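/- **Expected information matrix of the bivariate extended skew-normal distribution.** Let $\phi,\Phi$ be the standard normal density and distribution function, and let $\zeta_1(x)=\phi(x)/\Phi(x)$ and $\zeta_2(x)=\zeta_1'(x)=-(x\,\zeta_1(x)+\zeta_1(x)^2)$, the first two derivatives of $\log\Phi$. For $\xi,\alpha\in\mathbb R^2$, $\tau\in\mathbb R$ and a symmetric positive definite matrix $\Omega\in\mathbb R^{2\times2}$, put $\omega=\mathrm{diag}(\Omega_{11},\Omega_{22})^{1/2}$ and $\bar\Omega=\omega^{-1}\Omega\omega^{-1}$. The law $\mathrm{ESN}_2(\xi,\Omega,\alpha,\tau)$ has density $$f(y;\xi,\Omega,\alpha,\tau)=\phi_2(y-\xi;\Omega)\,\frac{\Phi\big(\tau\sqrt{1+\alpha^T\bar\Omega\alpha}+\alpha^T\omega^{-1}(y-\xi)\big)}{\Phi(\tau)},\qquad y\in\mathbb R^2,$$ where $\phi_2(\cdot\,;\Omega)$ is the $\mathrm N_2(0,\Omega)$ density. Let $\theta=(\xi_1,\xi_2,\Omega_{11},\Omega_{12},\Omega_{22},\alpha_1,\alpha_2,\tau)$ with $\Omega$ positive definite, let $\ell(\theta;y)=\log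 f(y;\xi,\Omega,\alpha,\tau)$, and let $i(\theta)$ be the $8\times8$ matrix with entries $i_{rs}=-\mathbb E\big[\partial^2\ell(\theta;Y)/\partial\theta_r\partial\theta_s\big]$, where $Y\sim\mathrm{ESN}_2(\xi,\Omega,\alpha,\tau)$. Put $$\lambda=\frac{\Omega_{12}}{\sqrt{\Omega_{11}\Omega_{22}}},\quad \alpha_*^2=\alpha^T\bar\Omega\alpha=\alpha_1^2+\alpha_2^2+2\alpha_1\alpha_2\lambda,\quad \alpha_0=\tau\sqrt{1+\alpha_*^2},\quad \delta=\frac{\bar\Omega\alpha}{\sqrt{1+\alpha_*^2}},\quad V=(v_{ij})=\bar\Omega-\delta\delta^T,$$ so that $\delta_1=(\alpha_1+\alpha_2\lambda)/\sqrt{1+\alpha_*^2}$, $\delta_2=(\alpha_2+\alpha_1\lambda)/\sqrt{1+\alpha_*^2}$, $v_{11}=1-\delta_1^2$, $v_{22}=1-\delta_2^2$, $v_{12}=\lambda-\delta_1\delta_2$. Let $Z\sim\mathrm{ESN}_2(0,\bar\Omega,\alpha,\tau)$, $T=\alpha_0+\alpha_1Z_1+\alpha_2Z_2$, and $$a_0=\mathbb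 E[\zeta_1(T)^2],\qquad a_{j,p}=\mathbb E[Z_j^p\,\zeta_1(T)^2],\qquad a_{ij}=\mathbb E[Z_iZ_j\,\zeta_1(T)^2]\qquad(i,j\in\{1,2\},\ p\in\{0,1,2\}).$$ Then $\ell(\cdot\,;y)$ is twice continuously differentiable at $\theta$ for every $y$, the density $f$ integrates to $1$, all expectations above and below exist and are finite, and with $c=\zeta_1(\tau)/\sqrt{1+\alpha_*^2}$, $$\mathbb E[Z_j]=\zeta_1(\tau)\delta_j,\quad \mathbb E[Z_1Z_2]=\lambda+\delta_1\delta_2[\zeta_2(\tau)+\zeta_1(\tau)^2],\quad \mathbb E[Z_j^2]=1+\delta_j^2[\zeta_2(\tau)+\zeta_1(\tau)^2],$$ $$\mathbb E[\zeta_1(T)]=c,\qquad \mathbb E[Z_j\zeta_1(T)]=-\tau\delta_j\,c,\qquad \mathbb E[\zeta_2(T)]=-(\alpha_0-\tau\alpha^T\delta)\,c-a_0,$$ and for $j\in\{1,2\}$ and $k=3-j$, $$\mathbb E[Z_j\zeta_2(T)]=-\big[-\alpha_0\tau\delta_j+\alpha_j(\tau^2\delta_j^2+v_{jj})+\alpha_k(\tau^2\delta_1\delta_2+v_{12})\big]c-a_{j,1},$$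 $$\mathbb E[Z_j^2\zeta_2(T)]=-\Big[\alpha_0(v_{jj}+\tau^2\delta_j^2)-\alpha_j\tau\delta_j(\tau^2\delta_j^2+3v_{jj})+\alpha_k\tau\Big(\frac{v_{12}}{v_{jj}}\delta_j-\delta_k\Big)(\tau^2\delta_j^2+v_{jj})-\alpha_k\tau\delta_j\frac{v_{12}}{v_{jj}}(\tau^2\delta_j^2+3v_{jj})\Big]c-a_{j,2},$$ $$\mathbb E[Z_1Z_2\zeta_2(T)]=-\Big[\alpha_0(v_{12}+\tau^2\delta_1\delta_2)+\alpha_1\tau\Big(\frac{v_{12}}{v_{11}}\delta_1-\delta_2\Big)(\tau^2\delta_1^2+v_{11})-\alpha_1\tau\delta_1\frac{v_{12}}{v_{11}}(\tau^2\delta_1^2+3v_{11})+\alpha_2\tau\Big(\frac{v_{12}}{v_{22}}\delta_2-\delta_1\Big)(\tau^2\delta_2^2+v_{22})-\alpha_2\tau\delta_2\frac{v_{12}}{v_{22}}(\tau^2\delta_2^2+3v_{22})\Big]c-a_{12}.$$ The matrix $i(\theta)$ is symmetric and positive semidefinite, and its entries on and above the diagonal are, with the expectations given by the expressions just listed, $$i_{11}=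 \frac{1}{\Omega_{11}}[ \frac{1}{1-\lambda^2} - \alpha^2_{1} \mathbb{E}[\zeta_{2}(T)] ]$$ $$i_{12}= -\frac{1}{\sqrt{\Omega_{11}\Omega_{22}}} [ \frac{\lambda}{1-\lambda^2} + \alpha_1\alpha_2 \mathbb{E}[\zeta_{2}(T)] ]$$ $$i_{13}= -\frac{\lambda \mathbb{E}[Z_2]-\mathbb{E}[Z_1]}{(1-\lambda^{2})^{2}\Omega^{3/2}_{11}} -\frac{\alpha_1}{2\Omega^{3/2}_{11}} \mathbb{E}[\zeta_1(T)]-\frac{\alpha_1}{2\Omega^{3/2}_{11}} ( \frac{\alpha_1\alpha_2\lambda\tau}{\sqrt{1+\alpha^2_*}}\mathbb{E}[\zeta_2(T)]+\alpha_1 \mathbb{E}[Z_1\zeta_2(T)] )$$ $$i_{14}= \frac{2\lambda(\lambda\mathbb{E}[Z_2]-\mathbb{E}[Z_1] )} {(1-\lambda^2)^2 \Omega_{11}\sqrt{\Omega_{22}}} + \frac{\mathbb{E}[Z_2]}{(1-\lambda^2) \Omega_{11}\sqrt{\Omega_{22}}} +\frac{\alpha^2_1\alpha_2\tau}{\Omega_{11}\sqrt{\Omega_{22}}\sqrt{1+\alpha^2_*}}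 \mathbb{E}[\zeta_2(T)]$$ $$i_{15}= - \frac{\lambda(\mathbb{E}[Z_2]-\mathbb{E}[Z_1]\lambda)}{(1-\lambda^2)^2\Omega_{22}\sqrt{\Omega_{11}}} -\frac{\alpha_1}{2\Omega_{22}\sqrt{\Omega_{11}}} ( \frac{\alpha_1\alpha_2\lambda\tau}{\sqrt{1+\alpha^2_*}}\mathbb{E}[\zeta_2(T)] + \alpha_2 \mathbb{E}[Z_2\zeta_2(T)])$$ $$i_{16}= \frac{\alpha_1}{\sqrt{\Omega_{11}}}[\frac{(\alpha_1+\lambda\alpha_2)\tau} {\sqrt{1+\alpha^2_*}}\mathbb{E}[\zeta_2(T)]+\mathbb{E}[Z_1\zeta_2(T)]] +\frac{1}{\sqrt{\Omega_{11}}} \mathbb{E}[\zeta_1(T)]$$ $$i_{17}= \frac{\alpha_1}{\sqrt{\Omega_{11}}} [\frac{(\alpha_2+\lambda\alpha_1)\tau}{\sqrt{1+\alpha^2_*}}\mathbb{E}[\zeta_2(T)]+\mathbb{E}[Z_2\zeta_2(T)]]$$ $$i_{18}= \frac{\alpha_1\sqrt{1+\alpha^2_*}}{\sqrt{\Omega_{11}}}\mathbb{E}[\zeta_2(T)]$$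 $$i_{22}= \frac{1}{\Omega_{22}}[ \frac{1}{1-\lambda^2} - \alpha^2_{2} \mathbb{E}[\zeta_2(T)] ]$$ $$i_{23}= - \frac{\lambda(\mathbb{E}[Z_1]-\mathbb{E}[Z_2]\lambda)}{(1-\lambda^2)^2\Omega_{11}\sqrt{\Omega_{22}}} -\frac{\alpha_2}{2\Omega_{11}\sqrt{\Omega_{22}}} ( \frac{\alpha_1\alpha_2\lambda\tau}{\sqrt{1+\alpha^2_*}}\mathbb{E}[\zeta_2(T)] +\alpha_1 \mathbb{E}[Z_1\zeta_2(T)])$$ $$i_{24}= \frac{2\lambda(\lambda \mathbb{E}[Z_1]-\mathbb{E}[Z_2])} {(1-\lambda^2)^2 \Omega_{22}\sqrt{\Omega_{11}}} + \frac{\mathbb{E}[Z_1]}{(1-\lambda^2) \Omega_{22}\sqrt{\Omega_{11}}} +\frac{\alpha^2_2\alpha_1\tau}{\Omega_{22}\sqrt{\Omega_{11}}\sqrt{1+\alpha^2_*}} \mathbb{E}[\zeta_2(T)]$$ $$i_{25}= -\frac{\lambda\mathbb{E}[Z_1]-\mathbb{E}[Z_2]}{(1-\lambda^{2})^{2}\Omega^{3/2}_{22}}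 -\frac{\alpha_2}{2\Omega^{3/2}_{22}}\mathbb{E}[\zeta_1(T)]-\frac{\alpha_2}{2\Omega^{3/2}_{22}} ( \frac{\alpha_1\alpha_2\lambda\tau}{\sqrt{1+\alpha^2_*}}\mathbb{E}[\zeta_2(T)] +\alpha_2 \mathbb{E}[Z_2\zeta_2(T)])$$ $$i_{26}= \frac{\alpha_2}{\sqrt{\Omega_{22}}} [\frac{(\alpha_1+\lambda\alpha_2)\tau}{\sqrt{1+\alpha^2_*}} \mathbb{E}[\zeta_2(T)] +\mathbb{E}[Z_1\zeta_2(T)] ]$$ $$i_{27}= \frac{\alpha_2}{\sqrt{\Omega_{22}}}[\frac{(\alpha_2+\lambda\alpha_1)\tau}{\sqrt{1+\alpha^2_*}}\mathbb{E}[\zeta_2(T)] +\mathbb{E}[Z_2\zeta_2(T)]]+\frac{1}{\sqrt{\Omega_{22}}}\mathbb{E}[\zeta_1(T)]$$ $$i_{28}= \frac{\alpha_2\sqrt{1+\alpha^2_*}}{\sqrt{\Omega_{22}}}\mathbb{E}[\zeta_2(T)]$$ $$i_{33}= - \frac{\lambda^2-\mathbb{E}[Z^2_1] +2\mathbb{E}[Z_1Z_2]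 \lambda}{\Omega^2_{11}(1-\lambda^{2})} - \frac{4\lambda^3\mathbb{E}[Z_1Z_2] -2\lambda^2 \mathbb{E}[Z^2_1] -\lambda^2\mathbb{E}[Z^2_2]}{\Omega^2_{11}(1-\lambda^{2})^{2}} -\frac{1}{4\Omega^2_{11}} ( \frac{3\alpha_1\alpha_2\tau\lambda}{\sqrt{1+\alpha^2_*}} \mathbb{E}[\zeta_1(T)] - \frac{\alpha^2_1\alpha^2_2\tau\lambda^2}{(1+\alpha^2_*)^{3/2}} \mathbb{E}[\zeta_1(T)] + 3\alpha_1 \mathbb{E}[Z_1\zeta_1(T)] ) -\frac{1}{4\Omega^2_{11}} ( \frac{\alpha^2_1\alpha^2_2\lambda^2\tau^2}{1+\alpha^2_*}\mathbb{E}[\zeta_2(T)] + \alpha^2_1\mathbb{E}[Z^2_1\zeta_2(T)]+ 2\frac{\alpha^2_1\alpha_2\lambda\tau}{\sqrt{1+\alpha^2_*}} \mathbb{E}[Z_1\zeta_2(T)] )+\frac{\lambda^4(\mathbb{E}[Z^2_1]+\mathbb{E}[Z^2_2]-2\mathbb{E}[Z_1Z_2]\lambda)}{\Omega^2_{11}(1-\lambda^{2})^{3}}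 - \frac{1}{2\Omega^2_{11}} - \frac{\lambda^4}{2\Omega^2_{11}(1-\lambda^{2})^{2}}$$ $$i_{34}= \frac{\lambda+\mathbb{E}[Z_1Z_2] }{(1-\lambda^{2}) \Omega^{3/2}_{11}\sqrt{\Omega_{22}}} - \frac{2\lambda \mathbb{E}[Z^2_1] + \lambda\mathbb{E}[Z^2_2] - 5\lambda^2 \mathbb{E}[Z_1Z_2] - \lambda^3} {(1-\lambda^{2})^2 \Omega^{3/2}_{11}\sqrt{\Omega_{22}}} -\frac{2\lambda^3(\mathbb{E}[Z^2_1]+\mathbb{E}[Z^2_2]-2\mathbb{E}[Z_1Z_2]\lambda)} {(1-\lambda^{2})^3\Omega^{3/2}_{11}\sqrt{\Omega_{22}}} -( \frac{\alpha^2_1\alpha^2_2\tau\lambda}{2\Omega^{3/2}_{11}\sqrt{\Omega_{22}} (1+\alpha^2_*)^{3/2} } - \frac{\alpha_1\alpha_2\tau}{2\Omega^{3/2}_{11}\sqrt{\Omega_{22}}\sqrt{1+\alpha^2_*}}) \mathbb{E}[\zeta_1(T)] +\frac{\alpha_1\alpha_2\tau}{2\Omega^{3/2}_{11}\sqrt{\Omega_{22}}\sqrt{1+\alpha^2_*}}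 ( \frac{\alpha_1\alpha_2\lambda\tau}{\sqrt{1+\alpha^2_*}}\mathbb{E}[\zeta_2(T)] + \alpha_1\mathbb{E}[Z_1\zeta_2(T)])$$ $$i_{35}= - \frac{\lambda^4 + 6\lambda^3\mathbb{E}[Z_1Z_2]-2\lambda^2\mathbb{E}[Z^2_1]-2\lambda^2\mathbb{E}[Z^2_2]} {2\Omega_{11}\Omega_{22} (1-\lambda^{2})^{2}} -\frac{\lambda^2}{2\Omega_{11}\Omega_{22}(1-\lambda^{2})} -\frac{\lambda\mathbb{E}[Z_1Z_2] }{\Omega_{11}\Omega_{22}(1-\lambda^2)} +\frac{\lambda^4(\mathbb{E}[Z^2_1]+\mathbb{E}[Z^2_2]-2\mathbb{E}[Z_1Z_2]\lambda)}{\Omega_{11}\Omega_{22}(1-\lambda^{2})^{3}} -\frac{\alpha_1\alpha_2\lambda\tau}{4\Omega_{11}\Omega_{22}\sqrt{1+\alpha^2_*}} ( 1 - \frac{\alpha_1\alpha_2\lambda}{1+\alpha^2_*}) \mathbb{E}[\zeta_1(T)] -\frac{\alpha_1\alpha_2}{4\Omega_{11}\Omega_{22}} ( \frac{\alpha_1\alpha_2\lambda^2\tau^2}{1+\alpha^2_*}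 \mathbb{E}[\zeta_2(T)] + \frac{\alpha_2\lambda\tau}{\sqrt{1+\alpha^2_*} } \mathbb{E}[Z_2\zeta_2(T)] +\frac{\alpha_1\lambda\tau}{\sqrt{1+\alpha^2_*} } \mathbb{E}[Z_1\zeta_2(T)] + \mathbb{E}[Z_1Z_2\zeta_2(T)] )$$ $$i_{36}= -\frac{1}{2\Omega_{11}}( \frac{\alpha_1\alpha_2\lambda(\alpha_2\lambda+\alpha_1)\tau} {(1+\alpha^2_*)^{3/2}}\mathbb{E}[\zeta_1(T)] -\frac{\alpha_2\lambda\tau}{\sqrt{1+\alpha^2_*}}\mathbb{E}[\zeta_1(T)] - \mathbb{E}[Z_1\zeta_1(T)] ) +\frac{1}{2\Omega_{11}} ( \frac{\alpha_1\alpha_2\lambda\tau^2 (\alpha_2\lambda+\alpha_1) }{1+\alpha^2_*} \mathbb{E}[\zeta_2(T)] + \frac{\alpha_1\alpha_2\lambda\tau }{\sqrt{1+\alpha^2_*}}\mathbb{E}[Z_1\zeta_2(T)]+\frac{\alpha_1(\alpha_2\lambda+\alpha_1)\tau}{\sqrt{1+\alpha^2_*}} \mathbb{E}[Z_1\zeta_2(T)]+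 \alpha_1 \mathbb{E}[Z_1^2\zeta_2(T)] )$$ $$i_{37}= -\frac{1}{2\Omega_{11}}( \frac{\alpha_1\alpha_2\lambda(\alpha_1\lambda+\alpha_2)\tau} {(1+\alpha^2_*)^{3/2}} -\frac{\alpha_1\lambda\tau}{\sqrt{1+\alpha^2_*}}) \mathbb{E}[\zeta_1(T)] +\frac{1}{2\Omega_{11}} ( \frac{\alpha_1\alpha_2\lambda\tau^2 (\alpha_2+\alpha_1\lambda) }{1+\alpha^2_*} \mathbb{E}[\zeta_2(T)] + \frac{\alpha_1\alpha_2\lambda\tau }{\sqrt{1+\alpha^2_*}}\mathbb{E}[Z_2\zeta_2(T)]+\frac{\alpha_1(\alpha_2+\alpha_1\lambda)\tau}{\sqrt{1+\alpha^2_*}} \mathbb{E}[Z_1\zeta_2(T)]+ \alpha_1 \mathbb{E}[Z_1Z_2\zeta_2(T)] )$$ $$i_{38}= \frac{\alpha_1\alpha_2\lambda}{2\Omega_{11}\sqrt{1+\alpha^2_*}} \mathbb{E}[\zeta_1(T)] +\frac{\sqrt{1+\alpha^2_*} }{2\Omega_{11}} ( \frac{\alpha_1\alpha_2\lambda\tau}{\sqrt{1+\alpha^2_*}}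 \mathbb{E}[\zeta_2(T)]+ \alpha_1\mathbb{E}[Z_1\zeta_2(T)] )$$ $$i_{44}= -\frac{1}{(1-\lambda^2)\Omega_{11}\Omega_{22}} - \frac{6\lambda \mathbb{E}[Z_1Z_2] -\mathbb{E}[Z^2_1] -\mathbb{E}[Z^2_2] +2\lambda^2 } {(1-\lambda^2)^2\Omega_{11}\Omega_{22}} +\frac{4\lambda^2(\mathbb{E}[Z^2_1] + \mathbb{E}[Z^2_2] -2 \mathbb{E}[Z_1Z_2] \lambda)}{(1-\lambda^2)^3\Omega_{11}\Omega_{22}} -\frac{\alpha^2_1\alpha^2_2\tau}{\Omega_{11}\Omega_{22} (1+\alpha^2_*)} ( \tau \mathbb{E}[\zeta_2(T)] - \frac{ \mathbb{E}[\zeta_1(T)] }{\sqrt{1+\alpha^2_*}} )$$ $$i_{45}= \frac{\lambda+\mathbb{E}[Z_1Z_2] }{(1-\lambda^{2}) \Omega^{3/2}_{22}\sqrt{\Omega_{11}}} - \frac{2\lambda \mathbb{E}[Z^2_2] + \lambda\mathbb{E}[Z^2_1] - 5\lambda^2 \mathbb{E}[Z_1Z_2] - \lambda^3} {(1-\lambda^{2})^2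 \Omega^{3/2}_{22}\sqrt{\Omega_{11}}} -\frac{2\lambda^3(\mathbb{E}[Z^2_1]+\mathbb{E}[Z^2_2]-2\mathbb{E}[Z_1Z_2]\lambda)} {(1-\lambda^{2})^3\Omega^{3/2}_{22}\sqrt{\Omega_{11}}} -( \frac{\alpha^2_1\alpha^2_2\tau\lambda}{2\Omega^{3/2}_{22}\sqrt{\Omega_{11}} (1+\alpha^2_*)^{3/2} } - \frac{\alpha_1\alpha_2\tau}{2\Omega^{3/2}_{22}\sqrt{\Omega_{11}}\sqrt{1+\alpha^2_*}}) \mathbb{E}[\zeta_1(T)] +\frac{\alpha_1\alpha_2\tau}{2\Omega^{3/2}_{22}\sqrt{\Omega_{11}}\sqrt{1+\alpha^2_*}} ( \frac{\alpha_1\alpha_2\lambda\tau}{\sqrt{1+\alpha^2_*}}\mathbb{E}[\zeta_2(T)] + \alpha_2\mathbb{E}[Z_2\zeta_2(T)])$$ $$i_{46}= - \frac{\alpha_2\tau}{\sqrt{\Omega_{11}\Omega_{22}} \sqrt{1+\alpha^2_*}} ( 1- \frac{\alpha_1(\alpha_2\lambda+\alpha_1)}{1+\alpha^2_*})\mathbb{E}[\zeta_1(T)]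 -\frac{\alpha_1\alpha_2\tau}{\sqrt{\Omega_{11}\Omega_{22}}\sqrt{1+\alpha^2_*}} ( \frac{(\alpha_1+\lambda\alpha_2)\tau}{\sqrt{1+\alpha^2_*}} \mathbb{E}[\zeta_2(T)]+\mathbb{E}[Z_1\zeta_2(T)] )$$ $$i_{47}= -\frac{\alpha_1\tau}{\sqrt{\Omega_{11}\Omega_{22}} \sqrt{1+\alpha^2_*}} ( 1- \frac{\alpha_2(\alpha_1\lambda+\alpha_2)}{1+\alpha^2_*})\mathbb{E}[\zeta_1(T)]-\frac{\alpha_1\alpha_2\tau}{\sqrt{\Omega_{11}\Omega_{22}}\sqrt{1+\alpha^2_*}} ( \frac{(\alpha_2+\lambda\alpha_1)\tau}{\sqrt{1+\alpha^2_*}} \mathbb{E}[\zeta_2(T)]+\mathbb{E}[Z_2\zeta_2(T)] )$$ $$i_{48}= -\frac{\alpha_1\alpha_2}{\sqrt{\Omega_{11}\Omega_{22}}} ( \frac{\mathbb{E}[\zeta_1(T)]}{\sqrt{1+\alpha^2_*}} +\tau\mathbb{E}[\zeta_2(T)] )$$ $$i_{55}= - \frac{\lambda^2-\mathbb{E}[Z^2_2]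 +2\mathbb{E}[Z_1Z_2] \lambda}{\Omega^2_{22}(1-\lambda^{2})} - \frac{4\lambda^3\mathbb{E}[Z_1Z_2] -2\lambda^2 \mathbb{E}[Z^2_2] -\lambda^2\mathbb{E}[Z^2_1]}{\Omega^2_{22}(1-\lambda^{2})^{2}} +\frac{\lambda^4(\mathbb{E}[Z^2_1]+\mathbb{E}[Z^2_2]-2\mathbb{E}[Z_1Z_2]\lambda)}{\Omega^2_{22}(1-\lambda^{2})^{3}} - \frac{1}{2\Omega^2_{22}} - \frac{\lambda^4}{2\Omega^2_{22}(1-\lambda^{2})^{2}} -\frac{1}{4\Omega^2_{22}} ( \frac{3\alpha_1\alpha_2\tau\lambda}{\sqrt{1+\alpha^2_*}} \mathbb{E}[\zeta_1(T)] - \frac{\alpha^2_1\alpha^2_2\tau\lambda^2}{(1+\alpha^2_*)^{3/2}} \mathbb{E}[\zeta_1(T)] + 3\alpha_2 \mathbb{E}[Z_2\zeta_1(T)] ) -\frac{1}{4\Omega^2_{22}} ( \frac{\alpha^2_1\alpha^2_2\lambda^2\tau^2}{1+\alpha^2_*}\mathbb{E}[\zeta_2(T)] + \alpha^2_2\mathbb{E}[Z^2_2\zeta_2(T)]+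 2\frac{\alpha_1\alpha^2_2\lambda\tau}{\sqrt{1+\alpha^2_*}} \mathbb{E}[Z_2\zeta_2(T)] )$$ $$i_{56}= -\frac{1}{2\Omega_{22}}( \frac{\alpha_1\alpha_2\lambda(\alpha_2\lambda+\alpha_1)\tau} {(1+\alpha^2_*)^{3/2}} -\frac{\alpha_2\lambda\tau}{\sqrt{1+\alpha^2_*}}) \mathbb{E}[\zeta_1(T)] +\frac{1}{2\Omega_{22}} ( \frac{\alpha_1\alpha_2\lambda\tau^2 (\alpha_1+\alpha_2\lambda) }{1+\alpha^2_*} \mathbb{E}[\zeta_2(T)] + \frac{\alpha_1\alpha_2\lambda\tau }{\sqrt{1+\alpha^2_*}}\mathbb{E}[Z_1\zeta_2(T)]+\frac{\alpha_2(\alpha_1+\alpha_2\lambda)\tau}{\sqrt{1+\alpha^2_*}} \mathbb{E}[Z_2\zeta_2(T)]+ \alpha_2 \mathbb{E}[Z_1Z_2\zeta_2(T)] )$$ $$i_{57}= -\frac{1}{2\Omega_{22}}( \frac{\alpha_1\alpha_2\lambda(\alpha_1\lambda+\alpha_2)\tau} {(1+\alpha^2_*)^{3/2}}\mathbb{E}[\zeta_1(T)]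 -\frac{\alpha_1\lambda\tau}{\sqrt{1+\alpha^2_*}}\mathbb{E}[\zeta_1(T)]- \mathbb{E}[Z_2\zeta_1(T)] ) +\frac{1}{2\Omega_{22}} ( \frac{\alpha_1\alpha_2\lambda\tau^2 (\alpha_1\lambda+\alpha_2) }{1+\alpha^2_*} \mathbb{E}[\zeta_2(T)] + \frac{\alpha_1\alpha_2\lambda\tau }{\sqrt{1+\alpha^2_*}}\mathbb{E}[Z_2\zeta_2(T)]+\frac{\alpha_2(\alpha_1\lambda+\alpha_2)\tau}{\sqrt{1+\alpha^2_*}} \mathbb{E}[Z_2\zeta_2(T)]+ \alpha_2 \mathbb{E}[Z_2^2\zeta_2(T)] )$$ $$i_{58}= \frac{\alpha_1\alpha_2\lambda}{2\Omega_{22}\sqrt{1+\alpha^2_*}} \mathbb{E}[\zeta_1(T)] +\frac{\sqrt{1+\alpha^2_*} }{2\Omega_{22}} ( \frac{\alpha_1\alpha_2\lambda\tau}{\sqrt{1+\alpha^2_*}} \mathbb{E}[\zeta_2(T)]+ \alpha_2\mathbb{E}[Z_2\zeta_2(T)] )$$ $$i_{66}= -( \frac{\tau}{\sqrt{1+\alpha^2_*}}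 - \frac{(\alpha_2\lambda+\alpha_1)^2\tau}{(1+\alpha^2_*)^{3/2}} ) \mathbb{E}[\zeta_1(T)] - \frac{(\alpha_1+\lambda\alpha_2)^2\tau^2}{1+\alpha^2_*} \mathbb{E}[\zeta_2(T)]- \mathbb{E}[Z^2_1\zeta_2(T)] - 2\frac{(\alpha_1+\lambda\alpha_2)\tau}{\sqrt{1+\alpha^2_*}}\mathbb{E}[Z_1\zeta_2(T)]$$ $$i_{67}= - ( \frac{\lambda\tau}{\sqrt{1+\alpha^2_*}} - \frac{(\alpha_2+\lambda\alpha_1)(\alpha_1+\lambda\alpha_2)\tau}{(1+\alpha^2_*)^{3/2}} ) \mathbb{E}[\zeta_1(T)] -\frac{(\alpha_1+\lambda\alpha_2)(\alpha_2+\lambda\alpha_1)\tau^2}{1+\alpha^2_*} \mathbb{E}[\zeta_2(T)] - \frac{(\alpha_1+\lambda\alpha_2)\tau}{\sqrt{1+\alpha^2_*}} \mathbb{E}[Z_2\zeta_2(T)] -\frac{(\alpha_2+\lambda\alpha_1)\tau}{\sqrt{1+\alpha^2_*}} \mathbb{E}[Z_1\zeta_2(T)] - \mathbb{E}[Z_1Z_2\zeta_2(T)]$$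 $$i_{68}= -\frac{\alpha_1+\lambda\alpha_2}{\sqrt{1+\alpha^2_*}} \mathbb{E}[\zeta_1(T)] -(\frac{(\alpha_1+\lambda\alpha_2)\tau}{\sqrt{1+\alpha^2_*}}\mathbb{E}[\zeta_2(T)]+\mathbb{E}[Z_1\zeta_2(T)]) \sqrt{1+\alpha^2_*}$$ $$i_{77}= - ( \frac{\tau}{\sqrt{1+\alpha^2_*}} - \frac{(\alpha_1\lambda+\alpha_2)^2\tau}{(1+\alpha^2_*)^{3/2}} ) \mathbb{E}[\zeta_1(T)] - \frac{(\alpha_2+\lambda\alpha_1)^2\tau^2}{1+\alpha^2_*} \mathbb{E}[\zeta_2(T)]-\mathbb{E}[Z^2_2\zeta_2(T)] - 2\frac{(\alpha_2+\lambda\alpha_1)\tau}{\sqrt{1+\alpha^2_*}}\mathbb{E}[Z_2\zeta_2(T)]$$ $$i_{78}= -\frac{\alpha_2+\lambda\alpha_1}{\sqrt{1+\alpha^2_*}} \mathbb{E}[\zeta_1(T)] -(\frac{(\alpha_2+\lambda\alpha_1)\tau}{\sqrt{1+\alpha^2_*}}\mathbb{E}[\zeta_2(T)]+\mathbb{E}[Z_2\zeta_2(T)])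 \sqrt{1+\alpha^2_*}$$ $$i_{88}= -(1+\alpha^2_*) \mathbb{E}[\zeta_2(T)]+\zeta_2(\tau)$$ -/

import Mathlib

open MeasureTheory ProbabilityTheory Matrix

noncomputable section

namespace ESN2

/-- Standard normal density. -/
def phi (x : ℝ) : ℝ := gaussianPDFReal 0 1 x

/-- Standard normal distribution function. -/
def Phi (x : ℝ) : ℝ := cdf (gaussianReal 0 1) x

/-- `ζ₁ = φ / Φ`, the first derivative of `log Φ`. -/
def zeta1 (x : ℝ) : ℝ := phi x / Phi x

/-- `ζ₂ = -(x ζ₁ + ζ₁²)`, the second derivative of `log Φ`. -/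
def zeta2 (x : ℝ) : ℝ := -(zeta1 x * x + zeta1 x ^ 2)

/-! ### The bivariate extended skew-normal distribution -/

/-- `ω⁻¹`, where `ω = diag(Ω₁₁, Ω₂₂)^{1/2}`. -/
def scaleInv (Ω : Matrix (Fin 2) (Fin 2) ℝ) : Matrix (Fin 2) (Fin 2) ℝ :=
  Matrix.diagonal fun i => (√(Ω i i))⁻¹

/-- The correlation matrix `ω⁻¹ Ω ω⁻¹`. -/
def corr (Ω : Matrix (Fin 2) (Fin 2) ℝ) : Matrix (Fin 2) (Fin 2) ℝ :=
  scaleInv Ω * Ω * scaleInv Ω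

/-- Density at `y` of the bivariate normal distribution `N(0, Ω)`. -/
def phi2 (Ω : Matrix (Fin 2) (Fin 2) ℝ) (y : Fin 2 → ℝ) : ℝ :=
  (2 * Real.pi * √Ω.det)⁻¹ * Real.exp (-(y ⬝ᵥ (Ω⁻¹ *ᵥ y)) / 2)

/-- Density of `ESN₂(ξ, Ω, α, τ)`. -/
def density (ξ : Fin 2 → ℝ) (Ω : Matrix (Fin 2) (Fin 2) ℝ) (α : Fin 2 → ℝ) (τ : ℝ)
    (y : Fin 2 → ℝ) : ℝ :=
  phi2 Ω (y - ξ) *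
    Phi (τ * √(1 + α ⬝ᵥ (corr Ω *ᵥ α)) + α ⬝ᵥ (scaleInv Ω *ᵥ (y - ξ))) / Phi τ

/-- The law `ESN₂(ξ, Ω, α, τ)`. -/
def law (ξ : Fin 2 → ℝ) (Ω : Matrix (Fin 2) (Fin 2) ℝ) (α : Fin 2 → ℝ) (τ : ℝ) :
    Measure (Fin 2 → ℝ) :=
  volume.withDensity fun y => ENNReal.ofReal (density ξ Ω α τ y)

/-! ### The parameter `θ = (ξ₁, ξ₂, Ω₁₁, Ω₁₂, Ω₂₂, α₁, α₂, τ)` -/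

abbrev Om11 (θ : Fin 8 → ℝ) : ℝ := θ 2
abbrev Om12 (θ : Fin 8 → ℝ) : ℝ := θ 3
abbrev Om22 (θ : Fin 8 → ℝ) : ℝ := θ 4
abbrev al1 (θ : Fin 8 → ℝ) : ℝ := θ 5
abbrev al2 (θ : Fin 8 → ℝ) : ℝ := θ 6
abbrev tau (θ : Fin 8 → ℝ) : ℝ := θ 7

def xi (θ : Fin 8 → ℝ) : Fin 2 → ℝ := ![θ 0, θ 1]

def Omega (θ : Fin 8 → ℝ) : Matrix (Fin 2) (Fin 2) ℝ := !![Om11 θ, Om12 θ; Om12 θ, Om22 θ]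

def alpha (θ : Fin 8 → ℝ) : Fin 2 → ℝ := ![al1 θ, al2 θ]

/-- The law of the observation `Y`. -/
def lawY (θ : Fin 8 → ℝ) : Measure (Fin 2 → ℝ) := law (xi θ) (Omega θ) (alpha θ) (tau θ)

/-- The law of the standardized variable `Z`. -/
def lawZ (θ : Fin 8 → ℝ) : Measure (Fin 2 → ℝ) := law 0 (corr (Omega θ)) (alpha θ) (tau θ)

/-- The log-likelihood of `θ` given one observation `y`. -/
def logLik (θ : Fin 8 → ℝ) (y : Fin 2 → ℝ) : ℝ :=
  Real.log (density (xi θ) (Omega θ) (alpha θ) (tau θ) y)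

/-- The partial derivative `∂F/∂θ_r` at `θ`. -/
def pderiv (r : Fin 8) (F : (Fin 8 → ℝ) → ℝ) (θ : Fin 8 → ℝ) : ℝ :=
  deriv (fun x => F (Function.update θ r x)) (θ r)

/-- The second partial derivative `∂²ℓ/∂θ_r∂θ_s` of the log-likelihood. -/
def hess (r s : Fin 8) (θ : Fin 8 → ℝ) (y : Fin 2 → ℝ) : ℝ :=
  pderiv r (pderiv s fun η => logLik η y) θ

/-- The expected Fisher information matrix, with entries `-E[∂²ℓ/∂θ_r∂θ_s]`. -/
def expectedInfo (θ : Fin 8 → ℝ) : Matrix (Fin 8) (Fin 8) ℝ :=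
  Matrix.of fun r s => -∫ y, hess r s θ y ∂(lawY θ)

/-- The expectation of `g` under `μ` exists and equals `c`. -/
def HasMean (μ : Measure (Fin 2 → ℝ)) (g : (Fin 2 → ℝ) → ℝ) (c : ℝ) : Prop :=
  Integrable g μ ∧ ∫ z, g z ∂μ = c

/-! ### The quantities in the explicit expressions -/

/-- `λ`, the correlation parameter. -/
def lam (θ : Fin 8 → ℝ) : ℝ := Om12 θ / √(Om11 θ * Om22 θ)

/-- `α*² = αᵀ Ω̄ α`. -/
def alphaStarSq (θ : Fin 8 → ℝ) : ℝ := al1 θ ^ 2 + al2 θ ^ 2 + 2 * al1 θ * al2 θ * lam θ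

/-- `√(1 + α*²)`. -/
def sStar (θ : Fin 8 → ℝ) : ℝ := √(1 + alphaStarSq θ)

def alpha0 (θ : Fin 8 → ℝ) : ℝ := tau θ * sStar θ

/-! `δ = (1 + α*²)^{-1/2} Ω̄ α`, componentwise. -/

def del1 (θ : Fin 8 → ℝ) : ℝ := (al1 θ + al2 θ * lam θ) / sStar θ

def del2 (θ : Fin 8 → ℝ) : ℝ := (al2 θ + al1 θ * lam θ) / sStar θ

/-! The entries of `V = Ω̄ - δ δᵀ`. -/

def v11 (θ : Fin 8 → ℝ) : ℝ := 1 - del1 θ ^ 2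

def v12 (θ : Fin 8 → ℝ) : ℝ := lam θ - del1 θ * del2 θ

def v22 (θ : Fin 8 → ℝ) : ℝ := 1 - del2 θ ^ 2

/-- `T = α₀ + αᵀ Z` as a function of `Z`. -/
def T (θ : Fin 8 → ℝ) (z : Fin 2 → ℝ) : ℝ := alpha0 θ + al1 θ * z 0 + al2 θ * z 1

/-- `a₀ = E[ζ₁(T)²]`. -/
def a0 (θ : Fin 8 → ℝ) : ℝ := ∫ z, zeta1 (T θ z) ^ 2 ∂(lawZ θ)

/-- `a_{j,p} = E[Z_j^p ζ₁(T)²]`; the components of `Z` are numbered `0`, `1` here. -/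
def aPow (θ : Fin 8 → ℝ) (j : Fin 2) (p : ℕ) : ℝ :=
  ∫ z, z j ^ p * zeta1 (T θ z) ^ 2 ∂(lawZ θ)

/-- `a_{ij} = E[Z_i Z_j ζ₁(T)²]`. -/
def aMix (θ : Fin 8 → ℝ) (i j : Fin 2) : ℝ :=
  ∫ z, z i * z j * zeta1 (T θ z) ^ 2 ∂(lawZ θ)

/-! The closed forms of the moments of `Z`, `ζ₁(T)` and `ζ₂(T)`. -/

def meanZ1 (θ : Fin 8 → ℝ) : ℝ :=
  zeta1 (tau θ) * del1 θ

def meanZ2 (θ : Fin 8 → ℝ) : ℝ :=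
  zeta1 (tau θ) * del2 θ

def meanZ1Z2 (θ : Fin 8 → ℝ) : ℝ :=
  lam θ + del1 θ * del2 θ * (zeta2 (tau θ) + zeta1 (tau θ) ^ 2)

def meanZ1Sq (θ : Fin 8 → ℝ) : ℝ :=
  1 + del1 θ ^ 2 * (zeta2 (tau θ) + zeta1 (tau θ) ^ 2)

def meanZ2Sq (θ : Fin 8 → ℝ) : ℝ :=
  1 + del2 θ ^ 2 * (zeta2 (tau θ) + zeta1 (tau θ) ^ 2)

def meanZeta1 (θ : Fin 8 → ℝ) : ℝ :=
  zeta1 (tau θ) / sStar θ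

def meanZ1Zeta1 (θ : Fin 8 → ℝ) : ℝ :=
  -tau θ * del1 θ * (zeta1 (tau θ) / sStar θ)

def meanZ2Zeta1 (θ : Fin 8 → ℝ) : ℝ :=
  -tau θ * del2 θ * (zeta1 (tau θ) / sStar θ)

def meanZeta2 (θ : Fin 8 → ℝ) : ℝ :=
  -(alpha0 θ - tau θ * (al1 θ * del1 θ + al2 θ * del2 θ)) * (zeta1 (tau θ) / sStar θ) -
    a0 θ

def meanZ1Zeta2 (θ : Fin 8 → ℝ) : ℝ :=
  -(-alpha0 θ * tau θ * del1 θ + al1 θ * (tau θ ^ 2 * del1 θ ^ 2 + v11 θ) + al2 θ *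
    (tau θ ^ 2 * del1 θ * del2 θ + v12 θ)) * (zeta1 (tau θ) / sStar θ) - aPow θ 0 1

def meanZ2Zeta2 (θ : Fin 8 → ℝ) : ℝ :=
  -(-alpha0 θ * tau θ * del2 θ + al2 θ * (tau θ ^ 2 * del2 θ ^ 2 + v22 θ) + al1 θ *
    (tau θ ^ 2 * del1 θ * del2 θ + v12 θ)) * (zeta1 (tau θ) / sStar θ) - aPow θ 1 1

def meanZ1SqZeta2 (θ : Fin 8 → ℝ) : ℝ :=
  -(alpha0 θ * (v11 θ + tau θ ^ 2 * del1 θ ^ 2) - al1 θ * tau θ * del1 θ * (tau θ ^ 2 *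
    del1 θ ^ 2 + 3 * v11 θ) + al2 θ * tau θ * (v12 θ / v11 θ * del1 θ - del2 θ) * (tau θ ^ 2
    * del1 θ ^ 2 + v11 θ) - al2 θ * tau θ * del1 θ * (v12 θ / v11 θ) * (tau θ ^ 2 *
    del1 θ ^ 2 + 3 * v11 θ)) * (zeta1 (tau θ) / sStar θ) - aPow θ 0 2

def meanZ2SqZeta2 (θ : Fin 8 → ℝ) : ℝ :=
  -(alpha0 θ * (v22 θ + tau θ ^ 2 * del2 θ ^ 2) - al2 θ * tau θ * del2 θ * (tau θ ^ 2 *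
    del2 θ ^ 2 + 3 * v22 θ) + al1 θ * tau θ * (v12 θ / v22 θ * del2 θ - del1 θ) * (tau θ ^ 2
    * del2 θ ^ 2 + v22 θ) - al1 θ * tau θ * del2 θ * (v12 θ / v22 θ) * (tau θ ^ 2 *
    del2 θ ^ 2 + 3 * v22 θ)) * (zeta1 (tau θ) / sStar θ) - aPow θ 1 2

def meanZ1Z2Zeta2 (θ : Fin 8 → ℝ) : ℝ :=
  -(alpha0 θ * (v12 θ + tau θ ^ 2 * del1 θ * del2 θ) + al1 θ * tau θ * (v12 θ / v11 θ *
    del1 θ - del2 θ) * (tau θ ^ 2 * del1 θ ^ 2 + v11 θ) - al1 θ * tau θ * del1 θ * (v12 θ /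
    v11 θ) * (tau θ ^ 2 * del1 θ ^ 2 + 3 * v11 θ) + al2 θ * tau θ * (v12 θ / v22 θ * del2 θ
    - del1 θ) * (tau θ ^ 2 * del2 θ ^ 2 + v22 θ) - al2 θ * tau θ * del2 θ * (v12 θ / v22 θ)
    * (tau θ ^ 2 * del2 θ ^ 2 + 3 * v22 θ)) * (zeta1 (tau θ) / sStar θ) - aMix θ 0 1

/-! Entries on and above the diagonal of the information matrix, indexed from 1. -/

def i11 (θ : Fin 8 → ℝ) : ℝ :=
  1 / Om11 θ * (1 / (1 - lam θ ^ 2) - al1 θ ^ 2 * meanZeta2 θ)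

def i12 (θ : Fin 8 → ℝ) : ℝ :=
  -(1 / √(Om11 θ * Om22 θ)) * (lam θ / (1 - lam θ ^ 2) + al1 θ * al2 θ * meanZeta2 θ)

def i13 (θ : Fin 8 → ℝ) : ℝ :=
  -((lam θ * meanZ2 θ - meanZ1 θ) / ((1 - lam θ ^ 2) ^ 2 * √(Om11 θ) ^ 3)) - al1 θ / (2 *
    √(Om11 θ) ^ 3) * meanZeta1 θ - al1 θ / (2 * √(Om11 θ) ^ 3) * (al1 θ * al2 θ * lam θ *
    tau θ / sStar θ * meanZeta2 θ + al1 θ * meanZ1Zeta2 θ)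

def i14 (θ : Fin 8 → ℝ) : ℝ :=
  2 * lam θ * (lam θ * meanZ2 θ - meanZ1 θ) / ((1 - lam θ ^ 2) ^ 2 * Om11 θ * √(Om22 θ)) +
    meanZ2 θ / ((1 - lam θ ^ 2) * Om11 θ * √(Om22 θ)) + al1 θ ^ 2 * al2 θ * tau θ / (Om11 θ
    * √(Om22 θ) * sStar θ) * meanZeta2 θ

def i15 (θ : Fin 8 → ℝ) : ℝ :=
  -(lam θ * (meanZ2 θ - meanZ1 θ * lam θ) / ((1 - lam θ ^ 2) ^ 2 * Om22 θ * √(Om11 θ))) -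
    al1 θ / (2 * Om22 θ * √(Om11 θ)) * (al1 θ * al2 θ * lam θ * tau θ / sStar θ *
    meanZeta2 θ + al2 θ * meanZ2Zeta2 θ)

def i16 (θ : Fin 8 → ℝ) : ℝ :=
  al1 θ / √(Om11 θ) * ((al1 θ + lam θ * al2 θ) * tau θ / sStar θ * meanZeta2 θ +
    meanZ1Zeta2 θ) + 1 / √(Om11 θ) * meanZeta1 θ

def i17 (θ : Fin 8 → ℝ) : ℝ :=
  al1 θ / √(Om11 θ) * ((al2 θ + lam θ * al1 θ) * tau θ / sStar θ * meanZeta2 θ +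
    meanZ2Zeta2 θ)

def i18 (θ : Fin 8 → ℝ) : ℝ :=
  al1 θ * sStar θ / √(Om11 θ) * meanZeta2 θ

def i22 (θ : Fin 8 → ℝ) : ℝ :=
  1 / Om22 θ * (1 / (1 - lam θ ^ 2) - al2 θ ^ 2 * meanZeta2 θ)

def i23 (θ : Fin 8 → ℝ) : ℝ :=
  -(lam θ * (meanZ1 θ - meanZ2 θ * lam θ) / ((1 - lam θ ^ 2) ^ 2 * Om11 θ * √(Om22 θ))) -
    al2 θ / (2 * Om11 θ * √(Om22 θ)) * (al1 θ * al2 θ * lam θ * tau θ / sStar θ *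
    meanZeta2 θ + al1 θ * meanZ1Zeta2 θ)

def i24 (θ : Fin 8 → ℝ) : ℝ :=
  2 * lam θ * (lam θ * meanZ1 θ - meanZ2 θ) / ((1 - lam θ ^ 2) ^ 2 * Om22 θ * √(Om11 θ)) +
    meanZ1 θ / ((1 - lam θ ^ 2) * Om22 θ * √(Om11 θ)) + al2 θ ^ 2 * al1 θ * tau θ / (Om22 θ
    * √(Om11 θ) * sStar θ) * meanZeta2 θ

def i25 (θ : Fin 8 → ℝ) : ℝ :=
  -((lam θ * meanZ1 θ - meanZ2 θ) / ((1 - lam θ ^ 2) ^ 2 * √(Om22 θ) ^ 3)) - al2 θ / (2 *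
    √(Om22 θ) ^ 3) * meanZeta1 θ - al2 θ / (2 * √(Om22 θ) ^ 3) * (al1 θ * al2 θ * lam θ *
    tau θ / sStar θ * meanZeta2 θ + al2 θ * meanZ2Zeta2 θ)

def i26 (θ : Fin 8 → ℝ) : ℝ :=
  al2 θ / √(Om22 θ) * ((al1 θ + lam θ * al2 θ) * tau θ / sStar θ * meanZeta2 θ +
    meanZ1Zeta2 θ)

def i27 (θ : Fin 8 → ℝ) : ℝ :=
  al2 θ / √(Om22 θ) * ((al2 θ + lam θ * al1 θ) * tau θ / sStar θ * meanZeta2 θ +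
    meanZ2Zeta2 θ) + 1 / √(Om22 θ) * meanZeta1 θ

def i28 (θ : Fin 8 → ℝ) : ℝ :=
  al2 θ * sStar θ / √(Om22 θ) * meanZeta2 θ

def i33 (θ : Fin 8 → ℝ) : ℝ :=
  -((lam θ ^ 2 - meanZ1Sq θ + 2 * meanZ1Z2 θ * lam θ) / (Om11 θ ^ 2 * (1 - lam θ ^ 2))) -
    (4 * lam θ ^ 3 * meanZ1Z2 θ - 2 * lam θ ^ 2 * meanZ1Sq θ - lam θ ^ 2 * meanZ2Sq θ) /
    (Om11 θ ^ 2 * (1 - lam θ ^ 2) ^ 2) - 1 / (4 * Om11 θ ^ 2) * (3 * al1 θ * al2 θ * tau θ *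
    lam θ / sStar θ * meanZeta1 θ - al1 θ ^ 2 * al2 θ ^ 2 * tau θ * lam θ ^ 2 / sStar θ ^ 3
    * meanZeta1 θ + 3 * al1 θ * meanZ1Zeta1 θ) - 1 / (4 * Om11 θ ^ 2) * (al1 θ ^ 2 *
    al2 θ ^ 2 * lam θ ^ 2 * tau θ ^ 2 / (1 + alphaStarSq θ) * meanZeta2 θ + al1 θ ^ 2 *
    meanZ1SqZeta2 θ + 2 * (al1 θ ^ 2 * al2 θ * lam θ * tau θ / sStar θ) * meanZ1Zeta2 θ) +
    lam θ ^ 4 * (meanZ1Sq θ + meanZ2Sq θ - 2 * meanZ1Z2 θ * lam θ) / (Om11 θ ^ 2 * (1 -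
    lam θ ^ 2) ^ 3) - 1 / (2 * Om11 θ ^ 2) - lam θ ^ 4 / (2 * Om11 θ ^ 2 * (1 -
    lam θ ^ 2) ^ 2)

def i34 (θ : Fin 8 → ℝ) : ℝ :=
  (lam θ + meanZ1Z2 θ) / ((1 - lam θ ^ 2) * √(Om11 θ) ^ 3 * √(Om22 θ)) - (2 * lam θ *
    meanZ1Sq θ + lam θ * meanZ2Sq θ - 5 * lam θ ^ 2 * meanZ1Z2 θ - lam θ ^ 3) / ((1 -
    lam θ ^ 2) ^ 2 * √(Om11 θ) ^ 3 * √(Om22 θ)) - 2 * lam θ ^ 3 * (meanZ1Sq θ + meanZ2Sq θ -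
    2 * meanZ1Z2 θ * lam θ) / ((1 - lam θ ^ 2) ^ 3 * √(Om11 θ) ^ 3 * √(Om22 θ)) - (al1 θ ^ 2
    * al2 θ ^ 2 * tau θ * lam θ / (2 * √(Om11 θ) ^ 3 * √(Om22 θ) * sStar θ ^ 3) - al1 θ *
    al2 θ * tau θ / (2 * √(Om11 θ) ^ 3 * √(Om22 θ) * sStar θ)) * meanZeta1 θ + al1 θ * al2 θ
    * tau θ / (2 * √(Om11 θ) ^ 3 * √(Om22 θ) * sStar θ) * (al1 θ * al2 θ * lam θ * tau θ /
    sStar θ * meanZeta2 θ + al1 θ * meanZ1Zeta2 θ)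

def i35 (θ : Fin 8 → ℝ) : ℝ :=
  -((lam θ ^ 4 + 6 * lam θ ^ 3 * meanZ1Z2 θ - 2 * lam θ ^ 2 * meanZ1Sq θ - 2 * lam θ ^ 2 *
    meanZ2Sq θ) / (2 * Om11 θ * Om22 θ * (1 - lam θ ^ 2) ^ 2)) - lam θ ^ 2 / (2 * Om11 θ *
    Om22 θ * (1 - lam θ ^ 2)) - lam θ * meanZ1Z2 θ / (Om11 θ * Om22 θ * (1 - lam θ ^ 2)) +
    lam θ ^ 4 * (meanZ1Sq θ + meanZ2Sq θ - 2 * meanZ1Z2 θ * lam θ) / (Om11 θ * Om22 θ * (1 -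
    lam θ ^ 2) ^ 3) - al1 θ * al2 θ * lam θ * tau θ / (4 * Om11 θ * Om22 θ * sStar θ) * (1 -
    al1 θ * al2 θ * lam θ / (1 + alphaStarSq θ)) * meanZeta1 θ - al1 θ * al2 θ / (4 * Om11 θ
    * Om22 θ) * (al1 θ * al2 θ * lam θ ^ 2 * tau θ ^ 2 / (1 + alphaStarSq θ) * meanZeta2 θ +
    al2 θ * lam θ * tau θ / sStar θ * meanZ2Zeta2 θ + al1 θ * lam θ * tau θ / sStar θ *
    meanZ1Zeta2 θ + meanZ1Z2Zeta2 θ)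

def i36 (θ : Fin 8 → ℝ) : ℝ :=
  -(1 / (2 * Om11 θ)) * (al1 θ * al2 θ * lam θ * (al2 θ * lam θ + al1 θ) * tau θ /
    sStar θ ^ 3 * meanZeta1 θ - al2 θ * lam θ * tau θ / sStar θ * meanZeta1 θ -
    meanZ1Zeta1 θ) + 1 / (2 * Om11 θ) * (al1 θ * al2 θ * lam θ * tau θ ^ 2 * (al2 θ * lam θ
    + al1 θ) / (1 + alphaStarSq θ) * meanZeta2 θ + al1 θ * al2 θ * lam θ * tau θ / sStar θ *
    meanZ1Zeta2 θ + al1 θ * (al2 θ * lam θ + al1 θ) * tau θ / sStar θ * meanZ1Zeta2 θ +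
    al1 θ * meanZ1SqZeta2 θ)

def i37 (θ : Fin 8 → ℝ) : ℝ :=
  -(1 / (2 * Om11 θ)) * (al1 θ * al2 θ * lam θ * (al1 θ * lam θ + al2 θ) * tau θ /
    sStar θ ^ 3 - al1 θ * lam θ * tau θ / sStar θ) * meanZeta1 θ + 1 / (2 * Om11 θ) * (al1 θ
    * al2 θ * lam θ * tau θ ^ 2 * (al2 θ + al1 θ * lam θ) / (1 + alphaStarSq θ) *
    meanZeta2 θ + al1 θ * al2 θ * lam θ * tau θ / sStar θ * meanZ2Zeta2 θ + al1 θ * (al2 θ +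
    al1 θ * lam θ) * tau θ / sStar θ * meanZ1Zeta2 θ + al1 θ * meanZ1Z2Zeta2 θ)

def i38 (θ : Fin 8 → ℝ) : ℝ :=
  al1 θ * al2 θ * lam θ / (2 * Om11 θ * sStar θ) * meanZeta1 θ + sStar θ / (2 * Om11 θ) *
    (al1 θ * al2 θ * lam θ * tau θ / sStar θ * meanZeta2 θ + al1 θ * meanZ1Zeta2 θ)

def i44 (θ : Fin 8 → ℝ) : ℝ :=
  -(1 / ((1 - lam θ ^ 2) * Om11 θ * Om22 θ)) - (6 * lam θ * meanZ1Z2 θ - meanZ1Sq θ -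
    meanZ2Sq θ + 2 * lam θ ^ 2) / ((1 - lam θ ^ 2) ^ 2 * Om11 θ * Om22 θ) + 4 * lam θ ^ 2 *
    (meanZ1Sq θ + meanZ2Sq θ - 2 * meanZ1Z2 θ * lam θ) / ((1 - lam θ ^ 2) ^ 3 * Om11 θ *
    Om22 θ) - al1 θ ^ 2 * al2 θ ^ 2 * tau θ / (Om11 θ * Om22 θ * (1 + alphaStarSq θ)) *
    (tau θ * meanZeta2 θ - meanZeta1 θ / sStar θ)

def i45 (θ : Fin 8 → ℝ) : ℝ :=
  (lam θ + meanZ1Z2 θ) / ((1 - lam θ ^ 2) * √(Om22 θ) ^ 3 * √(Om11 θ)) - (2 * lam θ *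
    meanZ2Sq θ + lam θ * meanZ1Sq θ - 5 * lam θ ^ 2 * meanZ1Z2 θ - lam θ ^ 3) / ((1 -
    lam θ ^ 2) ^ 2 * √(Om22 θ) ^ 3 * √(Om11 θ)) - 2 * lam θ ^ 3 * (meanZ1Sq θ + meanZ2Sq θ -
    2 * meanZ1Z2 θ * lam θ) / ((1 - lam θ ^ 2) ^ 3 * √(Om22 θ) ^ 3 * √(Om11 θ)) - (al1 θ ^ 2
    * al2 θ ^ 2 * tau θ * lam θ / (2 * √(Om22 θ) ^ 3 * √(Om11 θ) * sStar θ ^ 3) - al1 θ *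
    al2 θ * tau θ / (2 * √(Om22 θ) ^ 3 * √(Om11 θ) * sStar θ)) * meanZeta1 θ + al1 θ * al2 θ
    * tau θ / (2 * √(Om22 θ) ^ 3 * √(Om11 θ) * sStar θ) * (al1 θ * al2 θ * lam θ * tau θ /
    sStar θ * meanZeta2 θ + al2 θ * meanZ2Zeta2 θ)

def i46 (θ : Fin 8 → ℝ) : ℝ :=
  -(al2 θ * tau θ / (√(Om11 θ * Om22 θ) * sStar θ)) * (1 - al1 θ * (al2 θ * lam θ + al1 θ)
    / (1 + alphaStarSq θ)) * meanZeta1 θ - al1 θ * al2 θ * tau θ / (√(Om11 θ * Om22 θ) *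
    sStar θ) * ((al1 θ + lam θ * al2 θ) * tau θ / sStar θ * meanZeta2 θ + meanZ1Zeta2 θ)

def i47 (θ : Fin 8 → ℝ) : ℝ :=
  -(al1 θ * tau θ / (√(Om11 θ * Om22 θ) * sStar θ)) * (1 - al2 θ * (al1 θ * lam θ + al2 θ)
    / (1 + alphaStarSq θ)) * meanZeta1 θ - al1 θ * al2 θ * tau θ / (√(Om11 θ * Om22 θ) *
    sStar θ) * ((al2 θ + lam θ * al1 θ) * tau θ / sStar θ * meanZeta2 θ + meanZ2Zeta2 θ)

def i48 (θ : Fin 8 → ℝ) : ℝ :=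
  -(al1 θ * al2 θ / √(Om11 θ * Om22 θ)) * (meanZeta1 θ / sStar θ + tau θ * meanZeta2 θ)

def i55 (θ : Fin 8 → ℝ) : ℝ :=
  -((lam θ ^ 2 - meanZ2Sq θ + 2 * meanZ1Z2 θ * lam θ) / (Om22 θ ^ 2 * (1 - lam θ ^ 2))) -
    (4 * lam θ ^ 3 * meanZ1Z2 θ - 2 * lam θ ^ 2 * meanZ2Sq θ - lam θ ^ 2 * meanZ1Sq θ) /
    (Om22 θ ^ 2 * (1 - lam θ ^ 2) ^ 2) - 1 / (4 * Om22 θ ^ 2) * (3 * al1 θ * al2 θ * tau θ *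
    lam θ / sStar θ * meanZeta1 θ - al1 θ ^ 2 * al2 θ ^ 2 * tau θ * lam θ ^ 2 / sStar θ ^ 3
    * meanZeta1 θ + 3 * al2 θ * meanZ2Zeta1 θ) - 1 / (4 * Om22 θ ^ 2) * (al1 θ ^ 2 *
    al2 θ ^ 2 * lam θ ^ 2 * tau θ ^ 2 / (1 + alphaStarSq θ) * meanZeta2 θ + al2 θ ^ 2 *
    meanZ2SqZeta2 θ + 2 * (al1 θ * al2 θ ^ 2 * lam θ * tau θ / sStar θ) * meanZ2Zeta2 θ) +
    lam θ ^ 4 * (meanZ1Sq θ + meanZ2Sq θ - 2 * meanZ1Z2 θ * lam θ) / (Om22 θ ^ 2 * (1 -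
    lam θ ^ 2) ^ 3) - 1 / (2 * Om22 θ ^ 2) - lam θ ^ 4 / (2 * Om22 θ ^ 2 * (1 -
    lam θ ^ 2) ^ 2)

def i56 (θ : Fin 8 → ℝ) : ℝ :=
  -(1 / (2 * Om22 θ)) * (al1 θ * al2 θ * lam θ * (al2 θ * lam θ + al1 θ) * tau θ /
    sStar θ ^ 3 - al2 θ * lam θ * tau θ / sStar θ) * meanZeta1 θ + 1 / (2 * Om22 θ) * (al1 θ
    * al2 θ * lam θ * tau θ ^ 2 * (al1 θ + al2 θ * lam θ) / (1 + alphaStarSq θ) *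
    meanZeta2 θ + al1 θ * al2 θ * lam θ * tau θ / sStar θ * meanZ1Zeta2 θ + al2 θ * (al1 θ +
    al2 θ * lam θ) * tau θ / sStar θ * meanZ2Zeta2 θ + al2 θ * meanZ1Z2Zeta2 θ)

def i57 (θ : Fin 8 → ℝ) : ℝ :=
  -(1 / (2 * Om22 θ)) * (al1 θ * al2 θ * lam θ * (al1 θ * lam θ + al2 θ) * tau θ /
    sStar θ ^ 3 * meanZeta1 θ - al1 θ * lam θ * tau θ / sStar θ * meanZeta1 θ -
    meanZ2Zeta1 θ) + 1 / (2 * Om22 θ) * (al1 θ * al2 θ * lam θ * tau θ ^ 2 * (al1 θ * lam θ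
    + al2 θ) / (1 + alphaStarSq θ) * meanZeta2 θ + al1 θ * al2 θ * lam θ * tau θ / sStar θ *
    meanZ2Zeta2 θ + al2 θ * (al1 θ * lam θ + al2 θ) * tau θ / sStar θ * meanZ2Zeta2 θ +
    al2 θ * meanZ2SqZeta2 θ)

def i58 (θ : Fin 8 → ℝ) : ℝ :=
  al1 θ * al2 θ * lam θ / (2 * Om22 θ * sStar θ) * meanZeta1 θ + sStar θ / (2 * Om22 θ) *
    (al1 θ * al2 θ * lam θ * tau θ / sStar θ * meanZeta2 θ + al2 θ * meanZ2Zeta2 θ)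

def i66 (θ : Fin 8 → ℝ) : ℝ :=
  -(tau θ / sStar θ - (al2 θ * lam θ + al1 θ) ^ 2 * tau θ / sStar θ ^ 3) * meanZeta1 θ -
    (al1 θ + lam θ * al2 θ) ^ 2 * tau θ ^ 2 / (1 + alphaStarSq θ) * meanZeta2 θ -
    meanZ1SqZeta2 θ - 2 * ((al1 θ + lam θ * al2 θ) * tau θ / sStar θ) * meanZ1Zeta2 θ

def i67 (θ : Fin 8 → ℝ) : ℝ :=
  -(lam θ * tau θ / sStar θ - (al2 θ + lam θ * al1 θ) * (al1 θ + lam θ * al2 θ) * tau θ /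
    sStar θ ^ 3) * meanZeta1 θ - (al1 θ + lam θ * al2 θ) * (al2 θ + lam θ * al1 θ) *
    tau θ ^ 2 / (1 + alphaStarSq θ) * meanZeta2 θ - (al1 θ + lam θ * al2 θ) * tau θ /
    sStar θ * meanZ2Zeta2 θ - (al2 θ + lam θ * al1 θ) * tau θ / sStar θ * meanZ1Zeta2 θ -
    meanZ1Z2Zeta2 θ

def i68 (θ : Fin 8 → ℝ) : ℝ :=
  -((al1 θ + lam θ * al2 θ) / sStar θ) * meanZeta1 θ - ((al1 θ + lam θ * al2 θ) * tau θ /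
    sStar θ * meanZeta2 θ + meanZ1Zeta2 θ) * sStar θ

def i77 (θ : Fin 8 → ℝ) : ℝ :=
  -(tau θ / sStar θ - (al1 θ * lam θ + al2 θ) ^ 2 * tau θ / sStar θ ^ 3) * meanZeta1 θ -
    (al2 θ + lam θ * al1 θ) ^ 2 * tau θ ^ 2 / (1 + alphaStarSq θ) * meanZeta2 θ -
    meanZ2SqZeta2 θ - 2 * ((al2 θ + lam θ * al1 θ) * tau θ / sStar θ) * meanZ2Zeta2 θ

def i78 (θ : Fin 8 → ℝ) : ℝ :=
  -((al2 θ + lam θ * al1 θ) / sStar θ) * meanZeta1 θ - ((al2 θ + lam θ * al1 θ) * tau θ /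
    sStar θ * meanZeta2 θ + meanZ2Zeta2 θ) * sStar θ

def i88 (θ : Fin 8 → ℝ) : ℝ :=
  -(1 + alphaStarSq θ) * meanZeta2 θ + zeta2 (tau θ)

/-- The explicit `8 × 8` matrix, completed by symmetry below the diagonal. -/
def infoMatrix (θ : Fin 8 → ℝ) : Matrix (Fin 8) (Fin 8) ℝ :=
  !![i11 θ, i12 θ, i13 θ, i14 θ, i15 θ, i16 θ, i17 θ, i18 θ;
     i12 θ, i22 θ, i23 θ, i24 θ, i25 θ, i26 θ, i27 θ, i28 θ;
     i13 θ, i23 θ, i33 θ, i34 θ, i35 θ, i36 θ, i37 θ, i38 θ;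
     i14 θ, i24 θ, i34 θ, i44 θ, i45 θ, i46 θ, i47 θ, i48 θ;
     i15 θ, i25 θ, i35 θ, i45 θ, i55 θ, i56 θ, i57 θ, i58 θ;
     i16 θ, i26 θ, i36 θ, i46 θ, i56 θ, i66 θ, i67 θ, i68 θ;
     i17 θ, i27 θ, i37 θ, i47 θ, i57 θ, i67 θ, i77 θ, i78 θ;
     i18 θ, i28 θ, i38 θ, i48 θ, i58 θ, i68 θ, i78 θ, i88 θ]

end ESN2

end

/-!
# The expected information matrix of the bivariate extended skew-normal distribution

Everything about the law of `Z` follows from completing the square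
(`exponent_latent`, `normalDensity_latent`):
`√(1 + α*²) φ₂(z; Ω̄) φ(x √(1 + α*²) + αᵀ z) = φ(x) φ₂(z + x δ; V)`.
At `x = τ` it says that weighting the law of `Z` by `ζ₁(T)`, which replaces the factor `Φ(T)` of the
density by `φ(T)`, gives a multiple of `N(-τ δ, V)` (`lawZ_withDensity_zeta1`). Integrated over
`x ≤ τ` it says that `Z` is distributed as `C g - x δ`, where `C` is the Cholesky factor of `V`,
`g` is a pair of independent standard normal variables, and `x` is an independent standard normal
variable conditioned on `x ≤ τ` (`lawZ_eq_map`). So moments of `Z`, and moments weighted by `ζ₁(T)`,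
are moments of normal and truncated normal variables; `ζ₂(T) = -T ζ₁(T) - ζ₁(T)²` gives those
weighted by `ζ₂(T)` up to the quantities `a₀`, `a_{j,p}`, `a_{ij}`. All integrability questions are
settled by `ζ₁(x) ≤ e^{3/2} (1 + |x|)` (`zeta1_le`) and the existence of all moments of `Z`.

The law of `Y` is the image of that of `Z` under `z ↦ ξ + ω z` (`lawY_eq_map`). The derivatives of
the log-likelihood along directions `e` and `f` of the parameter space are computed once, for all
directions, in terms of the standardized observation (`hasDerivAt_logLik`, `hasDerivAt_dLogLik`).
The second derivative is a quadratic polynomial in `z`, plus an affine form times `ζ₁(T)`, plus a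
product of two affine forms times `ζ₂(T)`, so its expectation is read off from the moments
(`hasInt_ddLogLik`); for `e`, `f` unit vectors it agrees with the explicit entries
(`infoForm_eq_infoMatrix`).

The information is positive semidefinite because `t ↦ E_θ[ℓ(θ + t u; Y)]` is maximal at `t = 0` by
Gibbs' inequality (`integral_logLik_sub_le`), and its second derivative there, computed under the
integral sign, is `-uᵀ i(θ) u` (`infoForm_self_nonneg`). The domination this requires is polynomial
in `y`, locally uniformly in the parameter (`PolyBdd`).
-/

noncomputable section

namespace ESN2

/-! ### The functions `φ`, `Φ`, `ζ₁` and `ζ₂` -/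

lemma phi_eq (x : ℝ) : phi x = (√(2 * Real.pi))⁻¹ * Real.exp (-x ^ 2 / 2) := by
  simp [phi, gaussianPDFReal]

lemma phi_pos (x : ℝ) : 0 < phi x := gaussianPDFReal_pos _ _ _ one_ne_zero

lemma contDiff_phi {n : WithTop ℕ∞} : ContDiff ℝ n phi := by
  have : phi = fun x => (√(2 * Real.pi))⁻¹ * Real.exp (-x ^ 2 / 2) := funext phi_eq
  rw [this]
  fun_prop

lemma continuous_phi : Continuous phi := (contDiff_phi (n := 0)).continuous

lemma hasDerivAt_phi (x : ℝ) : HasDerivAt phi (-x * phi x) x := by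
  have : phi = fun x => (√(2 * Real.pi))⁻¹ * Real.exp (-x ^ 2 / 2) := funext phi_eq
  rw [this]
  have h : HasDerivAt (fun x : ℝ => -x ^ 2 / 2) (-x) x := by
    refine (((hasDerivAt_pow 2 x).neg).div_const 2).congr_deriv ?_
    simp; ring
  refine ((h.exp).const_mul _).congr_deriv ?_
  ring

lemma integrable_phi : Integrable phi := integrable_gaussianPDFReal 0 1

lemma gaussianReal_eq_withDensity_phi :
    gaussianReal 0 1 = volume.withDensity fun x => ENNReal.ofReal (phi x) :=
  gaussianReal_of_var_ne_zero 0 one_ne_zero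

lemma Phi_eq_integral (x : ℝ) : Phi x = ∫ t in Set.Iic x, phi t := by
  have h := gaussianReal_apply_eq_integral 0 (one_ne_zero (α := NNReal)) (Set.Iic x)
  rw [Phi, cdf_eq_real, measureReal_def, h, ENNReal.toReal_ofReal]
  · rfl
  · exact setIntegral_nonneg measurableSet_Iic fun t _ => gaussianPDFReal_nonneg _ _ _

lemma ofReal_Phi (x : ℝ) :
    ENNReal.ofReal (Phi x) = ∫⁻ t in Set.Iic x, ENNReal.ofReal (phi t) := by
  rw [Phi_eq_integral, ofReal_integral_eq_lintegral_ofReal integrable_phi.integrableOn]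
  exact Filter.Eventually.of_forall fun t => (phi_pos t).le

lemma hasDerivAt_Phi (x : ℝ) : HasDerivAt Phi (phi x) x := by
  have h : Phi = fun y => Phi 0 + ∫ t in (0 : ℝ)..y, phi t := by
    funext y
    rw [Phi_eq_integral, Phi_eq_integral, ← intervalIntegral.integral_Iic_sub_Iic
      integrable_phi.integrableOn integrable_phi.integrableOn]
    ring
  rw [h]
  exact ((intervalIntegral.integral_hasDerivAt_right
    (continuous_phi.intervalIntegrable _ _)
    (continuous_phi.stronglyMeasurableAtFilter _ _) continuous_phi.continuousAt).const_add _)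

lemma phi_le_mul_phi {x t : ℝ} (h₁ : x - (1 + |x|)⁻¹ ≤ t) (h₂ : t ≤ x) :
    Real.exp (-(3 / 2)) * phi x ≤ phi t := by
  have hx : 0 ≤ |x| := abs_nonneg x
  have h0 : (0 : ℝ) < 1 + |x| := by positivity
  obtain ⟨s, rfl⟩ : ∃ s, t = x - s := ⟨x - t, by ring⟩
  have hs0 : 0 ≤ s := by linarith
  have hs1 : s ≤ (1 + |x|)⁻¹ := by linarith
  have hs2 : s * (1 + |x|) ≤ 1 := by
    calc s * (1 + |x|) ≤ (1 + |x|)⁻¹ * (1 + |x|) := by gcongr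
      _ = 1 := inv_mul_cancel₀ h0.ne'
  rw [phi_eq, phi_eq, mul_left_comm, ← Real.exp_add]
  have : -(3 / 2) + -x ^ 2 / 2 ≤ -(x - s) ^ 2 / 2 := by
    have h3 : -x * s ≤ |x| * s := mul_le_mul_of_nonneg_right (neg_le_abs x) hs0
    have h4 : s ≤ 1 := by nlinarith
    nlinarith
  gcongr

lemma Phi_pos (x : ℝ) : 0 < Phi x := by
  rw [Phi_eq_integral]
  refine (setIntegral_pos_iff_support_of_nonneg_ae
    (Filter.Eventually.of_forall fun t => (phi_pos t).le) integrable_phi.integrableOn).2 ?_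
  have : Function.support phi = Set.univ := by
    ext t; simpa using (phi_pos t).ne'
  simp [this]

lemma zeta1_pos (x : ℝ) : 0 < zeta1 x := div_pos (phi_pos x) (Phi_pos x)

/-- A crude form of Mills' inequality: integrating `φ` over the window of length `1 / (1 + |x|)`
below `x`, on which it varies by a bounded factor only, bounds `Φ x` from below. -/
lemma zeta1_le (x : ℝ) : zeta1 x ≤ Real.exp (3 / 2) * (1 + |x|) := by
  have h0 : (0 : ℝ) < 1 + |x| := by positivity
  have hint : Real.exp (-(3 / 2)) * phi x * (1 + |x|)⁻¹ ≤ Phi x := by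
    rw [Phi_eq_integral]
    calc Real.exp (-(3 / 2)) * phi x * (1 + |x|)⁻¹
        = ∫ t in Set.Icc (x - (1 + |x|)⁻¹) x, Real.exp (-(3 / 2)) * phi x := by
          rw [setIntegral_const, measureReal_def, Real.volume_Icc, ENNReal.toReal_ofReal]
          · simp; ring
          · simp; positivity
      _ ≤ ∫ t in Set.Icc (x - (1 + |x|)⁻¹) x, phi t := by
          refine setIntegral_mono_on ?_ integrable_phi.integrableOn measurableSet_Icc ?_
          · exact integrableOn_const (by simp)
          · exact fun t ht => phi_le_mul_phi ht.1 ht.2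
      _ ≤ ∫ t in Set.Iic x, phi t := by
          refine setIntegral_mono_set integrable_phi.integrableOn
            (Filter.Eventually.of_forall fun t => (phi_pos t).le) ?_
          exact (Set.Icc_subset_Iic_self).eventuallyLE
  rw [zeta1, div_le_iff₀ (Phi_pos x)]
  calc phi x = Real.exp (3 / 2) * (1 + |x|) *
        (Real.exp (-(3 / 2)) * phi x * (1 + |x|)⁻¹) := by
        rw [Real.exp_neg]; field_simp
    _ ≤ _ := by gcongr

lemma abs_zeta1_le (x : ℝ) : |zeta1 x| ≤ Real.exp (3 / 2) * (1 + |x|) := by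
  rw [abs_of_pos (zeta1_pos x)]; exact zeta1_le x

lemma abs_zeta2_le (x : ℝ) : |zeta2 x| ≤ 2 * Real.exp 3 * (1 + |x|) ^ 2 := by
  have h1 := abs_zeta1_le x
  have he : Real.exp 3 = Real.exp (3 / 2) ^ 2 := by rw [← Real.exp_nat_mul]; norm_num
  have he1 : 1 ≤ Real.exp (3 / 2) := Real.one_le_exp (by norm_num)
  have hx := abs_nonneg x
  have hz := abs_nonneg (zeta1 x)
  calc |zeta2 x| ≤ |zeta1 x| * |x| + |zeta1 x| ^ 2 := by
        rw [zeta2, abs_neg, ← abs_mul, ← abs_pow]; exact abs_add_le _ _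
    _ ≤ (Real.exp (3 / 2) * (1 + |x|)) * (Real.exp (3 / 2) * (1 + |x|)) +
        (Real.exp (3 / 2) * (1 + |x|)) ^ 2 := by
        gcongr
        nlinarith
    _ = _ := by rw [he]; ring

lemma contDiff_Phi : ContDiff ℝ 2 Phi := by
  have hd : deriv Phi = phi := funext fun x => (hasDerivAt_Phi x).deriv
  have : ContDiff ℝ (1 + 1) Phi := by
    rw [contDiff_succ_iff_deriv]
    refine ⟨fun x => (hasDerivAt_Phi x).differentiableAt, by simp, ?_⟩
    rw [hd]; exact contDiff_phi
  simpa [one_add_one_eq_two] using this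

lemma continuous_Phi : Continuous Phi := contDiff_Phi.continuous

lemma contDiff_log_Phi : ContDiff ℝ 2 fun x => Real.log (Phi x) :=
  contDiff_Phi.log fun x => (Phi_pos x).ne'

lemma continuous_zeta1 : Continuous zeta1 :=
  continuous_phi.div continuous_Phi fun x => (Phi_pos x).ne'

lemma continuous_zeta2 : Continuous zeta2 := by
  unfold zeta2
  have := continuous_zeta1
  fun_prop

lemma hasDerivAt_log_Phi (x : ℝ) : HasDerivAt (fun t => Real.log (Phi t)) (zeta1 x) x :=
  (hasDerivAt_Phi x).log (Phi_pos x).ne'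

lemma hasDerivAt_zeta1 (x : ℝ) : HasDerivAt zeta1 (zeta2 x) x := by
  refine ((hasDerivAt_phi x).div (hasDerivAt_Phi x) (Phi_pos x).ne').congr_deriv ?_
  have := (Phi_pos x).ne'
  rw [zeta2, zeta1]
  field_simp
  ring

/-! ### The parameter region and its scalars -/

/-- The explicit form of positive definiteness of `Ω`; an open condition on `θ`. -/
def Admissible (θ : Fin 8 → ℝ) : Prop :=
  0 < Om11 θ ∧ 0 < Om22 θ ∧ Om12 θ ^ 2 < Om11 θ * Om22 θ

lemma admissible_of_posDef {θ : Fin 8 → ℝ} (h : (Omega θ).PosDef) : Admissible θ := by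
  have hd := h.det_pos
  have h0 := h.diag_pos (i := 0)
  have h1 := h.diag_pos (i := 1)
  simp [Omega, Matrix.det_fin_two] at hd h0 h1
  exact ⟨h0, h1, by nlinarith⟩

lemma isOpen_admissible : IsOpen {θ | Admissible θ} := by
  simp only [Admissible, Set.ofPred_and]
  refine (isOpen_lt ?_ ?_).inter ((isOpen_lt ?_ ?_).inter (isOpen_lt ?_ ?_)) <;> fun_prop

section Scalars

variable {θ : Fin 8 → ℝ}

lemma sq_lam_lt_one (h : Admissible θ) : lam θ ^ 2 < 1 := by
  obtain ⟨h1, h2, h3⟩ := h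
  rw [lam, div_pow, Real.sq_sqrt (by positivity), div_lt_one (by positivity)]
  exact h3

lemma alphaStarSq_nonneg (h : Admissible θ) : 0 ≤ alphaStarSq θ := by
  have := sq_lam_lt_one h
  have e : alphaStarSq θ = (al1 θ + al2 θ * lam θ) ^ 2 + al2 θ ^ 2 * (1 - lam θ ^ 2) := by
    rw [alphaStarSq]; ring
  rw [e]
  have : 0 ≤ 1 - lam θ ^ 2 := by linarith
  positivity

lemma sStar_pos (h : Admissible θ) : 0 < sStar θ :=
  Real.sqrt_pos.2 (by linarith [alphaStarSq_nonneg h])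

lemma sStar_sq (h : Admissible θ) : sStar θ ^ 2 = 1 + alphaStarSq θ :=
  Real.sq_sqrt (by linarith [alphaStarSq_nonneg h])

lemma sStar_mul_del1 (h : Admissible θ) : sStar θ * del1 θ = al1 θ + al2 θ * lam θ :=
  mul_div_cancel₀ _ (sStar_pos h).ne'

lemma sStar_mul_del2 (h : Admissible θ) : sStar θ * del2 θ = al2 θ + al1 θ * lam θ :=
  mul_div_cancel₀ _ (sStar_pos h).ne'

/-- `det V = det Ω̄ / (1 + α*²)`. -/
lemma sStar_sq_mul_detV (h : Admissible θ) :
    sStar θ ^ 2 * (v11 θ * v22 θ - v12 θ ^ 2) = 1 - lam θ ^ 2 := by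
  have e1 := sStar_mul_del1 h
  have e2 := sStar_mul_del2 h
  have e3 := sStar_sq h
  rw [alphaStarSq] at e3
  have : sStar θ ^ 2 * (v11 θ * v22 θ - v12 θ ^ 2) = sStar θ ^ 2 * (1 - lam θ ^ 2) -
      (sStar θ * del1 θ) ^ 2 - (sStar θ * del2 θ) ^ 2 +
      2 * lam θ * (sStar θ * del1 θ) * (sStar θ * del2 θ) := by
    rw [v11, v22, v12]; ring
  rw [this, e1, e2, e3]
  ring

lemma v11_pos (h : Admissible θ) : 0 < v11 θ := by
  have e1 := sStar_mul_del1 h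
  have e3 := sStar_sq h
  rw [alphaStarSq] at e3
  have hs := sStar_pos h
  have : sStar θ ^ 2 * v11 θ = 1 + al2 θ ^ 2 * (1 - lam θ ^ 2) := by
    have : sStar θ ^ 2 * v11 θ = sStar θ ^ 2 - (sStar θ * del1 θ) ^ 2 := by rw [v11]; ring
    rw [this, e1, e3]; ring
  have h2 : 0 ≤ 1 - lam θ ^ 2 := by linarith [sq_lam_lt_one h]
  have : 0 < sStar θ ^ 2 * v11 θ := by rw [this]; positivity
  exact pos_of_mul_pos_right this (by positivity)

lemma v22_pos (h : Admissible θ) : 0 < v22 θ := by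
  have e1 := sStar_mul_del2 h
  have e3 := sStar_sq h
  rw [alphaStarSq] at e3
  have hs := sStar_pos h
  have : sStar θ ^ 2 * v22 θ = 1 + al1 θ ^ 2 * (1 - lam θ ^ 2) := by
    have : sStar θ ^ 2 * v22 θ = sStar θ ^ 2 - (sStar θ * del2 θ) ^ 2 := by rw [v22]; ring
    rw [this, e1, e3]; ring
  have h2 : 0 ≤ 1 - lam θ ^ 2 := by linarith [sq_lam_lt_one h]
  have : 0 < sStar θ ^ 2 * v22 θ := by rw [this]; positivity
  exact pos_of_mul_pos_right this (by positivity)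

end Scalars

/-! ### The density in standardized coordinates -/

/-- The density of `N(0, Ω̄)`. -/
def normalDensity (θ : Fin 8 → ℝ) (z : Fin 2 → ℝ) : ℝ :=
  (2 * Real.pi * √(1 - lam θ ^ 2))⁻¹ *
    Real.exp (-((z 0 ^ 2 - 2 * lam θ * z 0 * z 1 + z 1 ^ 2) / (1 - lam θ ^ 2)) / 2)

lemma normalDensity_pos {θ : Fin 8 → ℝ} (h : Admissible θ) (z : Fin 2 → ℝ) :
    0 < normalDensity θ z := by
  have : 0 < 1 - lam θ ^ 2 := by linarith [sq_lam_lt_one h]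
  have := Real.pi_pos
  unfold normalDensity
  positivity

lemma continuous_normalDensity (θ : Fin 8 → ℝ) : Continuous (normalDensity θ) := by
  unfold normalDensity; fun_prop

lemma continuous_T (θ : Fin 8 → ℝ) : Continuous (T θ) := by
  unfold T; fun_prop

/-- The standardized observation `ω⁻¹ (y - ξ)`. -/
def stdize (θ : Fin 8 → ℝ) (y : Fin 2 → ℝ) : Fin 2 → ℝ :=
  ![(y 0 - θ 0) / √(Om11 θ), (y 1 - θ 1) / √(Om22 θ)]

lemma corr_Omega {θ : Fin 8 → ℝ} (h : Admissible θ) :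
    corr (Omega θ) = !![1, lam θ; lam θ, 1] := by
  obtain ⟨h1, h2, -⟩ := h
  have e1 := Real.sq_sqrt h1.le
  have e2 := Real.sq_sqrt h2.le
  have p1 := Real.sqrt_pos.2 h1
  have p2 := Real.sqrt_pos.2 h2
  ext i j
  fin_cases i <;> fin_cases j <;>
    simp [corr, scaleInv, Omega, lam, Matrix.mul_apply, Matrix.diagonal,
      Real.sqrt_mul h1.le] <;> field_simp <;> first | exact e1.symm | exact e2.symm

lemma corr_corr {θ : Fin 8 → ℝ} (h : Admissible θ) :
    corr (corr (Omega θ)) = !![1, lam θ; lam θ, 1] := by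
  rw [corr_Omega h]
  ext i j
  fin_cases i <;> fin_cases j <;>
    simp [corr, scaleInv, Matrix.mul_apply, Matrix.diagonal]

lemma density_stdized {θ : Fin 8 → ℝ} (h : Admissible θ) (z : Fin 2 → ℝ) :
    density 0 (corr (Omega θ)) (alpha θ) (tau θ) z =
      normalDensity θ z * Phi (T θ z) / Phi (tau θ) := by
  have hl : 1 - lam θ ^ 2 ≠ 0 := by linarith [sq_lam_lt_one h]
  have h1 : 1 + alpha θ ⬝ᵥ (corr (corr (Omega θ)) *ᵥ alpha θ) = 1 + alphaStarSq θ := by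
    rw [corr_corr h]
    simp [alpha, Matrix.mulVec, dotProduct, Fin.sum_univ_two, alphaStarSq]
    ring
  have h2 : alpha θ ⬝ᵥ (scaleInv (corr (Omega θ)) *ᵥ (z - 0)) =
      al1 θ * z 0 + al2 θ * z 1 := by
    rw [corr_Omega h]
    simp [alpha, scaleInv, Matrix.mulVec, dotProduct, Fin.sum_univ_two, Matrix.diagonal]
  have h3 : phi2 (corr (Omega θ)) (z - 0) = normalDensity θ z := by
    rw [corr_Omega h]
    simp only [phi2, normalDensity, Matrix.inv_def, Matrix.det_fin_two_of,
      Matrix.adjugate_fin_two_of, sub_zero, Ring.inverse_eq_inv']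
    have : (1 : ℝ) * 1 - lam θ * lam θ = 1 - lam θ ^ 2 := by ring
    rw [this]
    congr 2
    simp [Matrix.mulVec, dotProduct, Fin.sum_univ_two]
    field_simp
    ring
  rw [density, h1, h2, h3, T, alpha0, sStar]
  ring_nf

lemma density_eq_stdized {θ : Fin 8 → ℝ} (h : Admissible θ) (y : Fin 2 → ℝ) :
    density (xi θ) (Omega θ) (alpha θ) (tau θ) y =
      (√(Om11 θ) * √(Om22 θ))⁻¹ *
        density 0 (corr (Omega θ)) (alpha θ) (tau θ) (stdize θ y) := by
  have hl : 0 < 1 - lam θ ^ 2 := by linarith [sq_lam_lt_one h]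
  rw [density_stdized h]
  have h1 : 1 + alpha θ ⬝ᵥ (corr (Omega θ) *ᵥ alpha θ) = 1 + alphaStarSq θ := by
    rw [corr_Omega h]
    simp [alpha, Matrix.mulVec, dotProduct, Fin.sum_univ_two, alphaStarSq]
    ring
  have h2 : alpha θ ⬝ᵥ (scaleInv (Omega θ) *ᵥ (y - xi θ)) =
      al1 θ * stdize θ y 0 + al2 θ * stdize θ y 1 := by
    simp [alpha, scaleInv, Matrix.mulVec, dotProduct, Fin.sum_univ_two, Matrix.diagonal,
      Omega, xi, stdize]
    ring
  obtain ⟨p1, p2, p3⟩ := h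
  have q1 := Real.sqrt_pos.2 p1
  have q2 := Real.sqrt_pos.2 p2
  have e1 := Real.sq_sqrt p1.le
  have e2 := Real.sq_sqrt p2.le
  have e3 : Om12 θ = lam θ * (√(Om11 θ) * √(Om22 θ)) := by
    rw [lam, Real.sqrt_mul p1.le]; field_simp
  have hdet : (Omega θ).det = (√(Om11 θ) * √(Om22 θ)) ^ 2 * (1 - lam θ ^ 2) := by
    rw [Omega, Matrix.det_fin_two_of, e3, mul_pow, e1, e2]
    have : Om11 θ * Om22 θ = (√(Om11 θ) * √(Om22 θ)) ^ 2 := by rw [mul_pow, e1, e2]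
    rw [this]; ring
  have h3 : phi2 (Omega θ) (y - xi θ) =
      (√(Om11 θ) * √(Om22 θ))⁻¹ * normalDensity θ (stdize θ y) := by
    have hc : (2 * Real.pi * √(Omega θ).det)⁻¹ =
        (√(Om11 θ) * √(Om22 θ))⁻¹ * (2 * Real.pi * √(1 - lam θ ^ 2))⁻¹ := by
      rw [hdet, Real.sqrt_mul (by positivity), Real.sqrt_sq (by positivity), ← mul_inv]
      congr 1
      ring
    have hq : (y - xi θ) ⬝ᵥ ((Omega θ)⁻¹ *ᵥ (y - xi θ)) =
        (stdize θ y 0 ^ 2 - 2 * lam θ * stdize θ y 0 * stdize θ y 1 + stdize θ y 1 ^ 2) /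
          (1 - lam θ ^ 2) := by
      rw [Matrix.inv_def, hdet, Ring.inverse_eq_inv']
      simp only [Omega, Matrix.adjugate_fin_two_of, xi, stdize]
      simp [Matrix.mulVec, dotProduct, Fin.sum_univ_two]
      rw [← e1, ← e2, e3, Real.sqrt_sq q1.le, Real.sqrt_sq q2.le]
      field_simp
      ring
    rw [phi2, normalDensity, hq, hc, mul_assoc]
  rw [density, h1, h2, h3, T, alpha0, sStar]
  ring_nf

/-! ### Affine changes of variables -/

lemma lintegral_affine {a : ℝ} (ha : 0 < a) (m : ℝ) {f : ℝ → ENNReal} (hf : Measurable f) :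
    ∫⁻ x, f x = ENNReal.ofReal a * ∫⁻ x, f (a * x + m) := by
  have h := Real.smul_map_volume_mul_left ha.ne'
  rw [abs_of_pos ha] at h
  calc ∫⁻ x, f x = ∫⁻ x, f (x + m) := (lintegral_add_right_eq_self f m).symm
    _ = ∫⁻ x, f (x + m) ∂(ENNReal.ofReal a • Measure.map (a * ·) volume) := by rw [h]
    _ = _ := by
      rw [lintegral_smul_measure, lintegral_map (by fun_prop) (by fun_prop), smul_eq_mul]

lemma lintegral_triangular {a c : ℝ} (ha : 0 < a) (hc : 0 < c) (b m n : ℝ)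
    {f : (Fin 2 → ℝ) → ENNReal} (hf : Measurable f) :
    ∫⁻ z, f z = ENNReal.ofReal (a * c) *
      ∫⁻ g : ℝ × ℝ, f ![a * g.1 + m, b * g.1 + c * g.2 + n] := by
  have hm : Measurable fun p : ℝ × ℝ => f ![p.1, p.2] := by
    refine hf.comp (measurable_pi_iff.2 fun i => ?_)
    fin_cases i <;> simp <;> fun_prop
  have h1 : ∫⁻ z, f z = ∫⁻ p : ℝ × ℝ, f ![p.1, p.2] := by
    rw [← (volume_preserving_finTwoArrow ℝ).lintegral_comp hm]
    refine lintegral_congr fun z => congrArg f ?_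
    ext i; fin_cases i <;> rfl
  have hm2 : Measurable fun g : ℝ × ℝ => f ![a * g.1 + m, b * g.1 + c * g.2 + n] := by
    refine hf.comp (measurable_pi_iff.2 fun i => ?_)
    fin_cases i <;> simp <;> fun_prop
  rw [h1, Measure.volume_eq_prod, lintegral_prod _ hm.aemeasurable,
    lintegral_prod _ hm2.aemeasurable]
  have hin : Measurable fun x => ∫⁻ y, f ![x, y] := hm.lintegral_prod_right'
  rw [lintegral_affine ha m hin, ENNReal.ofReal_mul ha.le, mul_assoc]
  congr 1
  have hin2 : Measurable fun x => ∫⁻ y, f ![a * x + m, b * x + c * y + n] :=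
    hm2.lintegral_prod_right'
  rw [← lintegral_const_mul _ hin2]
  refine lintegral_congr fun x => ?_
  have hs : Measurable fun y => f ![a * x + m, y] :=
    hm.comp (by fun_prop : Measurable fun y : ℝ => (a * x + m, y))
  rw [lintegral_affine hc (b * x + n) hs]
  simp only [add_comm, add_left_comm]

/-! ### The latent variable representation -/

/-! The lower triangular Cholesky factor of `V`. -/

/-- The upper left entry of the Cholesky factor of `V`. -/
def chol11 (θ : Fin 8 → ℝ) : ℝ := √(v11 θ)

/-- The lower left entry of the Cholesky factor of `V`. -/
def chol21 (θ : Fin 8 → ℝ) : ℝ := v12 θ / √(v11 θ)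

/-- The lower right entry of the Cholesky factor of `V`. -/
def chol22 (θ : Fin 8 → ℝ) : ℝ := √(v22 θ - v12 θ ^ 2 / v11 θ)

/-- The point `C g - x δ`, where `C` is the Cholesky factor of `V`. If `g` is a pair of independent
standard normal variables, this has law `N(-x δ, V)`. -/
def latent (θ : Fin 8 → ℝ) (x : ℝ) (g : ℝ × ℝ) : Fin 2 → ℝ :=
  ![chol11 θ * g.1 + -(x * del1 θ), chol21 θ * g.1 + chol22 θ * g.2 + -(x * del2 θ)]

section

variable {θ : Fin 8 → ℝ}

lemma detV_pos (h : Admissible θ) : 0 < v11 θ * v22 θ - v12 θ ^ 2 := by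
  have h1 := sStar_sq_mul_detV h
  have h2 := sq_lam_lt_one h
  have h3 := sStar_pos h
  exact pos_of_mul_pos_right (a := sStar θ ^ 2) (by linarith) (by positivity)

lemma schur_pos (h : Admissible θ) : 0 < v22 θ - v12 θ ^ 2 / v11 θ := by
  have h1 := detV_pos h
  have h2 := v11_pos h
  have : v22 θ - v12 θ ^ 2 / v11 θ = (v11 θ * v22 θ - v12 θ ^ 2) / v11 θ := by field_simp
  rw [this]; positivity

lemma chol11_pos (h : Admissible θ) : 0 < chol11 θ := Real.sqrt_pos.2 (v11_pos h)

lemma chol22_pos (h : Admissible θ) : 0 < chol22 θ := Real.sqrt_pos.2 (schur_pos h)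

lemma chol11_sq (h : Admissible θ) : chol11 θ ^ 2 = v11 θ := Real.sq_sqrt (v11_pos h).le

lemma chol11_mul_chol21 (h : Admissible θ) : chol11 θ * chol21 θ = v12 θ :=
  mul_div_cancel₀ _ (chol11_pos h).ne'

lemma chol21_sq_add (h : Admissible θ) : chol21 θ ^ 2 + chol22 θ ^ 2 = v22 θ := by
  rw [chol22, Real.sq_sqrt (schur_pos h).le, chol21, div_pow, Real.sq_sqrt (v11_pos h).le]
  ring

lemma sStar_mul_chol (h : Admissible θ) :
    sStar θ * (chol11 θ * chol22 θ) = √(1 - lam θ ^ 2) := by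
  have h1 := chol11_pos h
  have h2 := chol22_pos h
  have h3 := sStar_pos h
  rw [← Real.sqrt_sq (by positivity : 0 ≤ sStar θ * (chol11 θ * chol22 θ))]
  congr 1
  rw [← sStar_sq_mul_detV h, ← chol21_sq_add h, ← chol11_mul_chol21 h, ← chol11_sq h]
  ring

/-- Completing the square: the joint density of `Z` and the variable truncated at `τ`, in the
coordinates given by the Cholesky factor, is a product of standard normal densities. -/
lemma exponent_latent (h : Admissible θ) (x : ℝ) (g : ℝ × ℝ) :
    (latent θ x g 0 ^ 2 - 2 * lam θ * latent θ x g 0 * latent θ x g 1 + latent θ x g 1 ^ 2) /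
        (1 - lam θ ^ 2) +
      (x * sStar θ + al1 θ * latent θ x g 0 + al2 θ * latent θ x g 1) ^ 2 =
    x ^ 2 + g.1 ^ 2 + g.2 ^ 2 := by
  obtain ⟨g1, g2⟩ := g
  set z1 := latent θ x (g1, g2) 0 with hz1
  set z2 := latent θ x (g1, g2) 1 with hz2
  simp only [latent, Matrix.cons_val_zero, Matrix.cons_val_one] at hz1 hz2
  have hm : 0 < 1 - lam θ ^ 2 := by linarith [sq_lam_lt_one h]
  have hS := sStar_pos h
  have hD := detV_pos h
  have c1 := chol11_sq h
  have c2 := chol11_mul_chol21 h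
  have c3 := chol21_sq_add h
  have e1 := sStar_mul_del1 h
  have e2 := sStar_mul_del2 h
  have e4 := sStar_sq_mul_detV h
  -- `|g|²` as the quadratic form of `V⁻¹` at `C g = z + x δ`
  have hg : (v11 θ * v22 θ - v12 θ ^ 2) * (g1 ^ 2 + g2 ^ 2) =
      v22 θ * (z1 + x * del1 θ) ^ 2 -
        2 * v12 θ * (z1 + x * del1 θ) * (z2 + x * del2 θ) +
        v11 θ * (z2 + x * del2 θ) ^ 2 := by
    rw [hz1, hz2, ← c1, ← c2, ← c3]
    ring
  have a1 : (1 - lam θ ^ 2) * al1 θ = sStar θ * (del1 θ - lam θ * del2 θ) := by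
    have : sStar θ * (del1 θ - lam θ * del2 θ) =
      sStar θ * del1 θ - lam θ * (sStar θ * del2 θ) := by ring
    rw [this, e1, e2]; ring
  have a2 : (1 - lam θ ^ 2) * al2 θ = sStar θ * (del2 θ - lam θ * del1 θ) := by
    have : sStar θ * (del2 θ - lam θ * del1 θ) =
      sStar θ * del2 θ - lam θ * (sStar θ * del1 θ) := by ring
    rw [this, e1, e2]; ring
  have b1 : al1 θ = sStar θ * (del1 θ - lam θ * del2 θ) / (1 - lam θ ^ 2) := by
    rw [eq_div_iff hm.ne']; linarith
  have b2 : al2 θ = sStar θ * (del2 θ - lam θ * del1 θ) / (1 - lam θ ^ 2) := by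
    rw [eq_div_iff hm.ne']; linarith
  have hsq : (x * sStar θ + al1 θ * z1 + al2 θ * z2) ^ 2 =
      sStar θ ^ 2 * (x + (del1 θ - lam θ * del2 θ) / (1 - lam θ ^ 2) * z1 +
        (del2 θ - lam θ * del1 θ) / (1 - lam θ ^ 2) * z2) ^ 2 := by
    rw [b1, b2]; ring
  have hS2 : sStar θ ^ 2 = (1 - lam θ ^ 2) / (v11 θ * v22 θ - v12 θ ^ 2) := by
    rw [eq_div_iff hD.ne']; exact e4
  have hg' : g1 ^ 2 + g2 ^ 2 = (v22 θ * (z1 + x * del1 θ) ^ 2 -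
        2 * v12 θ * (z1 + x * del1 θ) * (z2 + x * del2 θ) +
        v11 θ * (z2 + x * del2 θ) ^ 2) / (v11 θ * v22 θ - v12 θ ^ 2) := by
    rw [eq_div_iff hD.ne']; linarith
  rw [add_assoc (x ^ 2), hg', hsq, hS2]
  clear_value z1 z2
  have hD' := hD.ne'
  clear hg hg' hsq hS2 b1 b2 a1 a2 e1 e2 e4 c1 c2 c3 hD
  field_simp
  simp only [v11, v22, v12]
  ring

/-- The identity behind all moments:
`√(1 + α*²) φ₂(z; Ω̄) φ(x √(1 + α*²) + αᵀ z) = φ(x) φ₂(z + x δ; V)`, written in the coordinates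
`z = C g - x δ`. -/
lemma normalDensity_latent (h : Admissible θ) (x : ℝ) (g : ℝ × ℝ) :
    chol11 θ * chol22 θ * (sStar θ * normalDensity θ (latent θ x g) *
      phi (x * sStar θ + al1 θ * latent θ x g 0 + al2 θ * latent θ x g 1)) =
    phi x * (phi g.1 * phi g.2) := by
  have hm : 0 < √(1 - lam θ ^ 2) := Real.sqrt_pos.2 (by linarith [sq_lam_lt_one h])
  have hpi := Real.pi_pos
  have hs : √(2 * Real.pi) ^ 2 = 2 * Real.pi := Real.sq_sqrt (by positivity)
  have hs0 : 0 < √(2 * Real.pi) := by positivity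
  have hE := exponent_latent h x g
  have hc := sStar_mul_chol h
  rw [normalDensity]
  simp only [phi_eq]
  set Q := (latent θ x g 0 ^ 2 - 2 * lam θ * latent θ x g 0 * latent θ x g 1 +
    latent θ x g 1 ^ 2) / (1 - lam θ ^ 2)
  set t := x * sStar θ + al1 θ * latent θ x g 0 + al2 θ * latent θ x g 1
  have hexp : Real.exp (-Q / 2) * Real.exp (-t ^ 2 / 2) =
      Real.exp (-x ^ 2 / 2) * (Real.exp (-g.1 ^ 2 / 2) * Real.exp (-g.2 ^ 2 / 2)) := by
    rw [← Real.exp_add, ← Real.exp_add, ← Real.exp_add]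
    congr 1
    linarith
  calc _ = (sStar θ * (chol11 θ * chol22 θ)) * (2 * Real.pi * √(1 - lam θ ^ 2))⁻¹ *
        (√(2 * Real.pi))⁻¹ * (Real.exp (-Q / 2) * Real.exp (-t ^ 2 / 2)) := by ring
    _ = _ := by
      rw [hexp, hc]
      generalize √(2 * Real.pi) = s at *
      rw [← hs]
      field_simp

end

/-- The law of a pair of independent standard normal variables. -/
def stdPair : Measure (ℝ × ℝ) := (gaussianReal 0 1).prod (gaussianReal 0 1)

instance : IsProbabilityMeasure stdPair := by unfold stdPair; infer_instance

lemma stdPair_eq : stdPair = volume.withDensity fun g : ℝ × ℝ =>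
    ENNReal.ofReal (phi g.1 * phi g.2) := by
  have hm : Measurable fun x => ENNReal.ofReal (phi x) :=
    continuous_phi.measurable.ennreal_ofReal
  rw [stdPair, gaussianReal_eq_withDensity_phi, prod_withDensity hm hm, ← Measure.volume_eq_prod]
  simp only [ENNReal.ofReal_mul (phi_pos _).le]

lemma lintegral_stdPair {f : ℝ × ℝ → ENNReal} (hf : Measurable f) :
    ∫⁻ g, f g ∂stdPair = ∫⁻ g : ℝ × ℝ, ENNReal.ofReal (phi g.1 * phi g.2) * f g := by
  have := continuous_phi.measurable
  rw [stdPair_eq, lintegral_withDensity_eq_lintegral_mul _ (by fun_prop) hf]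
  rfl

lemma measurable_latent (θ : Fin 8 → ℝ) :
    Measurable fun p : ℝ × ℝ × ℝ => latent θ p.1 p.2 := by
  refine measurable_pi_iff.2 fun i => ?_
  fin_cases i <;> simp [latent] <;> fun_prop

lemma measurable_latent_right (θ : Fin 8 → ℝ) (x : ℝ) : Measurable (latent θ x) :=
  (measurable_latent θ).comp (by fun_prop : Measurable fun g : ℝ × ℝ => (x, g))

/-- Integration against `√(1 + α*²) φ₂(z; Ω̄) φ(x √(1 + α*²) + αᵀ z)` is, up to the factor `φ(x)`,
integration against `N(-x δ, V)`. -/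
lemma lintegral_slice {θ : Fin 8 → ℝ} (h : Admissible θ) (x : ℝ) {f : (Fin 2 → ℝ) → ENNReal}
    (hf : Measurable f) :
    ∫⁻ z, ENNReal.ofReal (sStar θ * normalDensity θ z *
        phi (x * sStar θ + al1 θ * z 0 + al2 θ * z 1)) * f z =
      ENNReal.ofReal (phi x) * ∫⁻ g, f (latent θ x g) ∂stdPair := by
  have hc1 := chol11_pos h
  have hc2 := chol22_pos h
  have m1 := continuous_phi.measurable
  have m2 := (continuous_normalDensity θ).measurable
  have m3 := measurable_latent_right θ x
  rw [lintegral_triangular hc1 hc2 (chol21 θ) (-(x * del1 θ)) (-(x * del2 θ)) (by fun_prop),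
    lintegral_stdPair (by fun_prop), ← lintegral_const_mul' _ _ ENNReal.ofReal_ne_top,
    ← lintegral_const_mul' _ _ ENNReal.ofReal_ne_top]
  refine lintegral_congr fun g => ?_
  rw [← mul_assoc, ← mul_assoc, ← ENNReal.ofReal_mul (by positivity),
    ← ENNReal.ofReal_mul (phi_pos x).le, ← normalDensity_latent h x g]
  rfl

lemma ofReal_Phi_T {θ : Fin 8 → ℝ} (h : Admissible θ) (z : Fin 2 → ℝ) :
    ENNReal.ofReal (Phi (T θ z)) = ∫⁻ x in Set.Iic (tau θ),
      ENNReal.ofReal (sStar θ * phi (x * sStar θ + al1 θ * z 0 + al2 θ * z 1)) := by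
  have hs := sStar_pos h
  have m1 := continuous_phi.measurable
  rw [ofReal_Phi, ← lintegral_indicator measurableSet_Iic, ← lintegral_indicator measurableSet_Iic,
    lintegral_affine hs (al1 θ * z 0 + al2 θ * z 1)
      ((by fun_prop : Measurable fun t => ENNReal.ofReal (phi t)).indicator measurableSet_Iic),
    ← lintegral_const_mul' _ _ ENNReal.ofReal_ne_top]
  refine lintegral_congr fun x => ?_
  have hiff : sStar θ * x + (al1 θ * z 0 + al2 θ * z 1) ∈ Set.Iic (T θ z) ↔
      x ∈ Set.Iic (tau θ) := by
    simp only [Set.mem_Iic, T, alpha0, add_assoc]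
    rw [add_le_add_iff_right, mul_comm (tau θ), mul_le_mul_iff_right₀ hs]
  by_cases hx : x ∈ Set.Iic (tau θ)
  · rw [Set.indicator_of_mem (hiff.2 hx), Set.indicator_of_mem hx, ← ENNReal.ofReal_mul hs.le]
    ring_nf
  · rw [Set.indicator_of_notMem (fun hh => hx (hiff.1 hh)), Set.indicator_of_notMem hx, mul_zero]

/-- The law of the latent pair: `x` standard normal restricted to `x ≤ τ`, and an independent pair
of standard normal variables. Its total mass is `Φ(τ)`. -/
def latentLaw (θ : Fin 8 → ℝ) : Measure (ℝ × ℝ × ℝ) :=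
  ((gaussianReal 0 1).restrict (Set.Iic (tau θ))).prod stdPair

/-- `Z` is distributed as `C g - x δ`, where `x` is standard normal conditioned on `x ≤ τ` and `g`
is an independent pair of standard normal variables. -/
lemma lawZ_eq_map {θ : Fin 8 → ℝ} (h : Admissible θ) :
    lawZ θ = ENNReal.ofReal (Phi (tau θ))⁻¹ •
      (latentLaw θ).map fun p => latent θ p.1 p.2 := by
  have hP := Phi_pos (tau θ)
  have m1 := continuous_phi.measurable
  have m2 := (continuous_normalDensity θ).measurable
  have m3 := continuous_Phi.measurable
  have m4 := (continuous_T θ).measurable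
  have m5 := measurable_latent θ
  refine Measure.ext_of_lintegral _ fun f hf => ?_
  rw [lawZ, law, lintegral_smul_measure, smul_eq_mul, lintegral_map hf m5]
  simp only [density_stdized h]
  rw [lintegral_withDensity_eq_lintegral_mul _ (by fun_prop) hf]
  have e1 : ∀ z, ((fun z => ENNReal.ofReal (normalDensity θ z * Phi (T θ z) / Phi (tau θ))) * f) z
      = ENNReal.ofReal (Phi (tau θ))⁻¹ * ∫⁻ x in Set.Iic (tau θ),
        ENNReal.ofReal (sStar θ * normalDensity θ z *
          phi (x * sStar θ + al1 θ * z 0 + al2 θ * z 1)) * f z := by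
    intro z
    have hn := normalDensity_pos h z
    have hs := sStar_pos h
    rw [Pi.mul_apply, lintegral_mul_const _ (by fun_prop), ← mul_assoc]
    congr 1
    rw [div_eq_inv_mul, ENNReal.ofReal_mul (by positivity), ENNReal.ofReal_mul hn.le,
      ofReal_Phi_T h, ← lintegral_const_mul _ (by fun_prop)]
    congr 1
    refine lintegral_congr fun x => ?_
    rw [← ENNReal.ofReal_mul hn.le]
    ring_nf
  have m6 : Measurable (Function.uncurry fun (z : Fin 2 → ℝ) (x : ℝ) =>
      ENNReal.ofReal (sStar θ * normalDensity θ z *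
        phi (x * sStar θ + al1 θ * z 0 + al2 θ * z 1)) * f z) := by
    simp only [Function.uncurry_def]
    fun_prop
  have hfm : Measurable fun p : ℝ × ℝ × ℝ => f (latent θ p.1 p.2) := by fun_prop
  rw [lintegral_congr e1, lintegral_const_mul _ m6.lintegral_prod_right,
    lintegral_lintegral_swap m6.aemeasurable, latentLaw,
    lintegral_prod _ hfm.aemeasurable, gaussianReal_eq_withDensity_phi,
    restrict_withDensity measurableSet_Iic,
    lintegral_withDensity_eq_lintegral_mul _ (by fun_prop) hfm.lintegral_prod_right']
  congr 1
  exact lintegral_congr fun x => lintegral_slice h x hf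

/-- Weighting the law of `Z` by `ζ₁(T)` gives a multiple of `N(-τ δ, V)`, since `ζ₁` cancels the
factor `Φ(T)` of the density. -/
lemma lawZ_withDensity_zeta1 {θ : Fin 8 → ℝ} (h : Admissible θ) :
    (lawZ θ).withDensity (fun z => ENNReal.ofReal (zeta1 (T θ z))) =
      ENNReal.ofReal (zeta1 (tau θ) / sStar θ) • stdPair.map (latent θ (tau θ)) := by
  have hP := Phi_pos (tau θ)
  have hs := sStar_pos h
  have m1 := continuous_phi.measurable
  have m2 := (continuous_normalDensity θ).measurable
  have m3 := continuous_Phi.measurable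
  have m4 := (continuous_T θ).measurable
  have m5 := measurable_latent_right θ (tau θ)
  have m6 := continuous_zeta1.measurable
  refine Measure.ext_of_lintegral _ fun f hf => ?_
  rw [lawZ, law, lintegral_smul_measure, smul_eq_mul, lintegral_map hf m5]
  simp only [density_stdized h]
  rw [lintegral_withDensity_eq_lintegral_mul _ (by fun_prop) hf,
    lintegral_withDensity_eq_lintegral_mul _ (by fun_prop) (by fun_prop)]
  have e : ENNReal.ofReal (zeta1 (tau θ) / sStar θ) =
      ENNReal.ofReal ((Phi (tau θ))⁻¹ * (sStar θ)⁻¹) * ENNReal.ofReal (phi (tau θ)) := by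
    rw [← ENNReal.ofReal_mul (by positivity), zeta1]
    congr 1
    field_simp
  rw [e, mul_assoc, ← lintegral_slice h (tau θ) hf, ← lintegral_const_mul _ (by fun_prop)]
  refine lintegral_congr fun z => ?_
  have hn := normalDensity_pos h z
  have hT := Phi_pos (T θ z)
  simp only [Pi.mul_apply]
  rw [← mul_assoc, ← mul_assoc, ← ENNReal.ofReal_mul (by positivity),
    ← ENNReal.ofReal_mul (by positivity)]
  congr 2
  rw [zeta1, T, alpha0] at *
  field_simp

lemma isProbabilityMeasure_lawZ {θ : Fin 8 → ℝ} (h : Admissible θ) :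
    IsProbabilityMeasure (lawZ θ) := by
  constructor
  rw [lawZ_eq_map h, Measure.smul_apply, Measure.map_apply (measurable_latent θ) .univ,
    Set.preimage_univ, latentLaw, ← Set.univ_prod_univ, Measure.prod_prod,
    Measure.restrict_apply_univ, measure_univ (μ := stdPair), mul_one, ← ofReal_cdf, smul_eq_mul,
    ← ENNReal.ofReal_mul (inv_nonneg.2 (Phi_pos _).le)]
  rw [← ENNReal.ofReal_one]
  congr 1
  exact inv_mul_cancel₀ (Phi_pos (tau θ)).ne'

/-- `Y = ξ + ω Z`. -/
def unstdize (θ : Fin 8 → ℝ) (z : Fin 2 → ℝ) : Fin 2 → ℝ :=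
  ![√(Om11 θ) * z 0 + θ 0, √(Om22 θ) * z 1 + θ 1]

lemma measurable_unstdize (θ : Fin 8 → ℝ) : Measurable (unstdize θ) := by
  refine measurable_pi_iff.2 fun i => ?_
  fin_cases i <;> simp [unstdize] <;> fun_prop

lemma continuous_density_stdized {θ : Fin 8 → ℝ} (h : Admissible θ) :
    Continuous (density 0 (corr (Omega θ)) (alpha θ) (tau θ)) := by
  have m1 := continuous_normalDensity θ
  have m2 := continuous_Phi
  have m3 := continuous_T θ
  rw [funext (density_stdized h)]
  fun_prop

lemma stdize_unstdize {θ : Fin 8 → ℝ} (h : Admissible θ) (z : Fin 2 → ℝ) :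
    stdize θ (unstdize θ z) = z := by
  have q1 := Real.sqrt_pos.2 h.1
  have q2 := Real.sqrt_pos.2 h.2.1
  ext i
  fin_cases i <;> simp [stdize, unstdize] <;> field_simp

lemma continuous_stdize (θ : Fin 8 → ℝ) : Continuous (stdize θ) := by
  refine continuous_pi fun i => ?_
  fin_cases i <;> simp [stdize] <;> fun_prop

lemma continuous_density {θ : Fin 8 → ℝ} (h : Admissible θ) :
    Continuous (density (xi θ) (Omega θ) (alpha θ) (tau θ)) := by
  rw [funext (density_eq_stdized h)]
  exact continuous_const.mul ((continuous_density_stdized h).comp (continuous_stdize θ))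

lemma lawY_eq_map {θ : Fin 8 → ℝ} (h : Admissible θ) :
    lawY θ = (lawZ θ).map (unstdize θ) := by
  have q1 := Real.sqrt_pos.2 h.1
  have q2 := Real.sqrt_pos.2 h.2.1
  have m1 := (continuous_density_stdized h).measurable
  have m2 := (continuous_density h).measurable
  have m3 := measurable_unstdize θ
  refine Measure.ext_of_lintegral _ fun f hf => ?_
  rw [lintegral_map hf m3, lawY, law, lawZ, law,
    lintegral_withDensity_eq_lintegral_mul _ (by fun_prop) hf,
    lintegral_withDensity_eq_lintegral_mul _ (by fun_prop) (by fun_prop),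
    lintegral_triangular q1 q2 0 (θ 0) (θ 1) (by fun_prop),
    ← (volume_preserving_finTwoArrow ℝ).lintegral_comp_emb
      MeasurableEquiv.finTwoArrow.measurableEmbedding,
    ← lintegral_const_mul' _ _ ENNReal.ofReal_ne_top]
  refine lintegral_congr fun z => ?_
  have e : ![√(Om11 θ) * (MeasurableEquiv.finTwoArrow z).1 + θ 0,
      0 * (MeasurableEquiv.finTwoArrow z).1 + √(Om22 θ) * (MeasurableEquiv.finTwoArrow z).2 + θ 1] =
      unstdize θ z := by
    simp [unstdize, MeasurableEquiv.finTwoArrow]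
  rw [e, Pi.mul_apply, Pi.mul_apply, density_eq_stdized h, stdize_unstdize h, ← mul_assoc,
    ← ENNReal.ofReal_mul (by positivity), mul_inv_cancel_left₀ (by positivity)]

lemma isProbabilityMeasure_lawY {θ : Fin 8 → ℝ} (h : Admissible θ) :
    IsProbabilityMeasure (lawY θ) := by
  have := isProbabilityMeasure_lawZ h
  rw [lawY_eq_map h]
  exact Measure.isProbabilityMeasure_map (measurable_unstdize θ).aemeasurable

/-! ### Moments -/

/-- The integral of `f` against `μ` exists and equals `c`. -/
def HasInt {X : Type*} [MeasurableSpace X] (μ : Measure X) (f : X → ℝ) (c : ℝ) : Prop :=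
  Integrable f μ ∧ ∫ x, f x ∂μ = c

namespace HasInt

variable {X Y : Type*} [MeasurableSpace X] [MeasurableSpace Y] {μ : Measure X} {ν : Measure Y}
  {f g : X → ℝ} {a b : ℝ}

lemma add (hf : HasInt μ f a) (hg : HasInt μ g b) : HasInt μ (fun x => f x + g x) (a + b) :=
  ⟨hf.1.add hg.1, by rw [integral_add hf.1 hg.1, hf.2, hg.2]⟩

lemma sub (hf : HasInt μ f a) (hg : HasInt μ g b) : HasInt μ (fun x => f x - g x) (a - b) :=
  ⟨hf.1.sub hg.1, by rw [integral_sub hf.1 hg.1, hf.2, hg.2]⟩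

lemma neg (hf : HasInt μ f a) : HasInt μ (fun x => -f x) (-a) :=
  ⟨hf.1.neg, by rw [integral_neg, hf.2]⟩

lemma const_mul (hf : HasInt μ f a) (c : ℝ) : HasInt μ (fun x => c * f x) (c * a) :=
  ⟨hf.1.const_mul c, by rw [integral_const_mul, hf.2]⟩

lemma congr (hf : HasInt μ f a) (h : ∀ x, g x = f x) (hab : b = a) : HasInt μ g b := by
  obtain rfl : g = f := funext h
  exact hab ▸ hf

lemma const [IsProbabilityMeasure μ] (c : ℝ) : HasInt μ (fun _ => c) c :=
  ⟨integrable_const _, by simp⟩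

lemma prod [SFinite μ] [SFinite ν] {h : Y → ℝ} (hf : HasInt μ f a) (hh : HasInt ν h b) :
    HasInt (μ.prod ν) (fun p => f p.1 * h p.2) (a * b) :=
  ⟨hf.1.mul_prod hh.1, by rw [integral_prod_mul, hf.2, hh.2]⟩

end HasInt

lemma integrable_one_add_abs_pow_gaussian (n : ℕ) :
    Integrable (fun x : ℝ => (1 + |x|) ^ n) (gaussianReal 0 1) := by
  have h1 : MemLp (fun x : ℝ => 1 + |x|) n (gaussianReal 0 1) := by
    have := memLp_id_gaussianReal' (μ := 0) (v := 1) (n : ENNReal) (by simp)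
    have h2 : MemLp (fun x : ℝ => ‖x‖) n (gaussianReal 0 1) := this.norm
    exact MemLp.add (f := fun _ => (1 : ℝ)) (memLp_const 1) h2
  refine (h1.integrable_norm_pow').congr (Filter.Eventually.of_forall fun x => ?_)
  simp only [Real.norm_eq_abs]
  rw [abs_of_nonneg (by positivity)]

lemma integrable_pow_gaussian (n : ℕ) : Integrable (fun x : ℝ => x ^ n) (gaussianReal 0 1) := by
  refine (integrable_one_add_abs_pow_gaussian n).mono' (by fun_prop)
    (Filter.Eventually.of_forall fun x => ?_)
  rw [norm_pow, Real.norm_eq_abs]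
  gcongr
  linarith

lemma gaussian_one : HasInt (gaussianReal 0 1) (fun x => x) 0 :=
  ⟨by simpa using integrable_pow_gaussian 1, integral_id_gaussianReal⟩

lemma gaussian_two : HasInt (gaussianReal 0 1) (fun x => x ^ 2) 1 := by
  refine ⟨integrable_pow_gaussian 2, ?_⟩
  have h := variance_fun_id_gaussianReal (μ := 0) (v := 1)
  rw [variance_eq_integral (by fun_prop)] at h
  simpa [integral_id_gaussianReal] using h

lemma gaussian_three : HasInt (gaussianReal 0 1) (fun x => x ^ 3) 0 := by
  refine ⟨integrable_pow_gaussian 3, ?_⟩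
  -- the law is symmetric and the integrand is odd
  have h : ∫ x, x ^ 3 ∂(gaussianReal 0 1) = ∫ x, (-x) ^ 3 ∂(gaussianReal 0 1) := by
    conv_lhs => rw [← neg_zero, ← gaussianReal_map_neg]
    rw [integral_map (by fun_prop) (by fun_prop)]
  have h2 : ∫ x : ℝ, (-x) ^ 3 ∂(gaussianReal 0 1) = -∫ x, x ^ 3 ∂(gaussianReal 0 1) := by
    rw [← integral_neg]
    refine integral_congr_ae (Filter.Eventually.of_forall fun x => ?_)
    simp only; ring
  linarith

/-! Moments of the standard normal law restricted to `(-∞, t]`. -/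

lemma integrable_gaussian_iff {f : ℝ → ℝ} :
    Integrable f (gaussianReal 0 1) ↔ Integrable fun x => phi x * f x := by
  have m := continuous_phi.measurable
  rw [gaussianReal_eq_withDensity_phi,
    integrable_withDensity_iff_integrable_smul' (by fun_prop)
      (Filter.Eventually.of_forall fun _ => ENNReal.ofReal_lt_top)]
  simp only [ENNReal.toReal_ofReal (phi_pos _).le, smul_eq_mul]

lemma setIntegral_gaussian (f : ℝ → ℝ) (t : ℝ) :
    ∫ x in Set.Iic t, f x ∂(gaussianReal 0 1) = ∫ x in Set.Iic t, phi x * f x := by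
  have m := continuous_phi.measurable
  rw [gaussianReal_eq_withDensity_phi, restrict_withDensity measurableSet_Iic,
    integral_withDensity_eq_integral_toReal_smul (by fun_prop)
      (Filter.Eventually.of_forall fun _ => ENNReal.ofReal_lt_top)]
  simp only [ENNReal.toReal_ofReal (phi_pos _).le, smul_eq_mul]

lemma truncated_zero (t : ℝ) :
    HasInt ((gaussianReal 0 1).restrict (Set.Iic t)) (fun _ => 1) (Phi t) := by
  refine ⟨integrable_const _, ?_⟩
  rw [Phi, cdf_eq_real]
  simp

lemma truncated_one (t : ℝ) :
    HasInt ((gaussianReal 0 1).restrict (Set.Iic t)) (fun x => x) (-phi t) := by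
  refine ⟨gaussian_one.1.integrableOn, ?_⟩
  rw [setIntegral_gaussian]
  have hd : ∀ x ∈ Set.Iic t, HasDerivAt (fun x => -phi x) (phi x * x) x := fun x _ =>
    (hasDerivAt_phi x).neg.congr_deriv (by ring)
  have hi : IntegrableOn (fun x => phi x * x) (Set.Iic t) :=
    (integrable_gaussian_iff.1 gaussian_one.1).integrableOn
  rw [integral_Iic_of_hasDerivAt_of_tendsto' hd hi
    (tendsto_zero_of_hasDerivAt_of_integrableOn_Iic hd hi integrable_phi.neg.integrableOn)]
  ring

lemma truncated_two (t : ℝ) :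
    HasInt ((gaussianReal 0 1).restrict (Set.Iic t)) (fun x => x ^ 2) (Phi t - t * phi t) := by
  refine ⟨gaussian_two.1.integrableOn, ?_⟩
  rw [setIntegral_gaussian]
  have hd : ∀ x ∈ Set.Iic t, HasDerivAt (fun x => -(x * phi x)) (phi x * x ^ 2 - phi x) x := by
    intro x _
    refine ((hasDerivAt_id x).mul (hasDerivAt_phi x)).neg.congr_deriv ?_
    simp; ring
  have h2 := integrable_gaussian_iff.1 gaussian_two.1
  have hi : IntegrableOn (fun x => phi x * x ^ 2 - phi x) (Set.Iic t) :=
    (h2.sub integrable_phi).integrableOn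
  have hi1 : IntegrableOn (fun x => -(x * phi x)) (Set.Iic t) := by
    have := (integrable_gaussian_iff.1 gaussian_one.1).neg.integrableOn (s := Set.Iic t)
    refine this.congr_fun (fun x _ => ?_) measurableSet_Iic
    simp [mul_comm]
  have hI := integral_Iic_of_hasDerivAt_of_tendsto' hd hi
    (tendsto_zero_of_hasDerivAt_of_integrableOn_Iic hd hi hi1)
  rw [integral_sub h2.integrableOn integrable_phi.integrableOn, ← Phi_eq_integral] at hI
  linarith

/-! Moments of the Gaussian law `N(-x δ, V)`. -/

lemma stdPair_cubic (a00 a10 a01 a20 a11 a02 a30 a21 a12 a03 : ℝ) :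
    HasInt stdPair (fun g => a00 + a10 * g.1 + a01 * g.2 + a20 * g.1 ^ 2 + a11 * (g.1 * g.2) +
      a02 * g.2 ^ 2 + a30 * g.1 ^ 3 + a21 * (g.1 ^ 2 * g.2) + a12 * (g.1 * g.2 ^ 2) +
      a03 * g.2 ^ 3) (a00 + a20 + a02) := by
  have h0 : HasInt (gaussianReal 0 1) (fun _ => 1) 1 := HasInt.const 1
  have h1 := gaussian_one
  have h2 := gaussian_two
  have h3 := gaussian_three
  refine (((((((((((HasInt.const (μ := stdPair) a00).add
    ((h1.prod h0).const_mul a10)).add ((h0.prod h1).const_mul a01)).add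
    ((h2.prod h0).const_mul a20)).add ((h1.prod h1).const_mul a11)).add
    ((h0.prod h2).const_mul a02)).add ((h3.prod h0).const_mul a30)).add
    ((h2.prod h1).const_mul a21)).add ((h1.prod h2).const_mul a12)).add
    ((h0.prod h3).const_mul a03))).congr (fun g => ?_) ?_
  · ring
  · ring

/-- The affine form `p 0 + p 1 * z 0 + p 2 * z 1`. -/
def affForm (p : Fin 3 → ℝ) (z : Fin 2 → ℝ) : ℝ := p 0 + p 1 * z 0 + p 2 * z 1

lemma continuous_affForm (p : Fin 3 → ℝ) : Continuous (affForm p) := by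
  unfold affForm; fun_prop

/-- The bilinear form of `V` on the linear parts of two affine forms: their covariance under
`N(m, V)`. -/
def covForm (θ : Fin 8 → ℝ) (p q : Fin 3 → ℝ) : ℝ :=
  p 1 * q 1 * v11 θ + (p 1 * q 2 + p 2 * q 1) * v12 θ + p 2 * q 2 * v22 θ

/-- Moments of degree at most three of `N(-x δ, V)`. -/
lemma stdPair_affForm {θ : Fin 8 → ℝ} (h : Admissible θ) (x : ℝ) (p q r : Fin 3 → ℝ) :
    HasInt stdPair (fun g => affForm p (latent θ x g) * affForm q (latent θ x g) *
        affForm r (latent θ x g))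
      (affForm p ![-(x * del1 θ), -(x * del2 θ)] * affForm q ![-(x * del1 θ), -(x * del2 θ)] *
          affForm r ![-(x * del1 θ), -(x * del2 θ)] +
        affForm p ![-(x * del1 θ), -(x * del2 θ)] * covForm θ q r +
        affForm q ![-(x * del1 θ), -(x * del2 θ)] * covForm θ p r +
        affForm r ![-(x * del1 θ), -(x * del2 θ)] * covForm θ p q) := by
  have key : ∀ a0 a1 a2 b0 b1 b2 c0 c1 c2 : ℝ, HasInt stdPair
      (fun g => (a0 + a1 * g.1 + a2 * g.2) * (b0 + b1 * g.1 + b2 * g.2) *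
        (c0 + c1 * g.1 + c2 * g.2))
      (a0 * b0 * c0 + a0 * (b1 * c1 + b2 * c2) + b0 * (a1 * c1 + a2 * c2) +
        c0 * (a1 * b1 + a2 * b2)) := by
    intro a0 a1 a2 b0 b1 b2 c0 c1 c2
    refine (stdPair_cubic (a0 * b0 * c0) (a1 * b0 * c0 + a0 * b1 * c0 + a0 * b0 * c1)
      (a2 * b0 * c0 + a0 * b2 * c0 + a0 * b0 * c2)
      (a0 * b1 * c1 + a1 * b0 * c1 + a1 * b1 * c0)
      (a0 * (b1 * c2 + b2 * c1) + b0 * (a1 * c2 + a2 * c1) + c0 * (a1 * b2 + a2 * b1))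
      (a0 * b2 * c2 + a2 * b0 * c2 + a2 * b2 * c0)
      (a1 * b1 * c1) (a1 * b1 * c2 + a1 * b2 * c1 + a2 * b1 * c1)
      (a1 * b2 * c2 + a2 * b1 * c2 + a2 * b2 * c1) (a2 * b2 * c2)).congr (fun g => ?_) ?_
    · ring
    · ring
  refine (key (affForm p ![-(x * del1 θ), -(x * del2 θ)])
    (p 1 * chol11 θ + p 2 * chol21 θ) (p 2 * chol22 θ)
    (affForm q ![-(x * del1 θ), -(x * del2 θ)])
    (q 1 * chol11 θ + q 2 * chol21 θ) (q 2 * chol22 θ)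
    (affForm r ![-(x * del1 θ), -(x * del2 θ)])
    (r 1 * chol11 θ + r 2 * chol21 θ) (r 2 * chol22 θ)).congr (fun g => ?_) ?_
  · simp only [affForm, latent, Matrix.cons_val_zero, Matrix.cons_val_one]
    ring
  · simp only [covForm, ← chol11_sq h, ← chol11_mul_chol21 h, ← chol21_sq_add h]
    ring

lemma hasMean_mul_zeta1 {θ : Fin 8 → ℝ} (h : Admissible θ) (p q r : Fin 3 → ℝ) :
    HasMean (lawZ θ) (fun z => affForm p z * affForm q z * affForm r z * zeta1 (T θ z))
      (zeta1 (tau θ) / sStar θ *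
        (affForm p ![-(tau θ * del1 θ), -(tau θ * del2 θ)] *
            affForm q ![-(tau θ * del1 θ), -(tau θ * del2 θ)] *
            affForm r ![-(tau θ * del1 θ), -(tau θ * del2 θ)] +
          affForm p ![-(tau θ * del1 θ), -(tau θ * del2 θ)] * covForm θ q r +
          affForm q ![-(tau θ * del1 θ), -(tau θ * del2 θ)] * covForm θ p r +
          affForm r ![-(tau θ * del1 θ), -(tau θ * del2 θ)] * covForm θ p q)) := by
  have hc : 0 ≤ zeta1 (tau θ) / sStar θ := (div_pos (zeta1_pos _) (sStar_pos h)).le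
  have hm : Measurable fun z => ENNReal.ofReal (zeta1 (T θ z)) :=
    (continuous_zeta1.comp (continuous_T θ)).measurable.ennreal_ofReal
  have hlt : ∀ᵐ z ∂lawZ θ, ENNReal.ofReal (zeta1 (T θ z)) < ⊤ :=
    Filter.Eventually.of_forall fun _ => ENNReal.ofReal_lt_top
  have hF : Continuous fun z => affForm p z * affForm q z * affForm r z :=
    ((continuous_affForm p).mul (continuous_affForm q)).mul (continuous_affForm r)
  obtain ⟨hi, hv⟩ := stdPair_affForm h (tau θ) p q r
  have hw := lawZ_withDensity_zeta1 h
  have hml := (measurable_latent_right θ (tau θ)).aemeasurable (μ := stdPair)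
  have hi' : Integrable (fun z => affForm p z * affForm q z * affForm r z)
      (stdPair.map (latent θ (tau θ))) :=
    (integrable_map_measure hF.aestronglyMeasurable hml).2 hi
  have e : ∀ z, affForm p z * affForm q z * affForm r z * zeta1 (T θ z) =
      (ENNReal.ofReal (zeta1 (T θ z))).toReal • (affForm p z * affForm q z * affForm r z) := by
    intro z
    rw [ENNReal.toReal_ofReal (zeta1_pos _).le, smul_eq_mul, mul_comm]
  simp only [HasMean, e]
  constructor
  · rw [← integrable_withDensity_iff_integrable_smul' hm hlt, hw]
    exact hi'.smul_measure ENNReal.ofReal_ne_top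
  · rw [← integral_withDensity_eq_integral_toReal_smul hm hlt, hw, integral_smul_measure,
      integral_map hml hF.aestronglyMeasurable, hv, ENNReal.toReal_ofReal hc, smul_eq_mul]

/-- Moments of degree at most two of `Z`. -/
lemma hasMean_affForm {θ : Fin 8 → ℝ} (h : Admissible θ) (p q : Fin 3 → ℝ) :
    HasMean (lawZ θ) (fun z => affForm p z * affForm q z)
      (p 0 * q 0 + zeta1 (tau θ) * (p 0 * (q 1 * del1 θ + q 2 * del2 θ) +
          q 0 * (p 1 * del1 θ + p 2 * del2 θ)) +
        (1 - tau θ * zeta1 (tau θ)) * ((p 1 * del1 θ + p 2 * del2 θ) *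
          (q 1 * del1 θ + q 2 * del2 θ)) + covForm θ p q) := by
  have hP := Phi_pos (tau θ)
  have t0 := truncated_zero (tau θ)
  have t1 := truncated_one (tau θ)
  have t2 := truncated_two (tau θ)
  -- the affine form `p` at `C g - x δ` is `p 0 - x (p₁ δ₁ + p₂ δ₂)` plus a linear form in `g`
  have lin : ∀ p : Fin 3 → ℝ, HasInt stdPair (fun g => (p 1 * chol11 θ + p 2 * chol21 θ) * g.1 +
      p 2 * chol22 θ * g.2) 0 := fun p =>
    (stdPair_cubic 0 (p 1 * chol11 θ + p 2 * chol21 θ) (p 2 * chol22 θ) 0 0 0 0 0 0 0).congr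
      (fun g => by ring) (by ring)
  have quad : HasInt stdPair (fun g => ((p 1 * chol11 θ + p 2 * chol21 θ) * g.1 +
      p 2 * chol22 θ * g.2) * ((q 1 * chol11 θ + q 2 * chol21 θ) * g.1 +
      q 2 * chol22 θ * g.2)) (covForm θ p q) := by
    refine (stdPair_cubic 0 0 0
      ((p 1 * chol11 θ + p 2 * chol21 θ) * (q 1 * chol11 θ + q 2 * chol21 θ))
      ((p 1 * chol11 θ + p 2 * chol21 θ) * (q 2 * chol22 θ) +
        (q 1 * chol11 θ + q 2 * chol21 θ) * (p 2 * chol22 θ))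
      (p 2 * chol22 θ * (q 2 * chol22 θ)) 0 0 0 0).congr (fun g => by ring) ?_
    simp only [covForm, ← chol11_sq h, ← chol11_mul_chol21 h, ← chol21_sq_add h]
    ring
  have lin1 : ∀ p : Fin 3 → ℝ, HasInt ((gaussianReal 0 1).restrict (Set.Iic (tau θ)))
      (fun x => p 0 - x * (p 1 * del1 θ + p 2 * del2 θ))
      (p 0 * Phi (tau θ) + (p 1 * del1 θ + p 2 * del2 θ) * phi (tau θ)) := fun p =>
    ((t0.const_mul (p 0)).sub (t1.const_mul (p 1 * del1 θ + p 2 * del2 θ))).congr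
      (fun x => by ring) (by ring)
  have quad1 := ((t0.const_mul (p 0 * q 0)).sub (t1.const_mul
    (p 0 * (q 1 * del1 θ + q 2 * del2 θ) + q 0 * (p 1 * del1 θ + p 2 * del2 θ)))).add
    (t2.const_mul ((p 1 * del1 θ + p 2 * del2 θ) * (q 1 * del1 θ + q 2 * del2 θ)))
  have hone : HasInt stdPair (fun _ => 1) 1 := HasInt.const 1
  have main : HasInt (latentLaw θ)
      (fun w => affForm p (latent θ w.1 w.2) * affForm q (latent θ w.1 w.2)) _ :=
    ((((quad1.prod hone).add ((lin1 p).prod (lin q))).add ((lin1 q).prod (lin p))).add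
      (t0.prod quad)).congr (fun w => by
        simp only [affForm, latent, Matrix.cons_val_zero, Matrix.cons_val_one]
        ring) rfl
  obtain ⟨hi, hv⟩ := main
  have hml := (measurable_latent θ).aemeasurable (μ := latentLaw θ)
  have hF : Continuous fun z => affForm p z * affForm q z :=
    (continuous_affForm p).mul (continuous_affForm q)
  rw [HasMean, lawZ_eq_map h]
  constructor
  · exact ((integrable_map_measure hF.aestronglyMeasurable hml).2 hi).smul_measure
      ENNReal.ofReal_ne_top
  · rw [integral_smul_measure, integral_map hml hF.aestronglyMeasurable, hv,
      ENNReal.toReal_ofReal (by positivity), smul_eq_mul, zeta1]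
    field_simp
    ring

/-! Polynomially bounded functions are integrable. -/

/-- The weight `1 + |z₁| + |z₂|`, whose powers dominate all functions to be integrated. -/
def weight (z : Fin 2 → ℝ) : ℝ := 1 + |z 0| + |z 1|

lemma one_le_weight (z : Fin 2 → ℝ) : 1 ≤ weight z := by
  unfold weight; have := abs_nonneg (z 0); have := abs_nonneg (z 1); linarith

lemma continuous_weight : Continuous weight := by
  unfold weight; fun_prop

lemma integrable_weight_pow {θ : Fin 8 → ℝ} (h : Admissible θ) (n : ℕ) :
    Integrable (fun z => weight z ^ n) (lawZ θ) := by
  have hml := (measurable_latent θ).aemeasurable (μ := latentLaw θ)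
  have hcw : Continuous fun z => weight z ^ n := continuous_weight.pow n
  rw [lawZ_eq_map h]
  refine Integrable.smul_measure ?_ ENNReal.ofReal_ne_top
  rw [integrable_map_measure hcw.aestronglyMeasurable hml]
  set K := 1 + |chol11 θ| + |chol21 θ| + |chol22 θ| + |del1 θ| + |del2 θ| with hK
  have g := integrable_one_add_abs_pow_gaussian n
  have hint : Integrable (fun w : ℝ × ℝ × ℝ =>
      K ^ n * ((1 + |w.1|) ^ n * ((1 + |w.2.1|) ^ n * (1 + |w.2.2|) ^ n))) (latentLaw θ) :=
    ((g.integrableOn (s := Set.Iic (tau θ))).integrable.mul_prod (g.mul_prod g)).const_mul _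
  refine hint.mono' (hcw.measurable.comp (measurable_latent θ)).aestronglyMeasurable
    (Filter.Eventually.of_forall fun w => ?_)
  have hw := one_le_weight (latent θ w.1 w.2)
  rw [Function.comp_apply, norm_pow, Real.norm_eq_abs, abs_of_nonneg (by linarith),
    ← mul_pow, ← mul_pow, ← mul_pow]
  refine pow_le_pow_left₀ (by linarith) ?_ n
  obtain ⟨x, g1, g2⟩ := w
  simp only [weight, latent, Matrix.cons_val_zero, Matrix.cons_val_one]
  have e1 : |chol11 θ * g1 + -(x * del1 θ)| ≤ |chol11 θ| * |g1| + |x| * |del1 θ| := by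
    refine (abs_add_le _ _).trans ?_
    rw [abs_neg, abs_mul, abs_mul]
  have e2 : |chol21 θ * g1 + chol22 θ * g2 + -(x * del2 θ)| ≤
      |chol21 θ| * |g1| + |chol22 θ| * |g2| + |x| * |del2 θ| := by
    refine (abs_add_three _ _ _).trans ?_
    rw [abs_neg, abs_mul, abs_mul, abs_mul]
  have hx := abs_nonneg x
  have h1 := abs_nonneg g1
  have h2 := abs_nonneg g2
  have k1 := abs_nonneg (chol11 θ)
  have k2 := abs_nonneg (chol21 θ)
  have k3 := abs_nonneg (chol22 θ)
  have k4 := abs_nonneg (del1 θ)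
  have k5 := abs_nonneg (del2 θ)
  -- each of `1`, `|x|`, `|g₁|`, `|g₂|` is at most the product `P`
  set P := (1 + |x|) * ((1 + |g1|) * (1 + |g2|)) with hP
  have p0 : 1 ≤ P := by
    have : 0 ≤ |x| * ((1 + |g1|) * (1 + |g2|)) + (|g1| * (1 + |g2|) + |g2|) := by positivity
    linarith [hP]
  have p1 : |x| ≤ P := by
    have : 0 ≤ 1 + (1 + |x|) * (|g1| * (1 + |g2|) + |g2|) := by positivity
    linarith [hP]
  have p2 : |g1| ≤ P := by
    have : 0 ≤ |x| * ((1 + |g1|) * (1 + |g2|)) + (1 + (1 + |g1|) * |g2|) := by positivity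
    linarith [hP]
  have p3 : |g2| ≤ P := by
    have : 0 ≤ |x| * ((1 + |g1|) * (1 + |g2|)) + (1 + |g1| * (1 + |g2|)) := by positivity
    linarith [hP]
  calc 1 + |chol11 θ * g1 + -(x * del1 θ)| + |chol21 θ * g1 + chol22 θ * g2 + -(x * del2 θ)|
      ≤ 1 + (|chol11 θ| * |g1| + |x| * |del1 θ|) +
        (|chol21 θ| * |g1| + |chol22 θ| * |g2| + |x| * |del2 θ|) := by gcongr
    _ ≤ P + (|chol11 θ| * P + P * |del1 θ|) +
        (|chol21 θ| * P + |chol22 θ| * P + P * |del2 θ|) := by gcongr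
    _ = K * P := by rw [hK]; ring

lemma integrable_of_le_weight {θ : Fin 8 → ℝ} (h : Admissible θ) {f : (Fin 2 → ℝ) → ℝ}
    (hf : Continuous f) {C : ℝ} {n : ℕ} (hb : ∀ z, |f z| ≤ C * weight z ^ n) :
    Integrable f (lawZ θ) :=
  ((integrable_weight_pow h n).const_mul C).mono' hf.aestronglyMeasurable
    (Filter.Eventually.of_forall hb)

lemma one_add_abs_T_le (θ : Fin 8 → ℝ) :
    ∃ K, 0 ≤ K ∧ ∀ z, 1 + |T θ z| ≤ K * weight z := by
  refine ⟨1 + |alpha0 θ| + |al1 θ| + |al2 θ|, by positivity, fun z => ?_⟩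
  have h1 : |T θ z| ≤ |alpha0 θ| + |al1 θ| * |z 0| + |al2 θ| * |z 1| := by
    rw [T, ← abs_mul, ← abs_mul]; exact abs_add_three _ _ _
  have : (1 + |alpha0 θ| + |al1 θ| + |al2 θ|) * weight z =
      1 + |alpha0 θ| + |al1 θ| * |z 0| + |al2 θ| * |z 1| + (|al1 θ| * (1 + |z 1|) +
      |al2 θ| * (1 + |z 0|) + |alpha0 θ| * (|z 0| + |z 1|) + |z 0| + |z 1|) := by
    rw [weight]; ring
  have : 0 ≤ |al1 θ| * (1 + |z 1|) +
      |al2 θ| * (1 + |z 0|) + |alpha0 θ| * (|z 0| + |z 1|) + |z 0| + |z 1| := by positivity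
  linarith

lemma abs_affForm_le (p : Fin 3 → ℝ) (z : Fin 2 → ℝ) :
    |affForm p z| ≤ (|p 0| + |p 1| + |p 2|) * weight z := by
  have h1 : |affForm p z| ≤ |p 0| + |p 1| * |z 0| + |p 2| * |z 1| := by
    rw [affForm, ← abs_mul, ← abs_mul]; exact abs_add_three _ _ _
  have : (|p 0| + |p 1| + |p 2|) * weight z =
      |p 0| + |p 1| * |z 0| + |p 2| * |z 1| + (|p 1| * (1 + |z 1|) +
      |p 2| * (1 + |z 0|) + |p 0| * (|z 0| + |z 1|)) := by
    rw [weight]; ring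
  have : 0 ≤ |p 1| * (1 + |z 1|) +
      |p 2| * (1 + |z 0|) + |p 0| * (|z 0| + |z 1|) := by positivity
  linarith

lemma integrable_mul_zeta1_sq {θ : Fin 8 → ℝ} (h : Admissible θ) (p q : Fin 3 → ℝ) :
    Integrable (fun z => affForm p z * affForm q z * zeta1 (T θ z) ^ 2) (lawZ θ) := by
  obtain ⟨K, hK0, hK⟩ := one_add_abs_T_le θ
  have c1 := continuous_affForm p
  have c2 := continuous_affForm q
  have c3 := continuous_zeta1
  have c4 := continuous_T θ
  refine integrable_of_le_weight h (by fun_prop) (n := 4)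
    (C := (|p 0| + |p 1| + |p 2|) * (|q 0| + |q 1| + |q 2|) * (Real.exp (3 / 2) * K) ^ 2)
    fun z => ?_
  have hw := one_le_weight z
  have hz : |zeta1 (T θ z)| ≤ Real.exp (3 / 2) * (K * weight z) :=
    (abs_zeta1_le _).trans (by gcongr; exact hK z)
  rw [abs_mul, abs_mul, abs_pow]
  calc |affForm p z| * |affForm q z| * |zeta1 (T θ z)| ^ 2
      ≤ (|p 0| + |p 1| + |p 2|) * weight z * ((|q 0| + |q 1| + |q 2|) * weight z) *
        (Real.exp (3 / 2) * (K * weight z)) ^ 2 := by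
        gcongr
        · exact abs_affForm_le p z
        · exact abs_affForm_le q z
    _ = _ := by ring

/-- `ζ₂(T) = -T ζ₁(T) - ζ₁(T)²` turns moments weighted by `ζ₂` into moments weighted by `ζ₁`. -/
lemma hasMean_mul_zeta2 {θ : Fin 8 → ℝ} (h : Admissible θ) (p q : Fin 3 → ℝ) :
    HasMean (lawZ θ) (fun z => affForm p z * affForm q z * zeta2 (T θ z))
      (-(zeta1 (tau θ) / sStar θ *
        (affForm p ![-(tau θ * del1 θ), -(tau θ * del2 θ)] *
            affForm q ![-(tau θ * del1 θ), -(tau θ * del2 θ)] *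
            T θ ![-(tau θ * del1 θ), -(tau θ * del2 θ)] +
          affForm p ![-(tau θ * del1 θ), -(tau θ * del2 θ)] *
            covForm θ q ![alpha0 θ, al1 θ, al2 θ] +
          affForm q ![-(tau θ * del1 θ), -(tau θ * del2 θ)] *
            covForm θ p ![alpha0 θ, al1 θ, al2 θ] +
          T θ ![-(tau θ * del1 θ), -(tau θ * del2 θ)] * covForm θ p q)) -
        ∫ z, affForm p z * affForm q z * zeta1 (T θ z) ^ 2 ∂(lawZ θ)) := by
  have h1 : HasInt _ _ _ := hasMean_mul_zeta1 h p q ![alpha0 θ, al1 θ, al2 θ]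
  have h2 : HasInt (lawZ θ) (fun z => affForm p z * affForm q z * zeta1 (T θ z) ^ 2) _ :=
    ⟨integrable_mul_zeta1_sq h p q, rfl⟩
  refine (h1.neg.sub h2).congr (fun z => ?_) ?_
  · simp [zeta2, affForm, T]; ring
  · simp [affForm, T]

/-! ### The closed forms of the moments -/

section Moments

variable {θ : Fin 8 → ℝ}

lemma HasMean.congr {μ : Measure (Fin 2 → ℝ)} {f g : (Fin 2 → ℝ) → ℝ} {a b : ℝ}
    (hf : HasMean μ f a) (h : ∀ x, g x = f x) (hab : b = a) : HasMean μ g b :=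
  HasInt.congr hf h hab

lemma hasMean_Z1 (h : Admissible θ) : HasMean (lawZ θ) (fun z => z 0) (meanZ1 θ) :=
  (hasMean_affForm h ![0, 1, 0] ![1, 0, 0]).congr (fun z => by simp [affForm])
    (by simp [covForm, meanZ1])

lemma hasMean_Z2 (h : Admissible θ) : HasMean (lawZ θ) (fun z => z 1) (meanZ2 θ) :=
  (hasMean_affForm h ![0, 0, 1] ![1, 0, 0]).congr (fun z => by simp [affForm])
    (by simp [covForm, meanZ2])

lemma hasMean_Z1Z2 (h : Admissible θ) : HasMean (lawZ θ) (fun z => z 0 * z 1) (meanZ1Z2 θ) :=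
  (hasMean_affForm h ![0, 1, 0] ![0, 0, 1]).congr (fun z => by simp [affForm])
    (by simp [covForm, meanZ1Z2, v12, zeta2]; ring)

lemma hasMean_Z1Sq (h : Admissible θ) : HasMean (lawZ θ) (fun z => z 0 ^ 2) (meanZ1Sq θ) :=
  (hasMean_affForm h ![0, 1, 0] ![0, 1, 0]).congr (fun z => by simp [affForm, sq])
    (by simp [covForm, meanZ1Sq, v11, zeta2]; ring)

lemma hasMean_Z2Sq (h : Admissible θ) : HasMean (lawZ θ) (fun z => z 1 ^ 2) (meanZ2Sq θ) :=
  (hasMean_affForm h ![0, 0, 1] ![0, 0, 1]).congr (fun z => by simp [affForm, sq])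
    (by simp [covForm, meanZ2Sq, v22, zeta2]; ring)

lemma hasMean_zeta1 (h : Admissible θ) :
    HasMean (lawZ θ) (fun z => zeta1 (T θ z)) (meanZeta1 θ) :=
  (hasMean_mul_zeta1 h ![1, 0, 0] ![1, 0, 0] ![1, 0, 0]).congr (fun z => by simp [affForm])
    (by simp [covForm, affForm, meanZeta1])

lemma hasMean_Z1_zeta1 (h : Admissible θ) :
    HasMean (lawZ θ) (fun z => z 0 * zeta1 (T θ z)) (meanZ1Zeta1 θ) :=
  (hasMean_mul_zeta1 h ![0, 1, 0] ![1, 0, 0] ![1, 0, 0]).congr (fun z => by simp [affForm])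
    (by simp [covForm, affForm, meanZ1Zeta1]; ring)

lemma hasMean_Z2_zeta1 (h : Admissible θ) :
    HasMean (lawZ θ) (fun z => z 1 * zeta1 (T θ z)) (meanZ2Zeta1 θ) :=
  (hasMean_mul_zeta1 h ![0, 0, 1] ![1, 0, 0] ![1, 0, 0]).congr (fun z => by simp [affForm])
    (by simp [covForm, affForm, meanZ2Zeta1]; ring)

lemma hasMean_zeta2 (h : Admissible θ) :
    HasMean (lawZ θ) (fun z => zeta2 (T θ z)) (meanZeta2 θ) :=
  (hasMean_mul_zeta2 h ![1, 0, 0] ![1, 0, 0]).congr (fun z => by simp [affForm])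
    (by simp [covForm, affForm, meanZeta2, T, a0]; ring)

lemma hasMean_Z1_zeta2 (h : Admissible θ) :
    HasMean (lawZ θ) (fun z => z 0 * zeta2 (T θ z)) (meanZ1Zeta2 θ) :=
  (hasMean_mul_zeta2 h ![0, 1, 0] ![1, 0, 0]).congr (fun z => by simp [affForm])
    (by simp [covForm, affForm, meanZ1Zeta2, T, aPow]; ring)

lemma hasMean_Z2_zeta2 (h : Admissible θ) :
    HasMean (lawZ θ) (fun z => z 1 * zeta2 (T θ z)) (meanZ2Zeta2 θ) :=
  (hasMean_mul_zeta2 h ![0, 0, 1] ![1, 0, 0]).congr (fun z => by simp [affForm])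
    (by simp [covForm, affForm, meanZ2Zeta2, T, aPow]; ring)

lemma hasMean_Z1Sq_zeta2 (h : Admissible θ) :
    HasMean (lawZ θ) (fun z => z 0 ^ 2 * zeta2 (T θ z)) (meanZ1SqZeta2 θ) := by
  have := (v11_pos h).ne'
  refine (hasMean_mul_zeta2 h ![0, 1, 0] ![0, 1, 0]).congr (fun z => by simp [affForm, sq]) ?_
  simp [covForm, affForm, meanZ1SqZeta2, T, aPow, sq]
  field_simp
  ring

lemma hasMean_Z2Sq_zeta2 (h : Admissible θ) :
    HasMean (lawZ θ) (fun z => z 1 ^ 2 * zeta2 (T θ z)) (meanZ2SqZeta2 θ) := by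
  have := (v22_pos h).ne'
  refine (hasMean_mul_zeta2 h ![0, 0, 1] ![0, 0, 1]).congr (fun z => by simp [affForm, sq]) ?_
  simp [covForm, affForm, meanZ2SqZeta2, T, aPow, sq]
  field_simp
  ring

lemma hasMean_Z1Z2_zeta2 (h : Admissible θ) :
    HasMean (lawZ θ) (fun z => z 0 * z 1 * zeta2 (T θ z)) (meanZ1Z2Zeta2 θ) := by
  have h1 := (v11_pos h).ne'
  have h2 := (v22_pos h).ne'
  refine (hasMean_mul_zeta2 h ![0, 1, 0] ![0, 0, 1]).congr (fun z => by simp [affForm]) ?_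
  simp [covForm, affForm, meanZ1Z2Zeta2, T, aMix]
  field_simp
  ring

lemma integrable_coord_mul_zeta1_sq (h : Admissible θ) (i j : Fin 2) :
    Integrable (fun z => z i * z j * zeta1 (T θ z) ^ 2) (lawZ θ) := by
  refine (integrable_mul_zeta1_sq h ![0, if i = 0 then 1 else 0, if i = 0 then 0 else 1]
    ![0, if j = 0 then 1 else 0, if j = 0 then 0 else 1]).congr
    (Filter.Eventually.of_forall fun z => ?_)
  fin_cases i <;> fin_cases j <;> simp [affForm]

lemma integrable_zeta1_sq (h : Admissible θ) :
    Integrable (fun z => zeta1 (T θ z) ^ 2) (lawZ θ) :=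
  (integrable_mul_zeta1_sq h ![1, 0, 0] ![1, 0, 0]).congr
    (Filter.Eventually.of_forall fun z => by simp [affForm])

lemma integrable_pow_mul_zeta1_sq (h : Admissible θ) (j : Fin 2) {p : ℕ} (hp : p ≤ 2) :
    Integrable (fun z => z j ^ p * zeta1 (T θ z) ^ 2) (lawZ θ) := by
  interval_cases p
  · simpa using integrable_zeta1_sq h
  · refine (integrable_mul_zeta1_sq h ![0, if j = 0 then 1 else 0, if j = 0 then 0 else 1]
      ![1, 0, 0]).congr (Filter.Eventually.of_forall fun z => ?_)
    fin_cases j <;> simp [affForm]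
  · simpa [sq] using integrable_coord_mul_zeta1_sq h j j

end Moments

/-! ### First and second derivatives of the log-likelihood -/

/-- `Ω₁₁^{-1/2}`. -/
def isd1 (θ : Fin 8 → ℝ) : ℝ := (√(Om11 θ))⁻¹

/-- `Ω₂₂^{-1/2}`. -/
def isd2 (θ : Fin 8 → ℝ) : ℝ := (√(Om22 θ))⁻¹

/-- `1 / (1 - λ²)`. -/
def kap (θ : Fin 8 → ℝ) : ℝ := (1 - lam θ ^ 2)⁻¹

/-- `(1 - λ²)` times the quadratic form of `Ω̄⁻¹`. -/
def quad (θ : Fin 8 → ℝ) (z : Fin 2 → ℝ) : ℝ := z 0 ^ 2 - 2 * lam θ * z 0 * z 1 + z 1 ^ 2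

/-! Derivatives along a direction `e` in the parameter space. Those of quantities that involve the
observation are written in terms of the standardized observation `z = ω⁻¹ (y - ξ)`, which itself
depends on the parameter. -/

/-- Derivative of `λ`. -/
def dLam (e θ : Fin 8 → ℝ) : ℝ :=
  -(lam θ / 2 * (isd1 θ ^ 2 * e 2 + isd2 θ ^ 2 * e 4)) + isd1 θ * isd2 θ * e 3

/-- Derivative of the first coordinate of the standardized observation. -/
def dStd1 (e θ : Fin 8 → ℝ) (z : Fin 2 → ℝ) : ℝ :=
  -(e 0 * isd1 θ) - isd1 θ ^ 2 * e 2 / 2 * z 0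

/-- Derivative of the second coordinate of the standardized observation. -/
def dStd2 (e θ : Fin 8 → ℝ) (z : Fin 2 → ℝ) : ℝ :=
  -(e 1 * isd2 θ) - isd2 θ ^ 2 * e 4 / 2 * z 1

/-- Derivative of `α*² / 2`. -/
def dHalfAlphaSq (e θ : Fin 8 → ℝ) : ℝ :=
  al1 θ * e 5 + al2 θ * e 6 + (e 5 * al2 θ + al1 θ * e 6) * lam θ + al1 θ * al2 θ * dLam e θ

/-- Derivative of `√(1 + α*²)`. -/
def dSStar (e θ : Fin 8 → ℝ) : ℝ := dHalfAlphaSq e θ * (sStar θ)⁻¹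

/-- Derivative of the argument `T` of `Φ`. -/
def dT (e θ : Fin 8 → ℝ) (z : Fin 2 → ℝ) : ℝ :=
  e 7 * sStar θ + tau θ * dSStar e θ + e 5 * z 0 + al1 θ * dStd1 e θ z + e 6 * z 1 +
    al2 θ * dStd2 e θ z

/-- Derivative of `quad`. -/
def dQuad (e θ : Fin 8 → ℝ) (z : Fin 2 → ℝ) : ℝ :=
  2 * (z 0 * dStd1 e θ z) - 2 * (dLam e θ * (z 0 * z 1)) -
    2 * (lam θ * (dStd1 e θ z * z 1 + z 0 * dStd2 e θ z)) + 2 * (z 1 * dStd2 e θ z)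

/-- Derivative of the log-likelihood. -/
def dLogLik (e θ : Fin 8 → ℝ) (z : Fin 2 → ℝ) : ℝ :=
  -(1 / 2 * (isd1 θ ^ 2 * e 2 + isd2 θ ^ 2 * e 4)) + lam θ * kap θ * dLam e θ -
    lam θ * kap θ ^ 2 * dLam e θ * quad θ z - 1 / 2 * (kap θ * dQuad e θ z) +
    zeta1 (T θ z) * dT e θ z - zeta1 (tau θ) * e 7

/-! Second derivatives along two directions `e` and `f`. -/

/-- Second derivative of `λ`. -/
def ddLam (e f θ : Fin 8 → ℝ) : ℝ :=
  -(dLam f θ / 2 * (isd1 θ ^ 2 * e 2 + isd2 θ ^ 2 * e 4)) +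
    lam θ / 2 * (isd1 θ ^ 4 * e 2 * f 2 + isd2 θ ^ 4 * e 4 * f 4) -
    e 3 / 2 * (isd1 θ ^ 3 * isd2 θ * f 2 + isd1 θ * isd2 θ ^ 3 * f 4)

/-- Second derivative of the first coordinate of the standardized observation. -/
def ddStd1 (e f θ : Fin 8 → ℝ) (z : Fin 2 → ℝ) : ℝ :=
  e 0 * isd1 θ ^ 3 * f 2 / 2 + isd1 θ ^ 4 * e 2 * f 2 / 2 * z 0 -
    isd1 θ ^ 2 * e 2 / 2 * dStd1 f θ z

/-- Second derivative of the second coordinate of the standardized observation. -/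
def ddStd2 (e f θ : Fin 8 → ℝ) (z : Fin 2 → ℝ) : ℝ :=
  e 1 * isd2 θ ^ 3 * f 4 / 2 + isd2 θ ^ 4 * e 4 * f 4 / 2 * z 1 -
    isd2 θ ^ 2 * e 4 / 2 * dStd2 f θ z

/-- Second derivative of `α*² / 2`. -/
def ddHalfAlphaSq (e f θ : Fin 8 → ℝ) : ℝ :=
  e 5 * f 5 + e 6 * f 6 + (e 5 * f 6 + f 5 * e 6) * lam θ +
    (e 5 * al2 θ + al1 θ * e 6) * dLam f θ + (f 5 * al2 θ + al1 θ * f 6) * dLam e θ +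
    al1 θ * al2 θ * ddLam e f θ

/-- Second derivative of `√(1 + α*²)`. -/
def ddSStar (e f θ : Fin 8 → ℝ) : ℝ :=
  ddHalfAlphaSq e f θ * (sStar θ)⁻¹ - dHalfAlphaSq e θ * dHalfAlphaSq f θ * (sStar θ)⁻¹ ^ 3

/-- Second derivative of `T`. -/
def ddT (e f θ : Fin 8 → ℝ) (z : Fin 2 → ℝ) : ℝ :=
  e 7 * dSStar f θ + f 7 * dSStar e θ + tau θ * ddSStar e f θ +
    e 5 * dStd1 f θ z + f 5 * dStd1 e θ z + al1 θ * ddStd1 e f θ z +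
    e 6 * dStd2 f θ z + f 6 * dStd2 e θ z + al2 θ * ddStd2 e f θ z

/-- Second derivative of `quad`. -/
def ddQuad (e f θ : Fin 8 → ℝ) (z : Fin 2 → ℝ) : ℝ :=
  2 * (dStd1 f θ z * dStd1 e θ z + z 0 * ddStd1 e f θ z) - 2 * (ddLam e f θ * (z 0 * z 1)) -
    2 * (dLam e θ * (dStd1 f θ z * z 1 + z 0 * dStd2 f θ z)) -
    2 * (dLam f θ * (dStd1 e θ z * z 1 + z 0 * dStd2 e θ z)) -
    2 * (lam θ * (ddStd1 e f θ z * z 1 + dStd1 e θ z * dStd2 f θ z + dStd1 f θ z * dStd2 e θ z +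
      z 0 * ddStd2 e f θ z)) +
    2 * (dStd2 f θ z * dStd2 e θ z + z 1 * ddStd2 e f θ z)

/-- Second derivative of the log-likelihood. -/
def ddLogLik (e f θ : Fin 8 → ℝ) (z : Fin 2 → ℝ) : ℝ :=
  1 / 2 * (isd1 θ ^ 4 * e 2 * f 2 + isd2 θ ^ 4 * e 4 * f 4) +
    (kap θ + 2 * lam θ ^ 2 * kap θ ^ 2) * (dLam e θ * dLam f θ) + lam θ * kap θ * ddLam e f θ -
    ((kap θ ^ 2 + 4 * lam θ ^ 2 * kap θ ^ 3) * (dLam e θ * dLam f θ) +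
      lam θ * kap θ ^ 2 * ddLam e f θ) * quad θ z -
    lam θ * kap θ ^ 2 * (dLam e θ * dQuad f θ z + dLam f θ * dQuad e θ z) -
    1 / 2 * (kap θ * ddQuad e f θ z) +
    zeta2 (T θ z) * (dT e θ z * dT f θ z) + zeta1 (T θ z) * ddT e f θ z -
    zeta2 (tau θ) * (e 7 * f 7)

lemma logLik_eq {θ : Fin 8 → ℝ} (h : Admissible θ) (y : Fin 2 → ℝ) :
    logLik θ y = -Real.log (2 * Real.pi) - 1 / 2 * Real.log (Om11 θ) -
      1 / 2 * Real.log (Om22 θ) - 1 / 2 * Real.log (1 - lam θ ^ 2) -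
      1 / 2 * (kap θ * quad θ (stdize θ y)) + Real.log (Phi (T θ (stdize θ y))) -
      Real.log (Phi (tau θ)) := by
  have q1 := Real.sqrt_pos.2 h.1
  have q2 := Real.sqrt_pos.2 h.2.1
  have hm : 0 < 1 - lam θ ^ 2 := by linarith [sq_lam_lt_one h]
  have q3 := Real.sqrt_pos.2 hm
  have hpi := Real.pi_pos
  have hP := Phi_pos (tau θ)
  have hP' := Phi_pos (T θ (stdize θ y))
  rw [logLik, density_eq_stdized h, density_stdized h, normalDensity,
    Real.log_mul (by positivity) (by positivity), Real.log_div (by positivity) (by positivity),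
    Real.log_mul (by positivity) (by positivity), Real.log_mul (by positivity) (by positivity),
    Real.log_exp, Real.log_inv, Real.log_inv, Real.log_mul (by positivity) (by positivity),
    Real.log_mul (x := 2 * Real.pi) (by positivity) (by positivity), Real.log_sqrt h.1.le,
    Real.log_sqrt h.2.1.le, Real.log_sqrt hm.le, kap, quad]
  ring

section Derivatives

variable {c : ℝ → Fin 8 → ℝ} {f : Fin 8 → ℝ} {t : ℝ}

lemma hasDerivAt_isd1 (hc : ∀ k, HasDerivAt (fun x => c x k) (f k) t) (h : Admissible (c t)) :
    HasDerivAt (fun x => isd1 (c x)) (-(isd1 (c t) ^ 3 / 2 * f 2)) t := by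
  have q1 := Real.sqrt_pos.2 h.1
  refine (((hc 2).sqrt h.1.ne').inv q1.ne').congr_deriv ?_
  rw [isd1]; field_simp

lemma hasDerivAt_isd2 (hc : ∀ k, HasDerivAt (fun x => c x k) (f k) t) (h : Admissible (c t)) :
    HasDerivAt (fun x => isd2 (c x)) (-(isd2 (c t) ^ 3 / 2 * f 4)) t := by
  have q1 := Real.sqrt_pos.2 h.2.1
  refine (((hc 4).sqrt h.2.1.ne').inv q1.ne').congr_deriv ?_
  rw [isd2]; field_simp

lemma lam_eq {θ : Fin 8 → ℝ} (h : Admissible θ) : lam θ = Om12 θ * (isd1 θ * isd2 θ) := by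
  rw [lam, Real.sqrt_mul h.1.le, div_eq_mul_inv, mul_inv, isd1, isd2]

lemma eventually_admissible (hc : ∀ k, HasDerivAt (fun x => c x k) (f k) t)
    (h : Admissible (c t)) : ∀ᶠ x in nhds t, Admissible (c x) :=
  (hasDerivAt_pi.2 hc).continuousAt.eventually (isOpen_admissible.mem_nhds h)

lemma hasDerivAt_lam (hc : ∀ k, HasDerivAt (fun x => c x k) (f k) t) (h : Admissible (c t)) :
    HasDerivAt (fun x => lam (c x)) (dLam f (c t)) t := by
  have h1 := hasDerivAt_isd1 hc h
  have h2 := hasDerivAt_isd2 hc h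
  have : HasDerivAt (fun x => c x 3 * (isd1 (c x) * isd2 (c x))) (dLam f (c t)) t := by
    refine ((hc 3).mul (h1.mul h2)).congr_deriv ?_
    rw [dLam, lam_eq h]
    simp only [Pi.mul_apply]
    ring
  exact this.congr_of_eventuallyEq ((eventually_admissible hc h).mono fun x hx => lam_eq hx)

lemma hasDerivAt_std1 (hc : ∀ k, HasDerivAt (fun x => c x k) (f k) t) (h : Admissible (c t))
    (y : Fin 2 → ℝ) :
    HasDerivAt (fun x => stdize (c x) y 0) (dStd1 f (c t) (stdize (c t) y)) t := by
  have : HasDerivAt (fun x => (y 0 - c x 0) * isd1 (c x))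
      (dStd1 f (c t) (stdize (c t) y)) t := by
    refine (((hc 0).const_sub (y 0)).mul (hasDerivAt_isd1 hc h)).congr_deriv ?_
    simp only [dStd1, stdize, Matrix.cons_val_zero, isd1]
    ring
  exact this

lemma hasDerivAt_std2 (hc : ∀ k, HasDerivAt (fun x => c x k) (f k) t) (h : Admissible (c t))
    (y : Fin 2 → ℝ) :
    HasDerivAt (fun x => stdize (c x) y 1) (dStd2 f (c t) (stdize (c t) y)) t := by
  have : HasDerivAt (fun x => (y 1 - c x 1) * isd2 (c x))
      (dStd2 f (c t) (stdize (c t) y)) t := by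
    refine (((hc 1).const_sub (y 1)).mul (hasDerivAt_isd2 hc h)).congr_deriv ?_
    simp only [dStd2, stdize, Matrix.cons_val_one, Matrix.cons_val_zero, isd2]
    ring
  exact this

lemma hasDerivAt_sStar (hc : ∀ k, HasDerivAt (fun x => c x k) (f k) t) (h : Admissible (c t)) :
    HasDerivAt (fun x => sStar (c x)) (dSStar f (c t)) t := by
  have hl := hasDerivAt_lam hc h
  have h5 := hc 5
  have h6 := hc 6
  have ha : HasDerivAt (fun x => 1 + alphaStarSq (c x)) (2 * dHalfAlphaSq f (c t)) t := by
    unfold alphaStarSq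
    refine HasDerivAt.congr_deriv (by
      repeat' first
        | exact hasDerivAt_const _ _
        | assumption
        | apply HasDerivAt.fun_pow
        | apply HasDerivAt.fun_add
        | apply HasDerivAt.fun_mul) ?_
    rw [dHalfAlphaSq]
    push_cast
    ring
  have hs := sStar_pos h
  refine (ha.sqrt (by rw [← sStar_sq h]; positivity)).congr_deriv ?_
  rw [dSStar]
  change _ / (2 * sStar (c t)) = _
  field_simp

lemma hasDerivAt_inv_sStar (hc : ∀ k, HasDerivAt (fun x => c x k) (f k) t)
    (h : Admissible (c t)) :
    HasDerivAt (fun x => (sStar (c x))⁻¹) (-(dSStar f (c t) * (sStar (c t))⁻¹ ^ 2)) t := by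
  have hs := sStar_pos h
  refine ((hasDerivAt_sStar hc h).inv hs.ne').congr_deriv ?_
  field_simp

lemma hasDerivAt_kap (hc : ∀ k, HasDerivAt (fun x => c x k) (f k) t) (h : Admissible (c t)) :
    HasDerivAt (fun x => kap (c x)) (2 * lam (c t) * kap (c t) ^ 2 * dLam f (c t)) t := by
  have hm : 1 - lam (c t) ^ 2 ≠ 0 := by linarith [sq_lam_lt_one h]
  refine ((((hasDerivAt_lam hc h).fun_pow 2).const_sub 1).inv hm).congr_deriv ?_
  rw [kap]
  field_simp
  push_cast
  ring

lemma hasDerivAt_T (hc : ∀ k, HasDerivAt (fun x => c x k) (f k) t) (h : Admissible (c t))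
    (y : Fin 2 → ℝ) :
    HasDerivAt (fun x => T (c x) (stdize (c x) y)) (dT f (c t) (stdize (c t) y)) t := by
  have h1 := hasDerivAt_std1 hc h y
  have h2 := hasDerivAt_std2 hc h y
  have h3 := hasDerivAt_sStar hc h
  refine ((((hc 7).mul h3).add ((hc 5).mul h1)).add ((hc 6).mul h2)).congr_deriv ?_
  rw [dT]
  ring

lemma hasDerivAt_quad (hc : ∀ k, HasDerivAt (fun x => c x k) (f k) t) (h : Admissible (c t))
    (y : Fin 2 → ℝ) :
    HasDerivAt (fun x => quad (c x) (stdize (c x) y)) (dQuad f (c t) (stdize (c t) y)) t := by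
  have h1 := hasDerivAt_std1 hc h y
  have h2 := hasDerivAt_std2 hc h y
  have h3 := hasDerivAt_lam hc h
  unfold quad
  refine HasDerivAt.congr_deriv (by
    repeat' first
      | exact hasDerivAt_const _ _
      | assumption
      | apply HasDerivAt.fun_pow
      | apply HasDerivAt.fun_sub
      | apply HasDerivAt.fun_add
      | apply HasDerivAt.fun_mul) ?_
  rw [dQuad]
  push_cast
  ring

lemma hasDerivAt_logLik (hc : ∀ k, HasDerivAt (fun x => c x k) (f k) t) (h : Admissible (c t))
    (y : Fin 2 → ℝ) :
    HasDerivAt (fun x => logLik (c x) y) (dLogLik f (c t) (stdize (c t) y)) t := by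
  have hm : 1 - lam (c t) ^ 2 ≠ 0 := by linarith [sq_lam_lt_one h]
  have h1 := (hc 2).log h.1.ne'
  have h2 := (hc 4).log h.2.1.ne'
  have h3 := (((hasDerivAt_lam hc h).fun_pow 2).const_sub 1).log hm
  have h4 := (hasDerivAt_kap hc h).mul (hasDerivAt_quad hc h y)
  have h5 := (hasDerivAt_log_Phi _).comp t (hasDerivAt_T hc h y)
  have h6 := (hasDerivAt_log_Phi _).comp t (hc 7)
  have key := ((((((h1.const_mul (1 / 2)).const_sub (-Real.log (2 * Real.pi))).sub
    (h2.const_mul (1 / 2))).sub (h3.const_mul (1 / 2))).sub (h4.const_mul (1 / 2))).add h5).sub h6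
  refine (key.congr_of_eventuallyEq
    ((eventually_admissible hc h).mono fun x hx => logLik_eq hx y)).congr_deriv ?_
  have e1 : isd1 (c t) ^ 2 = (c t 2)⁻¹ := by rw [isd1, inv_pow, Real.sq_sqrt h.1.le]
  have e2 : isd2 (c t) ^ 2 = (c t 4)⁻¹ := by rw [isd2, inv_pow, Real.sq_sqrt h.2.1.le]
  rw [dLogLik, e1, e2, kap]
  push_cast
  ring

variable (e : Fin 8 → ℝ)

lemma hasDerivAt_dLam (hc : ∀ k, HasDerivAt (fun x => c x k) (f k) t) (h : Admissible (c t)) :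
    HasDerivAt (fun x => dLam e (c x)) (ddLam e f (c t)) t := by
  have h1 := hasDerivAt_isd1 hc h
  have h2 := hasDerivAt_isd2 hc h
  have h3 := hasDerivAt_lam hc h
  unfold dLam
  refine HasDerivAt.congr_deriv (by
    repeat' first
      | exact hasDerivAt_const _ _
      | assumption
      | apply HasDerivAt.fun_pow
      | apply HasDerivAt.fun_add
      | apply HasDerivAt.fun_neg
      | apply HasDerivAt.fun_mul) ?_
  rw [ddLam]
  push_cast
  ring

lemma hasDerivAt_dStd1 (hc : ∀ k, HasDerivAt (fun x => c x k) (f k) t) (h : Admissible (c t))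
    (y : Fin 2 → ℝ) :
    HasDerivAt (fun x => dStd1 e (c x) (stdize (c x) y))
      (ddStd1 e f (c t) (stdize (c t) y)) t := by
  have h1 := hasDerivAt_isd1 hc h
  have h2 := hasDerivAt_std1 hc h y
  unfold dStd1
  refine HasDerivAt.congr_deriv (by
    repeat' first
      | exact hasDerivAt_const _ _
      | assumption
      | apply HasDerivAt.fun_pow
      | apply HasDerivAt.fun_sub
      | apply HasDerivAt.fun_neg
      | apply HasDerivAt.fun_mul) ?_
  rw [ddStd1]
  push_cast
  ring

lemma hasDerivAt_dStd2 (hc : ∀ k, HasDerivAt (fun x => c x k) (f k) t) (h : Admissible (c t))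
    (y : Fin 2 → ℝ) :
    HasDerivAt (fun x => dStd2 e (c x) (stdize (c x) y))
      (ddStd2 e f (c t) (stdize (c t) y)) t := by
  have h1 := hasDerivAt_isd2 hc h
  have h2 := hasDerivAt_std2 hc h y
  unfold dStd2
  refine HasDerivAt.congr_deriv (by
    repeat' first
      | exact hasDerivAt_const _ _
      | assumption
      | apply HasDerivAt.fun_pow
      | apply HasDerivAt.fun_sub
      | apply HasDerivAt.fun_neg
      | apply HasDerivAt.fun_mul) ?_
  rw [ddStd2]
  push_cast
  ring

lemma hasDerivAt_dSStar (hc : ∀ k, HasDerivAt (fun x => c x k) (f k) t) (h : Admissible (c t)) :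
    HasDerivAt (fun x => dSStar e (c x)) (ddSStar e f (c t)) t := by
  have h1 := hasDerivAt_inv_sStar hc h
  have h2 := hasDerivAt_lam hc h
  have h3 := hasDerivAt_dLam e hc h
  have h5 := hc 5
  have h6 := hc 6
  unfold dSStar dHalfAlphaSq
  refine HasDerivAt.congr_deriv (by
    repeat' first
      | exact hasDerivAt_const _ _
      | assumption
      | apply HasDerivAt.fun_add
      | apply HasDerivAt.fun_mul) ?_
  rw [ddSStar, ddHalfAlphaSq, dSStar, dHalfAlphaSq, dHalfAlphaSq]
  ring

lemma hasDerivAt_dT (hc : ∀ k, HasDerivAt (fun x => c x k) (f k) t) (h : Admissible (c t))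
    (y : Fin 2 → ℝ) :
    HasDerivAt (fun x => dT e (c x) (stdize (c x) y)) (ddT e f (c t) (stdize (c t) y)) t := by
  have h1 := hasDerivAt_sStar hc h
  have h2 := hasDerivAt_dSStar e hc h
  have h3 := hasDerivAt_std1 hc h y
  have h4 := hasDerivAt_std2 hc h y
  have h5 := hasDerivAt_dStd1 e hc h y
  have h6 := hasDerivAt_dStd2 e hc h y
  have h7 := hc 5
  have h8 := hc 6
  have h9 := hc 7
  unfold dT
  refine HasDerivAt.congr_deriv (by
    repeat' first
      | exact hasDerivAt_const _ _
      | assumption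
      | apply HasDerivAt.fun_add
      | apply HasDerivAt.fun_mul) ?_
  rw [ddT]
  ring

lemma hasDerivAt_dQuad (hc : ∀ k, HasDerivAt (fun x => c x k) (f k) t) (h : Admissible (c t))
    (y : Fin 2 → ℝ) :
    HasDerivAt (fun x => dQuad e (c x) (stdize (c x) y))
      (ddQuad e f (c t) (stdize (c t) y)) t := by
  have h1 := hasDerivAt_lam hc h
  have h2 := hasDerivAt_dLam e hc h
  have h3 := hasDerivAt_std1 hc h y
  have h4 := hasDerivAt_std2 hc h y
  have h5 := hasDerivAt_dStd1 e hc h y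
  have h6 := hasDerivAt_dStd2 e hc h y
  unfold dQuad
  refine HasDerivAt.congr_deriv (by
    repeat' first
      | exact hasDerivAt_const _ _
      | assumption
      | apply HasDerivAt.fun_sub
      | apply HasDerivAt.fun_add
      | apply HasDerivAt.fun_mul) ?_
  rw [ddQuad]
  ring

lemma hasDerivAt_dLogLik (hc : ∀ k, HasDerivAt (fun x => c x k) (f k) t) (h : Admissible (c t))
    (y : Fin 2 → ℝ) :
    HasDerivAt (fun x => dLogLik e (c x) (stdize (c x) y))
      (ddLogLik e f (c t) (stdize (c t) y)) t := by
  have h1 := hasDerivAt_lam hc h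
  have h2 := hasDerivAt_dLam e hc h
  have h3 := hasDerivAt_kap hc h
  have h4 := hasDerivAt_quad hc h y
  have h5 := hasDerivAt_dQuad e hc h y
  have h6 := hasDerivAt_dT e hc h y
  have h7 : HasDerivAt (fun x => zeta1 (T (c x) (stdize (c x) y))) _ t :=
    (hasDerivAt_zeta1 _).comp t (hasDerivAt_T hc h y)
  have h8 : HasDerivAt (fun x => zeta1 (tau (c x))) _ t := (hasDerivAt_zeta1 _).comp t (hc 7)
  have h9 := hasDerivAt_isd1 hc h
  have h10 := hasDerivAt_isd2 hc h
  unfold dLogLik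
  refine HasDerivAt.congr_deriv (by
    repeat' first
      | exact hasDerivAt_const _ _
      | assumption
      | apply HasDerivAt.fun_pow
      | apply HasDerivAt.fun_sub
      | apply HasDerivAt.fun_add
      | apply HasDerivAt.fun_neg
      | apply HasDerivAt.fun_mul) ?_
  rw [ddLogLik]
  push_cast
  ring

end Derivatives

lemma hasDerivAt_update_coord (θ : Fin 8 → ℝ) (r k : Fin 8) :
    HasDerivAt (fun x => Function.update θ r x k) ((Pi.single r 1 : Fin 8 → ℝ) k) (θ r) :=
  hasDerivAt_pi.1 (hasDerivAt_update θ r (θ r)) k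

lemma pderiv_logLik {θ : Fin 8 → ℝ} (h : Admissible θ) (r : Fin 8) (y : Fin 2 → ℝ) :
    pderiv r (fun η => logLik η y) θ = dLogLik (Pi.single r 1) θ (stdize θ y) := by
  have := hasDerivAt_logLik (c := Function.update θ r) (hasDerivAt_update_coord θ r)
    (by rwa [Function.update_eq_self]) y
  rw [Function.update_eq_self] at this
  exact this.deriv

lemma hess_eq {θ : Fin 8 → ℝ} (h : Admissible θ) (r s : Fin 8) (y : Fin 2 → ℝ) :
    hess r s θ y = ddLogLik (Pi.single s 1) (Pi.single r 1) θ (stdize θ y) := by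
  have hc := hasDerivAt_update_coord θ r
  have h' : Admissible (Function.update θ r (θ r)) := by rwa [Function.update_eq_self]
  have := hasDerivAt_dLogLik (c := Function.update θ r) (Pi.single s 1) hc h' y
  rw [Function.update_eq_self] at this
  refine Filter.EventuallyEq.deriv_eq ?_ |>.trans this.deriv
  exact (eventually_admissible hc h').mono fun x hx => pderiv_logLik hx s y

lemma ddLogLik_comm (e f θ : Fin 8 → ℝ) (z : Fin 2 → ℝ) :
    ddLogLik e f θ z = ddLogLik f e θ z := by
  have e1 : ddLam e f θ = ddLam f e θ := by simp only [ddLam, dLam]; ring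
  have e2 : ddStd1 e f θ z = ddStd1 f e θ z := by simp only [ddStd1, dStd1]; ring
  have e3 : ddStd2 e f θ z = ddStd2 f e θ z := by simp only [ddStd2, dStd2]; ring
  simp only [ddLogLik, ddQuad, ddT, ddSStar, ddHalfAlphaSq, e1, e2, e3]
  ring

/-! ### Expectation of the second derivatives -/

/-- Coefficients of `dT` as an affine form in the standardized observation. -/
def dTCoeff (e θ : Fin 8 → ℝ) : Fin 3 → ℝ :=
  ![e 7 * sStar θ + tau θ * dSStar e θ - al1 θ * (e 0 * isd1 θ) - al2 θ * (e 1 * isd2 θ),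
    e 5 - al1 θ * (isd1 θ ^ 2 * e 2 / 2),
    e 6 - al2 θ * (isd2 θ ^ 2 * e 4 / 2)]

lemma dT_eq (e θ : Fin 8 → ℝ) (z : Fin 2 → ℝ) : dT e θ z = affForm (dTCoeff e θ) z := by
  simp [dT, dTCoeff, affForm, dStd1, dStd2]
  ring

/-- Coefficients of `ddT` as an affine form in the standardized observation. -/
def ddTCoeff (e f θ : Fin 8 → ℝ) : Fin 3 → ℝ :=
  ![e 7 * dSStar f θ + f 7 * dSStar e θ + tau θ * ddSStar e f θ -
      (e 5 * f 0 + f 5 * e 0) * isd1 θ - (e 6 * f 1 + f 6 * e 1) * isd2 θ +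
      al1 θ * isd1 θ ^ 3 / 2 * (e 0 * f 2 + e 2 * f 0) +
      al2 θ * isd2 θ ^ 3 / 2 * (e 1 * f 4 + e 4 * f 1),
    -(isd1 θ ^ 2 / 2 * (e 5 * f 2 + f 5 * e 2)) + al1 θ * (3 / 4 * isd1 θ ^ 4 * e 2 * f 2),
    -(isd2 θ ^ 2 / 2 * (e 6 * f 4 + f 6 * e 4)) + al2 θ * (3 / 4 * isd2 θ ^ 4 * e 4 * f 4)]

lemma ddT_eq (e f θ : Fin 8 → ℝ) (z : Fin 2 → ℝ) :
    ddT e f θ z = affForm (ddTCoeff e f θ) z := by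
  simp [ddT, ddTCoeff, affForm, dStd1, dStd2, ddStd1, ddStd2]
  ring

/-- The quadratic polynomial `k₀ + k₁ z₁ + k₂ z₂ + k₃ z₁² + k₄ z₁ z₂ + k₅ z₂²`. -/
def quadForm (k : Fin 6 → ℝ) (z : Fin 2 → ℝ) : ℝ :=
  k 0 + k 1 * z 0 + k 2 * z 1 + k 3 * z 0 ^ 2 + k 4 * (z 0 * z 1) + k 5 * z 1 ^ 2

/-- The expectation of `quadForm k Z`. -/
def meanQuadForm (k : Fin 6 → ℝ) (θ : Fin 8 → ℝ) : ℝ :=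
  k 0 + k 1 * meanZ1 θ + k 2 * meanZ2 θ + k 3 * meanZ1Sq θ + k 4 * meanZ1Z2 θ +
    k 5 * meanZ2Sq θ

/-- Coefficients of `dQuad`. -/
def dQuadCoeff (e θ : Fin 8 → ℝ) : Fin 6 → ℝ :=
  ![0, 2 * (lam θ * (e 1 * isd2 θ) - e 0 * isd1 θ), 2 * (lam θ * (e 0 * isd1 θ) - e 1 * isd2 θ),
    -(isd1 θ ^ 2 * e 2),
    lam θ * (isd1 θ ^ 2 * e 2 + isd2 θ ^ 2 * e 4) - 2 * dLam e θ,
    -(isd2 θ ^ 2 * e 4)]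

lemma dQuad_eq (e θ : Fin 8 → ℝ) (z : Fin 2 → ℝ) :
    dQuad e θ z = quadForm (dQuadCoeff e θ) z := by
  simp [dQuad, dQuadCoeff, quadForm, dStd1, dStd2]
  ring

/-- Coefficients of `ddQuad`. -/
def ddQuadCoeff (e f θ : Fin 8 → ℝ) : Fin 6 → ℝ :=
  ![2 * (e 0 * f 0 * isd1 θ ^ 2) + 2 * (e 1 * f 1 * isd2 θ ^ 2) -
      2 * (lam θ * (isd1 θ * isd2 θ * (e 0 * f 1 + e 1 * f 0))),
    2 * (isd1 θ ^ 3 * (e 0 * f 2 + e 2 * f 0)) +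
      2 * isd2 θ * (dLam e θ * f 1 + dLam f θ * e 1) -
      lam θ * (isd1 θ ^ 2 * isd2 θ * (e 2 * f 1 + f 2 * e 1) +
        isd2 θ ^ 3 * (e 1 * f 4 + e 4 * f 1)),
    2 * (isd2 θ ^ 3 * (e 1 * f 4 + e 4 * f 1)) +
      2 * isd1 θ * (dLam e θ * f 0 + dLam f θ * e 0) -
      lam θ * (isd2 θ ^ 2 * isd1 θ * (e 4 * f 0 + f 4 * e 0) +
        isd1 θ ^ 3 * (e 0 * f 2 + e 2 * f 0)),
    2 * (isd1 θ ^ 4 * e 2 * f 2),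
    -(2 * ddLam e f θ) + dLam e θ * (isd1 θ ^ 2 * f 2 + isd2 θ ^ 2 * f 4) +
      dLam f θ * (isd1 θ ^ 2 * e 2 + isd2 θ ^ 2 * e 4) -
      lam θ * (3 / 2 * (isd1 θ ^ 4 * e 2 * f 2 + isd2 θ ^ 4 * e 4 * f 4) +
        isd1 θ ^ 2 * isd2 θ ^ 2 / 2 * (e 2 * f 4 + f 2 * e 4)),
    2 * (isd2 θ ^ 4 * e 4 * f 4)]

lemma ddQuad_eq (e f θ : Fin 8 → ℝ) (z : Fin 2 → ℝ) :
    ddQuad e f θ z = quadForm (ddQuadCoeff e f θ) z := by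
  simp [ddQuad, ddQuadCoeff, quadForm, dStd1, dStd2, ddStd1, ddStd2]
  ring

/-- The expectation of `-ddLogLik e f θ Z`. -/
def infoForm (e f θ : Fin 8 → ℝ) : ℝ :=
  -(1 / 2 * (isd1 θ ^ 4 * e 2 * f 2 + isd2 θ ^ 4 * e 4 * f 4) +
    (kap θ + 2 * lam θ ^ 2 * kap θ ^ 2) * (dLam e θ * dLam f θ) + lam θ * kap θ * ddLam e f θ -
    ((kap θ ^ 2 + 4 * lam θ ^ 2 * kap θ ^ 3) * (dLam e θ * dLam f θ) +
      lam θ * kap θ ^ 2 * ddLam e f θ) * meanQuadForm ![0, 0, 0, 1, -(2 * lam θ), 1] θ -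
    lam θ * kap θ ^ 2 * (dLam e θ * meanQuadForm (dQuadCoeff f θ) θ +
      dLam f θ * meanQuadForm (dQuadCoeff e θ) θ) -
    1 / 2 * (kap θ * meanQuadForm (ddQuadCoeff e f θ) θ) +
    (dTCoeff e θ 0 * dTCoeff f θ 0 * meanZeta2 θ +
      (dTCoeff e θ 0 * dTCoeff f θ 1 + dTCoeff e θ 1 * dTCoeff f θ 0) * meanZ1Zeta2 θ +
      (dTCoeff e θ 0 * dTCoeff f θ 2 + dTCoeff e θ 2 * dTCoeff f θ 0) * meanZ2Zeta2 θ +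
      dTCoeff e θ 1 * dTCoeff f θ 1 * meanZ1SqZeta2 θ +
      (dTCoeff e θ 1 * dTCoeff f θ 2 + dTCoeff e θ 2 * dTCoeff f θ 1) * meanZ1Z2Zeta2 θ +
      dTCoeff e θ 2 * dTCoeff f θ 2 * meanZ2SqZeta2 θ) +
    (ddTCoeff e f θ 0 * meanZeta1 θ + ddTCoeff e f θ 1 * meanZ1Zeta1 θ +
      ddTCoeff e f θ 2 * meanZ2Zeta1 θ) -
    zeta2 (tau θ) * (e 7 * f 7))

section Expectation

variable {θ : Fin 8 → ℝ}

lemma hasInt_quadForm (h : Admissible θ) (k : Fin 6 → ℝ) :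
    HasInt (lawZ θ) (quadForm k) (meanQuadForm k θ) := by
  have := isProbabilityMeasure_lawZ h
  have h1 : HasInt (lawZ θ) _ _ := hasMean_Z1 h
  have h2 : HasInt (lawZ θ) _ _ := hasMean_Z2 h
  have h3 : HasInt (lawZ θ) _ _ := hasMean_Z1Sq h
  have h4 : HasInt (lawZ θ) _ _ := hasMean_Z1Z2 h
  have h5 : HasInt (lawZ θ) _ _ := hasMean_Z2Sq h
  exact ((((((HasInt.const (μ := lawZ θ) (k 0)).add (h1.const_mul (k 1))).add
    (h2.const_mul (k 2))).add (h3.const_mul (k 3))).add (h4.const_mul (k 4))).add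
    (h5.const_mul (k 5)))

lemma hasInt_zeta1_mul_affForm (h : Admissible θ) (p : Fin 3 → ℝ) :
    HasInt (lawZ θ) (fun z => zeta1 (T θ z) * affForm p z)
      (p 0 * meanZeta1 θ + p 1 * meanZ1Zeta1 θ + p 2 * meanZ2Zeta1 θ) := by
  have h1 : HasInt (lawZ θ) _ _ := hasMean_zeta1 h
  have h2 : HasInt (lawZ θ) _ _ := hasMean_Z1_zeta1 h
  have h3 : HasInt (lawZ θ) _ _ := hasMean_Z2_zeta1 h
  exact (((h1.const_mul (p 0)).add (h2.const_mul (p 1))).add (h3.const_mul (p 2))).congr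
    (fun z => by rw [affForm]; ring) rfl

lemma hasInt_zeta2_mul_affForm (h : Admissible θ) (p q : Fin 3 → ℝ) :
    HasInt (lawZ θ) (fun z => zeta2 (T θ z) * (affForm p z * affForm q z))
      (p 0 * q 0 * meanZeta2 θ + (p 0 * q 1 + p 1 * q 0) * meanZ1Zeta2 θ +
      (p 0 * q 2 + p 2 * q 0) * meanZ2Zeta2 θ + p 1 * q 1 * meanZ1SqZeta2 θ +
      (p 1 * q 2 + p 2 * q 1) * meanZ1Z2Zeta2 θ + p 2 * q 2 * meanZ2SqZeta2 θ) := by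
  have h1 : HasInt (lawZ θ) _ _ := hasMean_zeta2 h
  have h2 : HasInt (lawZ θ) _ _ := hasMean_Z1_zeta2 h
  have h3 : HasInt (lawZ θ) _ _ := hasMean_Z2_zeta2 h
  have h4 : HasInt (lawZ θ) _ _ := hasMean_Z1Sq_zeta2 h
  have h5 : HasInt (lawZ θ) _ _ := hasMean_Z1Z2_zeta2 h
  have h6 : HasInt (lawZ θ) _ _ := hasMean_Z2Sq_zeta2 h
  exact ((((((h1.const_mul (p 0 * q 0)).add (h2.const_mul (p 0 * q 1 + p 1 * q 0))).add
    (h3.const_mul (p 0 * q 2 + p 2 * q 0))).add (h4.const_mul (p 1 * q 1))).add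
    (h5.const_mul (p 1 * q 2 + p 2 * q 1))).add (h6.const_mul (p 2 * q 2))).congr
    (fun z => by simp only [affForm]; ring) rfl

lemma hasInt_ddLogLik (h : Admissible θ) (e f : Fin 8 → ℝ) :
    HasInt (lawZ θ) (ddLogLik e f θ) (-infoForm e f θ) := by
  have := isProbabilityMeasure_lawZ h
  have hq := hasInt_quadForm h ![0, 0, 0, 1, -(2 * lam θ), 1]
  have he := hasInt_quadForm h (dQuadCoeff e θ)
  have hf := hasInt_quadForm h (dQuadCoeff f θ)
  have hef := hasInt_quadForm h (ddQuadCoeff e f θ)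
  have h1 := hasInt_zeta1_mul_affForm h (ddTCoeff e f θ)
  have h2 := hasInt_zeta2_mul_affForm h (dTCoeff e θ) (dTCoeff f θ)
  have hc := HasInt.const (μ := lawZ θ)
  refine (((((((hc (1 / 2 * (isd1 θ ^ 4 * e 2 * f 2 + isd2 θ ^ 4 * e 4 * f 4) +
    (kap θ + 2 * lam θ ^ 2 * kap θ ^ 2) * (dLam e θ * dLam f θ) +
      lam θ * kap θ * ddLam e f θ)).sub
    (hq.const_mul ((kap θ ^ 2 + 4 * lam θ ^ 2 * kap θ ^ 3) * (dLam e θ * dLam f θ) +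
      lam θ * kap θ ^ 2 * ddLam e f θ))).sub
    (((hf.const_mul (dLam e θ)).add (he.const_mul (dLam f θ))).const_mul
      (lam θ * kap θ ^ 2))).sub
    ((hef.const_mul (kap θ)).const_mul (1 / 2))).add h2).add h1).sub
    (hc (zeta2 (tau θ) * (e 7 * f 7)))).congr (fun z => ?_) ?_
  · have : quadForm ![0, 0, 0, 1, -(2 * lam θ), 1] z = quad θ z := by
      simp [quadForm, quad]; ring
    rw [ddLogLik, ← dT_eq, ← dT_eq, ← ddT_eq, ← dQuad_eq, ← dQuad_eq, ← ddQuad_eq, this]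
  · rw [infoForm]; ring

/-- Expectations under the law of `Y = ξ + ω Z` are expectations under the law of `Z`. -/
lemma hasInt_lawY_iff (h : Admissible θ) {g : (Fin 2 → ℝ) → ℝ} (hg : Continuous g) {a : ℝ} :
    HasInt (lawY θ) (fun y => g (stdize θ y)) a ↔ HasInt (lawZ θ) g a := by
  have hm := (measurable_unstdize θ).aemeasurable (μ := lawZ θ)
  have hc : Continuous fun y => g (stdize θ y) := hg.comp (continuous_stdize θ)
  rw [HasInt, HasInt, lawY_eq_map h, integrable_map_measure hc.aestronglyMeasurable hm,
    integral_map hm hc.aestronglyMeasurable]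
  simp only [Function.comp_def, stdize_unstdize h]

lemma continuous_ddLogLik (e f : Fin 8 → ℝ) : Continuous (ddLogLik e f θ) := by
  have c1 := continuous_zeta1
  have c2 := continuous_zeta2
  have c3 := continuous_T θ
  unfold ddLogLik quad ddQuad dQuad dT ddT ddStd1 ddStd2 dStd1 dStd2
  fun_prop

lemma hasInt_hess (h : Admissible θ) (r s : Fin 8) :
    HasInt (lawY θ) (hess r s θ) (-infoForm (Pi.single r 1) (Pi.single s 1) θ) := by
  have : hess r s θ = fun y => ddLogLik (Pi.single r 1) (Pi.single s 1) θ (stdize θ y) :=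
    funext fun y => by rw [hess_eq h, ddLogLik_comm]
  rw [this, hasInt_lawY_iff h (continuous_ddLogLik _ _)]
  exact hasInt_ddLogLik h _ _

lemma expectedInfo_apply (h : Admissible θ) (r s : Fin 8) :
    expectedInfo θ r s = infoForm (Pi.single r 1) (Pi.single s 1) θ := by
  rw [expectedInfo, Matrix.of_apply, (hasInt_hess h r s).2, neg_neg]

lemma expectedInfo_comm (h : Admissible θ) (r s : Fin 8) :
    expectedInfo θ r s = expectedInfo θ s r := by
  have : hess r s θ = hess s r θ := funext fun y => by rw [hess_eq h, hess_eq h, ddLogLik_comm]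
  rw [expectedInfo, Matrix.of_apply, Matrix.of_apply, this]

end Expectation

/-! ### The entries of the information matrix -/

set_option maxHeartbeats 8000000 in
-- thirty-six rational identities, checked one after the other
/-- Both sides are rational functions of `√Ω₁₁`, `√Ω₂₂`, `λ`, `√(1 + α*²)`, the remaining parameters
and the moments, and they agree identically. -/
lemma infoForm_eq_infoMatrix {θ : Fin 8 → ℝ} (h : Admissible θ) (r s : Fin 8) (hrs : r ≤ s) :
    infoForm (Pi.single r 1) (Pi.single s 1) θ = infoMatrix θ r s := by
  have q1 := Real.sqrt_pos.2 h.1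
  have q2 := Real.sqrt_pos.2 h.2.1
  have e1 := Real.sq_sqrt h.1.le
  have e2 := Real.sq_sqrt h.2.1.le
  have e3 := Real.sqrt_mul h.1.le (Om22 θ)
  have hm : 1 - lam θ ^ 2 ≠ 0 := by linarith [sq_lam_lt_one h]
  have hs := sStar_pos h
  have hS := sStar_sq h
  fin_cases r <;> fin_cases s <;> first | exact absurd hrs (by decide) | skip
  all_goals
    simp [-mul_eq_mul_right_iff, -mul_eq_mul_left_iff, infoMatrix, infoForm, dLam,
      ddLam, dTCoeff, ddTCoeff, dQuadCoeff, ddQuadCoeff, meanQuadForm, dSStar, ddSStar, dHalfAlphaSq, ddHalfAlphaSq, ← hS, isd1, isd2,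
      kap, e3, i11, i12, i13, i14, i15, i16, i17, i18, i22, i23, i24, i25, i26, i27, i28, i33, i34,
      i35, i36, i37, i38, i44, i45, i46, i47, i48, i55, i56, i57, i58, i66, i67, i68, i77, i78, i88]
    generalize √(Om11 θ) = w1 at *
    generalize √(Om22 θ) = w2 at *
    try rw [← e1]
    try rw [← e2]
    field_simp
    try ring

lemma infoMatrix_comm (θ : Fin 8 → ℝ) (r s : Fin 8) : infoMatrix θ r s = infoMatrix θ s r := by
  fin_cases r <;> fin_cases s <;> rfl

/-! ### Regularity of the log-likelihood in the parameter -/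

section Regularity

variable {θ : Fin 8 → ℝ}

lemma contDiffAt_sqrt_Om11 (h : Admissible θ) : ContDiffAt ℝ 2 (fun η => √(Om11 η)) θ :=
  ContDiffAt.sqrt (by fun_prop) h.1.ne'

lemma contDiffAt_sqrt_Om22 (h : Admissible θ) : ContDiffAt ℝ 2 (fun η => √(Om22 η)) θ :=
  ContDiffAt.sqrt (by fun_prop) h.2.1.ne'

lemma contDiffAt_lam (h : Admissible θ) : ContDiffAt ℝ 2 lam θ := by
  have hp : 0 < Om11 θ * Om22 θ := mul_pos h.1 h.2.1
  exact ContDiffAt.div (by fun_prop) (ContDiffAt.sqrt (by fun_prop) hp.ne')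
    (Real.sqrt_pos.2 hp).ne'

lemma contDiffAt_sStar (h : Admissible θ) : ContDiffAt ℝ 2 sStar θ := by
  have := contDiffAt_lam h
  have hs := sStar_pos h
  refine ContDiffAt.sqrt (f := fun η => 1 + alphaStarSq η) ?_ ?_
  · unfold alphaStarSq; fun_prop
  · rw [← sStar_sq h]; positivity

lemma contDiffAt_kap (h : Admissible θ) : ContDiffAt ℝ 2 kap θ := by
  have := contDiffAt_lam h
  exact ContDiffAt.inv (by fun_prop) (by linarith [sq_lam_lt_one h])

lemma contDiffAt_std1 (h : Admissible θ) (y : Fin 2 → ℝ) :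
    ContDiffAt ℝ 2 (fun η => stdize η y 0) θ := by
  change ContDiffAt ℝ 2 (fun η : Fin 8 → ℝ => (y 0 - η 0) / √(Om11 η)) θ
  exact ContDiffAt.div (by fun_prop) (contDiffAt_sqrt_Om11 h) (Real.sqrt_pos.2 h.1).ne'

lemma contDiffAt_std2 (h : Admissible θ) (y : Fin 2 → ℝ) :
    ContDiffAt ℝ 2 (fun η => stdize η y 1) θ := by
  change ContDiffAt ℝ 2 (fun η : Fin 8 → ℝ => (y 1 - η 1) / √(Om22 η)) θ
  exact ContDiffAt.div (by fun_prop) (contDiffAt_sqrt_Om22 h) (Real.sqrt_pos.2 h.2.1).ne'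

lemma contDiffAt_logLik (h : Admissible θ) (y : Fin 2 → ℝ) :
    ContDiffAt ℝ 2 (fun η => logLik η y) θ := by
  have h1 := contDiffAt_lam h
  have h2 := contDiffAt_sStar h
  have h3 := contDiffAt_kap h
  have h4 := contDiffAt_std1 h y
  have h5 := contDiffAt_std2 h y
  have hq : ContDiffAt ℝ 2 (fun η => quad η (stdize η y)) θ := by unfold quad; fun_prop
  have hT : ContDiffAt ℝ 2 (fun η => T η (stdize η y)) θ := by unfold T alpha0; fun_prop
  have l1 : ContDiffAt ℝ 2 (fun η => Real.log (Om11 η)) θ :=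
    ContDiffAt.log (by fun_prop) h.1.ne'
  have l2 : ContDiffAt ℝ 2 (fun η => Real.log (Om22 η)) θ :=
    ContDiffAt.log (by fun_prop) h.2.1.ne'
  have l3 : ContDiffAt ℝ 2 (fun η => Real.log (1 - lam η ^ 2)) θ :=
    ContDiffAt.log (by fun_prop) (by linarith [sq_lam_lt_one h])
  have l4 : ContDiffAt ℝ 2 (fun η => Real.log (Phi (T η (stdize η y)))) θ :=
    contDiff_log_Phi.contDiffAt.comp θ hT
  have l5 : ContDiffAt ℝ 2 (fun η => Real.log (Phi (tau η))) θ :=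
    contDiff_log_Phi.contDiffAt.comp (f := tau) θ (by fun_prop)
  refine ContDiffAt.congr_of_eventuallyEq ?_
    (Filter.mem_of_superset (isOpen_admissible.mem_nhds h) fun η hη => logLik_eq hη y)
  fun_prop

end Regularity

/-! ### Domination by polynomials, locally uniformly in the parameter -/

/-- For `η` near `θ`, `|F η y|` is bounded by a fixed polynomial in `|y|`. -/
def PolyBdd (θ : Fin 8 → ℝ) (F : (Fin 8 → ℝ) → (Fin 2 → ℝ) → ℝ) : Prop :=
  ∃ C, 0 ≤ C ∧ ∃ n : ℕ, ∀ᶠ η in nhds θ, ∀ y, |F η y| ≤ C * weight y ^ n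

namespace PolyBdd

variable {θ : Fin 8 → ℝ} {F G : (Fin 8 → ℝ) → (Fin 2 → ℝ) → ℝ}

lemma of_continuousAt {b : (Fin 8 → ℝ) → ℝ} (hb : ContinuousAt b θ) :
    PolyBdd θ fun η _ => b η := by
  refine ⟨|b θ| + 1, by positivity, 0, ?_⟩
  have : ∀ᶠ η in nhds θ, |b η| < |b θ| + 1 :=
    hb.abs.eventually (gt_mem_nhds (by linarith))
  filter_upwards [this] with η hη y
  simpa using hη.le

lemma param (k : Fin 8) : PolyBdd θ fun η _ => η k :=
  of_continuousAt (continuous_apply k).continuousAt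

lemma add (hF : PolyBdd θ F) (hG : PolyBdd θ G) : PolyBdd θ fun η y => F η y + G η y := by
  obtain ⟨C, hC, n, h1⟩ := hF
  obtain ⟨D, hD, m, h2⟩ := hG
  refine ⟨C + D, by positivity, n + m, ?_⟩
  filter_upwards [h1, h2] with η h1 h2 y
  have hw := one_le_weight y
  calc |F η y + G η y| ≤ C * weight y ^ n + D * weight y ^ m :=
        (abs_add_le _ _).trans (add_le_add (h1 y) (h2 y))
    _ ≤ C * weight y ^ (n + m) + D * weight y ^ (n + m) := by
        gcongr <;> first | exact hw | omega
    _ = _ := by ring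

lemma neg (hF : PolyBdd θ F) : PolyBdd θ fun η y => -F η y := by
  obtain ⟨C, hC, n, h1⟩ := hF
  exact ⟨C, hC, n, by simpa using h1⟩

lemma sub (hF : PolyBdd θ F) (hG : PolyBdd θ G) : PolyBdd θ fun η y => F η y - G η y := by
  simpa [sub_eq_add_neg] using hF.add hG.neg

lemma mul (hF : PolyBdd θ F) (hG : PolyBdd θ G) : PolyBdd θ fun η y => F η y * G η y := by
  obtain ⟨C, hC, n, h1⟩ := hF
  obtain ⟨D, hD, m, h2⟩ := hG
  refine ⟨C * D, by positivity, n + m, ?_⟩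
  filter_upwards [h1, h2] with η h1 h2 y
  have hw := one_le_weight y
  calc |F η y * G η y| ≤ (C * weight y ^ n) * (D * weight y ^ m) := by
        rw [abs_mul]
        exact mul_le_mul (h1 y) (h2 y) (abs_nonneg _) (by positivity)
    _ = _ := by ring

lemma mono (hG : PolyBdd θ G) (h : ∀ η y, |F η y| ≤ G η y) : PolyBdd θ F := by
  obtain ⟨C, hC, n, h1⟩ := hG
  refine ⟨C, hC, n, ?_⟩
  filter_upwards [h1] with η h1 y
  exact (h η y).trans ((le_abs_self _).trans (h1 y))

lemma abs (hF : PolyBdd θ F) : PolyBdd θ fun η y => |F η y| := by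
  simpa [PolyBdd] using hF

lemma coord (i : Fin 2) : PolyBdd θ fun _ y => y i := by
  refine ⟨1, zero_le_one, 1, Filter.Eventually.of_forall fun η y => ?_⟩
  have h0 := abs_nonneg (y 0)
  have h1 := abs_nonneg (y 1)
  fin_cases i <;> simp [weight] <;> linarith

lemma zeta1_comp (hF : PolyBdd θ F) : PolyBdd θ fun η y => zeta1 (F η y) :=
  ((of_continuousAt (b := fun _ => Real.exp (3 / 2)) continuousAt_const).mul
    ((of_continuousAt (b := fun _ => 1) continuousAt_const).add hF.abs)).mono
    fun _ _ => abs_zeta1_le _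

lemma zeta2_comp (hF : PolyBdd θ F) : PolyBdd θ fun η y => zeta2 (F η y) := by
  have h1 := (of_continuousAt (b := fun _ => 1) continuousAt_const).add hF.abs
  exact ((of_continuousAt (b := fun _ => 2 * Real.exp 3) continuousAt_const).mul
    (h1.mul h1)).mono fun _ _ => (abs_zeta2_le _).trans_eq (by ring)

end PolyBdd

section Bounds

variable {θ : Fin 8 → ℝ}

lemma continuousAt_isd1 (h : Admissible θ) : ContinuousAt isd1 θ :=
  (contDiffAt_sqrt_Om11 h).continuousAt.inv₀ (Real.sqrt_pos.2 h.1).ne'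

lemma continuousAt_isd2 (h : Admissible θ) : ContinuousAt isd2 θ :=
  (contDiffAt_sqrt_Om22 h).continuousAt.inv₀ (Real.sqrt_pos.2 h.2.1).ne'

lemma polyBdd_std1 (h : Admissible θ) : PolyBdd θ fun η y => stdize η y 0 := by
  change PolyBdd θ fun η y => (y 0 - η 0) * isd1 η
  exact ((PolyBdd.coord 0).sub (.param 0)).mul
    (.of_continuousAt (continuousAt_isd1 h))

lemma polyBdd_std2 (h : Admissible θ) : PolyBdd θ fun η y => stdize η y 1 := by
  change PolyBdd θ fun η y => (y 1 - η 1) * isd2 η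
  exact ((PolyBdd.coord 1).sub (.param 1)).mul
    (.of_continuousAt (continuousAt_isd2 h))

lemma polyBdd_T (h : Admissible θ) : PolyBdd θ fun η y => T η (stdize η y) := by
  have h1 := polyBdd_std1 h
  have h2 := polyBdd_std2 h
  have c := (contDiffAt_sStar h).continuousAt
  unfold T
  exact (((PolyBdd.param 7).mul (.of_continuousAt c)).add
    ((PolyBdd.param 5).mul h1)).add
    ((PolyBdd.param 6).mul h2)

lemma continuousAt_dLam (h : Admissible θ) (e : Fin 8 → ℝ) : ContinuousAt (dLam e) θ := by
  have c1 := continuousAt_isd1 h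
  have c2 := continuousAt_isd2 h
  have c3 := (contDiffAt_lam h).continuousAt
  unfold dLam; fun_prop

lemma continuousAt_ddLam (h : Admissible θ) (e f : Fin 8 → ℝ) : ContinuousAt (ddLam e f) θ := by
  have c1 := continuousAt_isd1 h
  have c2 := continuousAt_isd2 h
  have c3 := (contDiffAt_lam h).continuousAt
  have c4 := continuousAt_dLam h f
  unfold ddLam; fun_prop

lemma continuousAt_inv_sStar (h : Admissible θ) : ContinuousAt (fun η => (sStar η)⁻¹) θ :=
  (contDiffAt_sStar h).continuousAt.inv₀ (sStar_pos h).ne'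

lemma continuousAt_dHalfAlphaSq (h : Admissible θ) (e : Fin 8 → ℝ) :
    ContinuousAt (dHalfAlphaSq e) θ := by
  have c3 := (contDiffAt_lam h).continuousAt
  have c4 := continuousAt_dLam h e
  unfold dHalfAlphaSq; fun_prop

lemma continuousAt_dSStar (h : Admissible θ) (e : Fin 8 → ℝ) : ContinuousAt (dSStar e) θ := by
  have c1 := continuousAt_inv_sStar h
  have c2 := continuousAt_dHalfAlphaSq h e
  unfold dSStar; fun_prop

lemma continuousAt_ddSStar (h : Admissible θ) (e f : Fin 8 → ℝ) :
    ContinuousAt (ddSStar e f) θ := by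
  have c1 := continuousAt_inv_sStar h
  have c2 := continuousAt_dHalfAlphaSq h e
  have c3 := continuousAt_dHalfAlphaSq h f
  have c4 := (contDiffAt_lam h).continuousAt
  have c5 := continuousAt_dLam h e
  have c6 := continuousAt_dLam h f
  have c7 := continuousAt_ddLam h e f
  unfold ddSStar ddHalfAlphaSq; fun_prop

lemma polyBdd_dStd1 (h : Admissible θ) (e : Fin 8 → ℝ) :
    PolyBdd θ fun η y => dStd1 e η (stdize η y) := by
  have c1 := continuousAt_isd1 h
  exact (PolyBdd.of_continuousAt (b := fun η => -(e 0 * isd1 η)) (by fun_prop)).sub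
    ((PolyBdd.of_continuousAt (b := fun η => isd1 η ^ 2 * e 2 / 2) (by fun_prop)).mul
      (polyBdd_std1 h))

lemma polyBdd_dStd2 (h : Admissible θ) (e : Fin 8 → ℝ) :
    PolyBdd θ fun η y => dStd2 e η (stdize η y) := by
  have c1 := continuousAt_isd2 h
  exact (PolyBdd.of_continuousAt (b := fun η => -(e 1 * isd2 η)) (by fun_prop)).sub
    ((PolyBdd.of_continuousAt (b := fun η => isd2 η ^ 2 * e 4 / 2) (by fun_prop)).mul
      (polyBdd_std2 h))

lemma polyBdd_ddStd1 (h : Admissible θ) (e f : Fin 8 → ℝ) :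
    PolyBdd θ fun η y => ddStd1 e f η (stdize η y) := by
  have c1 := continuousAt_isd1 h
  exact ((PolyBdd.of_continuousAt (b := fun η => e 0 * isd1 η ^ 3 * f 2 / 2) (by fun_prop)).add
    ((PolyBdd.of_continuousAt (b := fun η => isd1 η ^ 4 * e 2 * f 2 / 2) (by fun_prop)).mul
      (polyBdd_std1 h))).sub
    ((PolyBdd.of_continuousAt (b := fun η => isd1 η ^ 2 * e 2 / 2) (by fun_prop)).mul
      (polyBdd_dStd1 h f))

lemma polyBdd_ddStd2 (h : Admissible θ) (e f : Fin 8 → ℝ) :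
    PolyBdd θ fun η y => ddStd2 e f η (stdize η y) := by
  have c1 := continuousAt_isd2 h
  exact ((PolyBdd.of_continuousAt (b := fun η => e 1 * isd2 η ^ 3 * f 4 / 2) (by fun_prop)).add
    ((PolyBdd.of_continuousAt (b := fun η => isd2 η ^ 4 * e 4 * f 4 / 2) (by fun_prop)).mul
      (polyBdd_std2 h))).sub
    ((PolyBdd.of_continuousAt (b := fun η => isd2 η ^ 2 * e 4 / 2) (by fun_prop)).mul
      (polyBdd_dStd2 h f))

lemma polyBdd_dT (h : Admissible θ) (e : Fin 8 → ℝ) :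
    PolyBdd θ fun η y => dT e η (stdize η y) := by
  have h1 := polyBdd_std1 h
  have h2 := polyBdd_std2 h
  have h3 := polyBdd_dStd1 h e
  have h4 := polyBdd_dStd2 h e
  have c1 := (contDiffAt_sStar h).continuousAt
  have c2 := continuousAt_dSStar h e
  unfold dT
  repeat' first
    | assumption
    | exact PolyBdd.param _
    | exact PolyBdd.of_continuousAt (by fun_prop)
    | apply PolyBdd.add
    | apply PolyBdd.mul

lemma polyBdd_ddT (h : Admissible θ) (e f : Fin 8 → ℝ) :
    PolyBdd θ fun η y => ddT e f η (stdize η y) := by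
  have h3 := polyBdd_dStd1 h e
  have h4 := polyBdd_dStd2 h e
  have h5 := polyBdd_dStd1 h f
  have h6 := polyBdd_dStd2 h f
  have h7 := polyBdd_ddStd1 h e f
  have h8 := polyBdd_ddStd2 h e f
  have c1 := continuousAt_ddSStar h e f
  have c2 := continuousAt_dSStar h e
  have c3 := continuousAt_dSStar h f
  unfold ddT
  repeat' first
    | assumption
    | exact PolyBdd.param _
    | exact PolyBdd.of_continuousAt (by fun_prop)
    | apply PolyBdd.add
    | apply PolyBdd.mul

lemma polyBdd_quad (h : Admissible θ) : PolyBdd θ fun η y => quad η (stdize η y) := by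
  have h1 := polyBdd_std1 h
  have h2 := polyBdd_std2 h
  have c1 := (contDiffAt_lam h).continuousAt
  simp only [quad, sq]
  repeat' first
    | assumption
    | exact PolyBdd.param _
    | exact PolyBdd.of_continuousAt (by fun_prop)
    | apply PolyBdd.sub
    | apply PolyBdd.add
    | apply PolyBdd.mul

lemma polyBdd_dQuad (h : Admissible θ) (e : Fin 8 → ℝ) :
    PolyBdd θ fun η y => dQuad e η (stdize η y) := by
  have h1 := polyBdd_std1 h
  have h2 := polyBdd_std2 h
  have h3 := polyBdd_dStd1 h e
  have h4 := polyBdd_dStd2 h e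
  have c1 := (contDiffAt_lam h).continuousAt
  have c2 := continuousAt_dLam h e
  unfold dQuad
  repeat' first
    | assumption
    | exact PolyBdd.param _
    | exact PolyBdd.of_continuousAt (by fun_prop)
    | apply PolyBdd.sub
    | apply PolyBdd.add
    | apply PolyBdd.mul

lemma polyBdd_ddQuad (h : Admissible θ) (e f : Fin 8 → ℝ) :
    PolyBdd θ fun η y => ddQuad e f η (stdize η y) := by
  have h1 := polyBdd_std1 h
  have h2 := polyBdd_std2 h
  have h3 := polyBdd_dStd1 h e
  have h4 := polyBdd_dStd2 h e
  have h5 := polyBdd_dStd1 h f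
  have h6 := polyBdd_dStd2 h f
  have h7 := polyBdd_ddStd1 h e f
  have h8 := polyBdd_ddStd2 h e f
  have c1 := (contDiffAt_lam h).continuousAt
  have c2 := continuousAt_dLam h e
  have c3 := continuousAt_dLam h f
  have c4 := continuousAt_ddLam h e f
  unfold ddQuad
  repeat' first
    | assumption
    | exact PolyBdd.param _
    | exact PolyBdd.of_continuousAt (by fun_prop)
    | apply PolyBdd.sub
    | apply PolyBdd.add
    | apply PolyBdd.mul

lemma polyBdd_dLogLik (h : Admissible θ) (e : Fin 8 → ℝ) :
    PolyBdd θ fun η y => dLogLik e η (stdize η y) := by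
  have h1 := polyBdd_quad h
  have h2 := polyBdd_dQuad h e
  have h3 := (polyBdd_T h).zeta1_comp
  have h4 := polyBdd_dT h e
  have c1 := (contDiffAt_lam h).continuousAt
  have c2 := continuousAt_dLam h e
  have c3 := (contDiffAt_kap h).continuousAt
  have c4 := continuousAt_isd1 h
  have c5 := continuousAt_isd2 h
  have k7 := (PolyBdd.param (θ := θ) 7).zeta1_comp
  unfold dLogLik
  repeat' first
    | assumption
    | exact PolyBdd.param _
    | exact PolyBdd.of_continuousAt (by fun_prop)
    | apply PolyBdd.sub
    | apply PolyBdd.add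
    | apply PolyBdd.mul

lemma polyBdd_ddLogLik (h : Admissible θ) (e f : Fin 8 → ℝ) :
    PolyBdd θ fun η y => ddLogLik e f η (stdize η y) := by
  have h1 := polyBdd_quad h
  have h2 := polyBdd_dQuad h e
  have h3 := (polyBdd_T h).zeta1_comp
  have h4 := polyBdd_dT h e
  have h5 := polyBdd_dQuad h f
  have h6 := polyBdd_dT h f
  have h7 := polyBdd_ddQuad h e f
  have h8 := polyBdd_ddT h e f
  have h9 := (polyBdd_T h).zeta2_comp
  have c1 := (contDiffAt_lam h).continuousAt
  have c2 := continuousAt_dLam h e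
  have c3 := (contDiffAt_kap h).continuousAt
  have c4 := continuousAt_isd1 h
  have c5 := continuousAt_isd2 h
  have k7 := (PolyBdd.param (θ := θ) 7).zeta2_comp
  have c7 := continuousAt_dLam h f
  have c8 := continuousAt_ddLam h e f
  unfold ddLogLik
  repeat' first
    | assumption
    | exact PolyBdd.param _
    | exact PolyBdd.of_continuousAt (by fun_prop)
    | apply PolyBdd.sub
    | apply PolyBdd.add
    | apply PolyBdd.mul

lemma integrable_weight_pow_lawY (h : Admissible θ) (n : ℕ) :
    Integrable (fun y => weight y ^ n) (lawY θ) := by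
  have hm := (measurable_unstdize θ).aemeasurable (μ := lawZ θ)
  have hcw : Continuous fun y => weight y ^ n := continuous_weight.pow n
  rw [lawY_eq_map h, integrable_map_measure hcw.aestronglyMeasurable hm]
  have hcu : Continuous (unstdize θ) := by
    refine continuous_pi fun i => ?_
    fin_cases i <;> simp [unstdize] <;> fun_prop
  refine integrable_of_le_weight h (hcw.comp hcu) (n := n)
    (C := (1 + √(Om11 θ) + √(Om22 θ) + |θ 0| + |θ 1|) ^ n) fun z => ?_
  have hw := one_le_weight (unstdize θ z)
  rw [Function.comp_apply, abs_of_nonneg (by positivity), ← mul_pow]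
  gcongr
  have e1 : |√(Om11 θ) * z 0 + θ 0| ≤ √(Om11 θ) * |z 0| + |θ 0| := by
    refine (abs_add_le _ _).trans ?_
    rw [abs_mul, abs_of_nonneg (Real.sqrt_nonneg _)]
  have e2 : |√(Om22 θ) * z 1 + θ 1| ≤ √(Om22 θ) * |z 1| + |θ 1| := by
    refine (abs_add_le _ _).trans ?_
    rw [abs_mul, abs_of_nonneg (Real.sqrt_nonneg _)]
  have p1 := Real.sqrt_nonneg (Om11 θ)
  have p2 := Real.sqrt_nonneg (Om22 θ)
  simp only [weight, unstdize, Matrix.cons_val_zero, Matrix.cons_val_one]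
  have : 0 ≤ √(Om11 θ) * (1 + |z 1|) + √(Om22 θ) * (1 + |z 0|) +
      (1 + |θ 0| + |θ 1|) * (|z 0| + |z 1|) := by positivity
  linarith

end Bounds

/-! ### Positivity of the expected information -/

/-- The second-order necessary condition at a maximum, for a function given by an integral that may
be differentiated twice under the integral sign. -/
lemma integral_secondDeriv_nonpos {X : Type*} [MeasurableSpace X] {μ : Measure X}
    {F F' F'' : ℝ → X → ℝ} {ε : ℝ} (hε : 0 < ε) {b₁ b₂ : X → ℝ}
    (hF : ∀ t ∈ Metric.ball (0 : ℝ) ε, AEStronglyMeasurable (F t) μ)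
    (hF' : ∀ t ∈ Metric.ball (0 : ℝ) ε, AEStronglyMeasurable (F' t) μ)
    (hF'' : AEStronglyMeasurable (F'' 0) μ) (hF0 : ∀ y, F 0 y = 0)
    (hd₁ : ∀ y, ∀ t ∈ Metric.ball (0 : ℝ) ε, HasDerivAt (F · y) (F' t y) t)
    (hd₂ : ∀ y, ∀ t ∈ Metric.ball (0 : ℝ) ε, HasDerivAt (F' · y) (F'' t y) t)
    (hb₁ : ∀ y, ∀ t ∈ Metric.ball (0 : ℝ) ε, |F' t y| ≤ b₁ y)
    (hb₂ : ∀ y, ∀ t ∈ Metric.ball (0 : ℝ) ε, |F'' t y| ≤ b₂ y)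
    (hi₁ : Integrable b₁ μ) (hi₂ : Integrable b₂ μ)
    (hmax : ∀ t ∈ Metric.ball (0 : ℝ) ε, Integrable (F t) μ → ∫ y, F t y ∂μ ≤ 0) :
    ∫ y, F'' 0 y ∂μ ≤ 0 := by
  have h0 : (0 : ℝ) ∈ Metric.ball (0 : ℝ) ε := Metric.mem_ball_self hε
  have hn : ∀ t ∈ Metric.ball (0 : ℝ) ε, Metric.ball (0 : ℝ) ε ∈ nhds t :=
    fun t ht => Metric.isOpen_ball.mem_nhds ht
  have hint : ∀ t ∈ Metric.ball (0 : ℝ) ε, Integrable (F t) μ := by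
    intro t ht
    refine (hi₁.mul_const ‖t - 0‖).mono' (hF t ht) (Filter.Eventually.of_forall fun y => ?_)
    have := (convex_ball (0 : ℝ) ε).norm_image_sub_le_of_norm_hasDerivWithin_le
      (fun x hx => (hd₁ y x hx).hasDerivWithinAt) (hb₁ y) h0 ht
    simpa [hF0] using this
  have hD₁ : ∀ t ∈ Metric.ball (0 : ℝ) ε,
      Integrable (F' t) μ ∧ HasDerivAt (fun t => ∫ y, F t y ∂μ) (∫ y, F' t y ∂μ) t := by
    intro t ht
    exact hasDerivAt_integral_of_dominated_loc_of_deriv_le (hn t ht)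
      (Filter.mem_of_superset (hn t ht) hF) (hint t ht) (hF' t ht)
      (Filter.Eventually.of_forall hb₁) hi₁ (Filter.Eventually.of_forall hd₁)
  have hD₂ : HasDerivAt (fun t => ∫ y, F' t y ∂μ) (∫ y, F'' 0 y ∂μ) 0 :=
    (hasDerivAt_integral_of_dominated_loc_of_deriv_le (hn 0 h0)
      (Filter.mem_of_superset (hn 0 h0) hF') (hD₁ 0 h0).1 hF''
      (Filter.Eventually.of_forall hb₂) hi₂ (Filter.Eventually.of_forall hd₂)).2
  set G : ℝ → ℝ := fun t => ∫ y, F t y ∂μ with hG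
  have hG0 : G 0 = 0 := by simp [hG, hF0]
  have hmaxG : IsLocalMax G 0 := by
    refine Filter.mem_of_superset (hn 0 h0) fun t ht => ?_
    change G t ≤ G 0
    rw [hG0]
    exact hmax t ht (hint t ht)
  have hdG : deriv G =ᶠ[nhds 0] fun t => ∫ y, F' t y ∂μ :=
    Filter.mem_of_superset (hn 0 h0) fun t ht => (hD₁ t ht).2.deriv
  have hddG : deriv (deriv G) 0 = ∫ y, F'' 0 y ∂μ := hdG.deriv_eq.trans hD₂.deriv
  by_contra! hpos
  -- a positive second derivative would make the maximum a minimum as well, hence `G` constant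
  have hmin : IsLocalMin G 0 := isLocalMin_of_deriv_deriv_pos (by rw [hddG]; exact hpos)
    hmaxG.deriv_eq_zero (hD₁ 0 h0).2.continuousAt
  have hconst : G =ᶠ[nhds 0] fun _ => G 0 := by
    filter_upwards [hmaxG, hmin] with t h1 h2 using le_antisymm h1 h2
  have hz : deriv (deriv G) 0 = 0 := by
    have h1 : deriv G =ᶠ[nhds 0] deriv fun _ => G 0 := hconst.deriv
    rw [h1.deriv_eq]
    simp
  rw [hddG] at hz
  exact hpos.ne' hz

section

variable {θ : Fin 8 → ℝ}

lemma density_pos (h : Admissible θ) (y : Fin 2 → ℝ) :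
    0 < density (xi θ) (Omega θ) (alpha θ) (tau θ) y := by
  have q1 := Real.sqrt_pos.2 h.1
  have q2 := Real.sqrt_pos.2 h.2.1
  have := normalDensity_pos h (stdize θ y)
  have := Phi_pos (T θ (stdize θ y))
  have := Phi_pos (tau θ)
  rw [density_eq_stdized h, density_stdized h]
  positivity

lemma hasInt_density (h : Admissible θ) :
    HasInt volume (density (xi θ) (Omega θ) (alpha θ) (tau θ)) 1 := by
  have hp := isProbabilityMeasure_lawY h
  have hc := continuous_density h
  have hnn : 0 ≤ᵐ[volume] density (xi θ) (Omega θ) (alpha θ) (tau θ) :=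
    Filter.Eventually.of_forall fun y => (density_pos h y).le
  have h1 : ∫⁻ y, ENNReal.ofReal (density (xi θ) (Omega θ) (alpha θ) (tau θ) y) = 1 := by
    have := hp.measure_univ
    rwa [lawY, law, withDensity_apply _ .univ, Measure.restrict_univ] at this
  constructor
  · refine ⟨hc.aestronglyMeasurable, ?_⟩
    rw [hasFiniteIntegral_iff_ofReal hnn, h1]
    exact ENNReal.one_lt_top
  · rw [integral_eq_lintegral_of_nonneg_ae hnn hc.aestronglyMeasurable, h1, ENNReal.toReal_one]

lemma continuous_logLik (h : Admissible θ) : Continuous (logLik θ) :=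
  (continuous_density h).log fun y => (density_pos h y).ne'

/-- Gibbs' inequality: the expected log-likelihood is maximal at the true parameter. -/
lemma integral_logLik_sub_le {η : Fin 8 → ℝ} (h : Admissible θ) (hη : Admissible η)
    (hi : Integrable (fun y => logLik η y - logLik θ y) (lawY θ)) :
    ∫ y, (logLik η y - logLik θ y) ∂(lawY θ) ≤ 0 := by
  have := isProbabilityMeasure_lawY h
  set f := density (xi θ) (Omega θ) (alpha θ) (tau θ) with hf
  set g := density (xi η) (Omega η) (alpha η) (tau η) with hg
  have hf0 : ∀ y, 0 < f y := density_pos h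
  have hg0 : ∀ y, 0 < g y := density_pos hη
  have hm : Measurable fun y => ENNReal.ofReal (f y) :=
    (continuous_density h).measurable.ennreal_ofReal
  have hlt : ∀ᵐ y ∂(volume : Measure (Fin 2 → ℝ)), ENNReal.ofReal (f y) < ⊤ :=
    Filter.Eventually.of_forall fun _ => ENNReal.ofReal_lt_top
  have e : ∀ y, (ENNReal.ofReal (f y)).toReal • (g y / f y) = g y := by
    intro y
    rw [ENNReal.toReal_ofReal (hf0 y).le, smul_eq_mul, mul_div_cancel₀ _ (hf0 y).ne']
  have hr : HasInt (lawY θ) (fun y => g y / f y) 1 := by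
    constructor
    · rw [lawY, law, integrable_withDensity_iff_integrable_smul' hm hlt]
      exact (hasInt_density hη).1.congr (Filter.Eventually.of_forall fun y => (e y).symm)
    · rw [lawY, law, integral_withDensity_eq_integral_toReal_smul hm hlt]
      exact (integral_congr_ae (Filter.Eventually.of_forall e)).trans (hasInt_density hη).2
  have hr1 := hr.sub (HasInt.const (μ := lawY θ) 1)
  rw [sub_self] at hr1
  rw [← hr1.2]
  refine integral_mono hi hr1.1 fun y => ?_
  have hq : 0 < g y / f y := div_pos (hg0 y) (hf0 y)
  have := Real.log_le_sub_one_of_pos hq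
  rwa [Real.log_div (hg0 y).ne' (hf0 y).ne'] at this

lemma continuous_dLogLik (e : Fin 8 → ℝ) : Continuous (dLogLik e θ) := by
  have c1 := continuous_zeta1
  have c3 := continuous_T θ
  unfold dLogLik quad dQuad dT dStd1 dStd2
  fun_prop

/-- The Hessian of the expected log-likelihood at its maximum is negative semidefinite. -/
lemma infoForm_self_nonneg (h : Admissible θ) (u : Fin 8 → ℝ) : 0 ≤ infoForm u u θ := by
  set c : ℝ → Fin 8 → ℝ := fun t => θ + t • u with hc
  have hc0 : c 0 = θ := by simp [hc]
  have hcd : ∀ t k, HasDerivAt (fun x => c x k) (u k) t := by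
    intro t k
    simpa [hc] using ((hasDerivAt_id t).mul_const (u k)).const_add (θ k)
  have hct : Filter.Tendsto c (nhds 0) (nhds θ) := by
    have : Continuous c := by fun_prop
    simpa [hc0] using this.tendsto 0
  obtain ⟨C₁, -, n₁, hb₁⟩ := polyBdd_dLogLik h u
  obtain ⟨C₂, -, n₂, hb₂⟩ := polyBdd_ddLogLik h u u
  have hev : ∀ᶠ η in nhds θ, Admissible η := isOpen_admissible.mem_nhds h
  obtain ⟨ε, hε, hball⟩ := Metric.eventually_nhds_iff_ball.1
    (hct.eventually (hev.and (hb₁.and hb₂)))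
  have hA : ∀ t ∈ Metric.ball (0 : ℝ) ε, Admissible (c t) := fun t ht => (hball t ht).1
  have key : ∫ y, ddLogLik u u (c 0) (stdize (c 0) y) ∂(lawY θ) ≤ 0 := by
    refine integral_secondDeriv_nonpos (F := fun t y => logLik (c t) y - logLik θ y)
      (F' := fun t y => dLogLik u (c t) (stdize (c t) y))
      (F'' := fun t y => ddLogLik u u (c t) (stdize (c t) y)) hε
      (b₁ := fun y => C₁ * weight y ^ n₁) (b₂ := fun y => C₂ * weight y ^ n₂)
      ?_ ?_ ?_ ?_ ?_ ?_ ?_ ?_ ?_ ?_ ?_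
    · exact fun t ht => ((continuous_logLik (hA t ht)).sub
        (continuous_logLik h)).aestronglyMeasurable
    · exact fun t _ => ((continuous_dLogLik u).comp
        (continuous_stdize (c t))).aestronglyMeasurable
    · exact ((continuous_ddLogLik u u).comp (continuous_stdize (c 0))).aestronglyMeasurable
    · simp [hc0]
    · exact fun y t ht => (hasDerivAt_logLik (hcd t) (hA t ht) y).sub_const _
    · exact fun y t ht => hasDerivAt_dLogLik u (hcd t) (hA t ht) y
    · exact fun y t ht => (hball t ht).2.1 y
    · exact fun y t ht => (hball t ht).2.2 y
    · exact (integrable_weight_pow_lawY h n₁).const_mul C₁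
    · exact (integrable_weight_pow_lawY h n₂).const_mul C₂
    · exact fun t ht hi => integral_logLik_sub_le h (hA t ht) hi
  rw [hc0, ((hasInt_lawY_iff h (continuous_ddLogLik u u)).2 (hasInt_ddLogLik h u u)).2] at key
  linarith

lemma infoForm_comm (h : Admissible θ) (e f : Fin 8 → ℝ) : infoForm e f θ = infoForm f e θ := by
  have h1 := (hasInt_ddLogLik h e f).2
  have h2 := (hasInt_ddLogLik h f e).2
  rw [funext (ddLogLik_comm e f θ)] at h1
  linarith

lemma isLinearMap_infoForm (f : Fin 8 → ℝ) : IsLinearMap ℝ fun e => infoForm e f θ := by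
  constructor
  · intro e e'
    simp [infoForm, dLam, ddLam, dTCoeff, ddTCoeff, dQuadCoeff, ddQuadCoeff, meanQuadForm,
      dSStar, ddSStar, dHalfAlphaSq, ddHalfAlphaSq]
    ring
  · intro a e
    simp [infoForm, dLam, ddLam, dTCoeff, ddTCoeff, dQuadCoeff, ddQuadCoeff, meanQuadForm,
      dSStar, ddSStar, dHalfAlphaSq, ddHalfAlphaSq]
    ring

lemma infoForm_eq_sum (h : Admissible θ) (u : Fin 8 → ℝ) :
    infoForm u u θ =
      ∑ r, u r * ∑ s, infoForm (Pi.single r 1) (Pi.single s 1) θ * u s := by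
  have lin : ∀ f, infoForm u f θ = ∑ r, u r * infoForm (Pi.single r 1) f θ := by
    intro f
    have hu : u = ∑ r, u r • (Pi.single r (1 : ℝ) : Fin 8 → ℝ) := by
      simpa using pi_eq_sum_univ' u
    conv_lhs => rw [hu]
    exact (map_sum ((isLinearMap_infoForm (θ := θ) f).mk' _) _ _).trans
      (Finset.sum_congr rfl fun r _ => (isLinearMap_infoForm f).map_smul (u r) _)
  rw [lin u]
  refine Finset.sum_congr rfl fun r _ => ?_
  rw [infoForm_comm h, lin]
  congr 1
  refine Finset.sum_congr rfl fun s _ => ?_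
  rw [infoForm_comm h, mul_comm]

lemma posSemidef_expectedInfo (h : Admissible θ) : (expectedInfo θ).PosSemidef := by
  refine Matrix.PosSemidef.of_dotProduct_mulVec_nonneg ?_ fun u => ?_
  · ext r s
    simpa using expectedInfo_comm h s r
  · have := infoForm_self_nonneg h u
    rw [infoForm_eq_sum h] at this
    simpa [dotProduct, Matrix.mulVec, expectedInfo_apply h] using this

end

end ESN2

end

theorem mainTheorem6 (θ : Fin 8 → ℝ) (hΩ : (ESN2.Omega θ).PosDef) :
    -- regularity of the log-likelihood, and existence of all expectations
    IsProbabilityMeasure (ESN2.lawY θ) ∧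
    (∀ y, ContDiffAt ℝ 2 (fun η => ESN2.logLik η y) θ) ∧
    (∀ r s, Integrable (ESN2.hess r s θ) (ESN2.lawY θ)) ∧
    Integrable (fun z => ESN2.zeta1 (ESN2.T θ z) ^ 2) (ESN2.lawZ θ) ∧
    (∀ j, ∀ p ≤ 2, Integrable (fun z => z j ^ p * ESN2.zeta1 (ESN2.T θ z) ^ 2) (ESN2.lawZ θ)) ∧
    (∀ i j, Integrable (fun z => z i * z j * ESN2.zeta1 (ESN2.T θ z) ^ 2) (ESN2.lawZ θ)) ∧
    -- the moments used in the entries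
    ESN2.HasMean (ESN2.lawZ θ) (fun z => z 0) (ESN2.meanZ1 θ) ∧
    ESN2.HasMean (ESN2.lawZ θ) (fun z => z 1) (ESN2.meanZ2 θ) ∧
    ESN2.HasMean (ESN2.lawZ θ) (fun z => z 0 * z 1) (ESN2.meanZ1Z2 θ) ∧
    ESN2.HasMean (ESN2.lawZ θ) (fun z => z 0 ^ 2) (ESN2.meanZ1Sq θ) ∧
    ESN2.HasMean (ESN2.lawZ θ) (fun z => z 1 ^ 2) (ESN2.meanZ2Sq θ) ∧
    ESN2.HasMean (ESN2.lawZ θ) (fun z => ESN2.zeta1 (ESN2.T θ z)) (ESN2.meanZeta1 θ) ∧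
    ESN2.HasMean (ESN2.lawZ θ) (fun z => z 0 * ESN2.zeta1 (ESN2.T θ z)) (ESN2.meanZ1Zeta1 θ) ∧
    ESN2.HasMean (ESN2.lawZ θ) (fun z => z 1 * ESN2.zeta1 (ESN2.T θ z)) (ESN2.meanZ2Zeta1 θ) ∧
    ESN2.HasMean (ESN2.lawZ θ) (fun z => ESN2.zeta2 (ESN2.T θ z)) (ESN2.meanZeta2 θ) ∧
    ESN2.HasMean (ESN2.lawZ θ) (fun z => z 0 * ESN2.zeta2 (ESN2.T θ z)) (ESN2.meanZ1Zeta2 θ) ∧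
    ESN2.HasMean (ESN2.lawZ θ) (fun z => z 1 * ESN2.zeta2 (ESN2.T θ z)) (ESN2.meanZ2Zeta2 θ) ∧
    ESN2.HasMean (ESN2.lawZ θ) (fun z => z 0 ^ 2 * ESN2.zeta2 (ESN2.T θ z))
      (ESN2.meanZ1SqZeta2 θ) ∧
    ESN2.HasMean (ESN2.lawZ θ) (fun z => z 1 ^ 2 * ESN2.zeta2 (ESN2.T θ z))
      (ESN2.meanZ2SqZeta2 θ) ∧
    ESN2.HasMean (ESN2.lawZ θ) (fun z => z 0 * z 1 * ESN2.zeta2 (ESN2.T θ z))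
      (ESN2.meanZ1Z2Zeta2 θ) ∧
    -- the expected information matrix
    ESN2.expectedInfo θ = ESN2.infoMatrix θ ∧
    (ESN2.infoMatrix θ).PosSemidef := by
  have h := ESN2.admissible_of_posDef hΩ
  have hinfo : ESN2.expectedInfo θ = ESN2.infoMatrix θ := by
    ext r s
    rcases le_total r s with hrs | hrs
    · rw [ESN2.expectedInfo_apply h, ESN2.infoForm_eq_infoMatrix h r s hrs]
    · rw [ESN2.expectedInfo_comm h, ESN2.expectedInfo_apply h,
        ESN2.infoForm_eq_infoMatrix h s r hrs, ESN2.infoMatrix_comm]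
  exact ⟨ESN2.isProbabilityMeasure_lawY h, ESN2.contDiffAt_logLik h,
    fun r s => (ESN2.hasInt_hess h r s).1, ESN2.integrable_zeta1_sq h,
    fun j p hp => ESN2.integrable_pow_mul_zeta1_sq h j hp, ESN2.integrable_coord_mul_zeta1_sq h,
    ESN2.hasMean_Z1 h, ESN2.hasMean_Z2 h, ESN2.hasMean_Z1Z2 h, ESN2.hasMean_Z1Sq h,
    ESN2.hasMean_Z2Sq h, ESN2.hasMean_zeta1 h, ESN2.hasMean_Z1_zeta1 h, ESN2.hasMean_Z2_zeta1 h,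
    ESN2.hasMean_zeta2 h, ESN2.hasMean_Z1_zeta2 h, ESN2.hasMean_Z2_zeta2 h,
    ESN2.hasMean_Z1Sq_zeta2 h, ESN2.hasMean_Z2Sq_zeta2 h, ESN2.hasMean_Z1Z2_zeta2 h,
    hinfo, hinfo ▸ ESN2.posSemidef_expectedInfo h⟩
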